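/- Let $K$ be an algebraically closed field of characteristic zero and let $X\subset\mathbb{P}^5_K$ be the Büchi K3 surface, defined by $$x_{i+2}^2-2x_{i+1}^2+x_i^2-2x_0^2=0,\qquad i=1,2,3.$$ If $Q$ is a quadratic form of rank four vanishing on $X$, write $Q=\ell_0\ell_3-\ell_1\ell_2$ with linearly independent linear forms $\ell_0,\dots,\ell_3$; the map $X\to\mathbb{P}^1$, $x\mapsto[\ell_0(x):\ell_1(x)]=[\ell_2(x):\ell_3(x)]$, is called a pencil on $X$ arising from $Q$ (up to automorphisms of $\mathbb{P}^1$ there are two of them, corresponding to the two rulings of the quadric surface over which $\{Q=0\}$ is a cone). Such a pencil is called elliptic if it is everywhere defined on $X$ and all but finitely many of its scheme-theoretic fibers are smooth irreducible curves of genus one. A fiber is of type $I_2$ if, as a divisor on $X$, it is $C_1+C_2$ with $C_1,C_2$ smooth rational curves meeting transversally in exactly two points. (1) Let $C\subset X$ be a conic (a smooth plane conic or, more generally, a union of two distinct coplanar lines). Then there is an elliptic pencil on $X$, arising from a quadric of rank four containing $X$, that has a reducible fiber containing $C$. (2) Conversely, for every pencil on $X$ arising from a quadric of rank four containing $X$,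 every fiber of type $I_2$ is the union of two distinct smooth conics. -/

import Mathlib

open scoped LinearAlgebra.Projectivization

noncomputable section

namespace Buchi

variable (K : Type*) [Field K]

/-- Projective five-space over `K` (its set of `K`-points). -/
abbrev P5 : Type _ := ℙ K (Fin 6 → K)

/-- The projective line over `K`. -/
abbrev P1 : Type _ := ℙ K (Fin 2 → K)

variable {K}

/-! ### Projective sets -/

/-- The zero locus in projective space of a set of polynomials.  It is only ever used for
homogeneous polynomials, for which it does not depend on the chosen representatives. -/
def zeroLocus (S : Set (MvPolynomial (Fin 6) K)) : Set (P5 K) :=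
  {p | ∀ f ∈ S, MvPolynomial.eval p.rep f = 0}

/-- Zariski closed subsets of projective space. -/
def IsZariskiClosed (Z : Set (P5 K)) : Prop :=
  ∃ S : Set (MvPolynomial (Fin 6) K), (∀ f ∈ S, ∃ n, f.IsHomogeneous n) ∧ Z = zeroLocus S

/-- `Z` is reducible: it is the union of two proper Zariski closed subsets. -/
def IsReducible (Z : Set (P5 K)) : Prop :=
  ∃ A B : Set (P5 K), IsZariskiClosed A ∧ IsZariskiClosed B ∧ A ≠ Z ∧ B ≠ Z ∧ Z = A ∪ B

/-- All homogeneous polynomials that vanish on `Z`. -/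
def formsVanishingOn (Z : Set (P5 K)) : Set (MvPolynomial (Fin 6) K) :=
  {f | (∃ n, f.IsHomogeneous n) ∧ ∀ p ∈ Z, MvPolynomial.eval p.rep f = 0}

/-- The tangent space at `p.rep` of the affine cone defined by the homogeneous polynomials in `S`.
If `p` is a zero of `S`, it contains the line `p.submodule`, and the quotient by this line is the
Zariski tangent space at `p` of the projective scheme defined by `S`; so that scheme has a Zariski
tangent space of dimension `m` at `p` if and only if this space has dimension `m + 1`. -/
def coneTangent (S : Set (MvPolynomial (Fin 6) K)) (p : P5 K) : Submodule K (Fin 6 → K) :=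
  ⨅ f ∈ S, LinearMap.ker
    (∑ i, MvPolynomial.eval p.rep (MvPolynomial.pderiv i f) •
      (LinearMap.proj i : (Fin 6 → K) →ₗ[K] K))

/-- The linear space of all polynomials vanishing at the representatives of the points of `Z`. -/
def vanishingSubmodule (Z : Set (P5 K)) : Submodule K (MvPolynomial (Fin 6) K) :=
  ⨅ p ∈ Z, LinearMap.ker (MvPolynomial.aeval (R := K) p.rep).toLinearMap

/-- The Hilbert function of `Z`: the dimension of the degree `n` part of its homogeneous
coordinate ring. -/
def hilbertFunction (Z : Set (P5 K)) (n : ℕ) : ℕ :=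
  Module.finrank K
    ((MvPolynomial.homogeneousSubmodule (Fin 6) K n) ⧸
      (vanishingSubmodule Z).comap (MvPolynomial.homogeneousSubmodule (Fin 6) K n).subtype)

/-- `C` is a smooth irreducible projective curve of genus `g`: its Hilbert polynomial is
`d n + 1 - g` with `d > 0` (the degree of the curve). -/
def IsSmoothCurveOfGenus (g : ℕ) (C : Set (P5 K)) : Prop :=
  IsZariskiClosed C ∧ C.Nonempty ∧ ¬ IsReducible C ∧
  (∃ d : ℕ, 0 < d ∧
    ∀ᶠ n : ℕ in Filter.atTop, (hilbertFunction C n : ℤ) = d * n + 1 - g) ∧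
  ∀ p ∈ C, Module.finrank K (coneTangent (formsVanishingOn C) p) = 2

/-! ### Conics -/

/-- The curve in the plane `ℙ(W)` defined by the quadratic form `q`. -/
def planeConic (W : Submodule K (Fin 6 → K)) (q : QuadraticForm K W) : Set (P5 K) :=
  {p | ∃ h : p.rep ∈ W, q ⟨p.rep, h⟩ = 0}

/-- The rank of a quadratic form (in characteristic different from two). -/
def quadRank {V : Type*} [AddCommGroup V] [Module K V] (q : QuadraticForm K V) : ℕ :=
  Module.finrank K (LinearMap.range q.polarBilin)

/-- `C` is a reduced plane conic: a smooth conic or the union of two distinct coplanar lines. -/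
def IsConic (C : Set (P5 K)) : Prop :=
  ∃ (W : Submodule K (Fin 6 → K)) (q : QuadraticForm K W),
    Module.finrank K W = 3 ∧ 2 ≤ quadRank q ∧ C = planeConic W q

/-- `C` is a smooth (equivalently, irreducible) plane conic. -/
def IsSmoothConic (C : Set (P5 K)) : Prop :=
  ∃ (W : Submodule K (Fin 6 → K)) (q : QuadraticForm K W),
    Module.finrank K W = 3 ∧ quadRank q = 3 ∧ C = planeConic W q

variable (K) in
/-- The equations `x_{i+2}^2 - 2 x_{i+1}^2 + x_i^2 - 2 x_0^2`, `i = 1, 2, 3`. -/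
def buchiEquations : Set (MvPolynomial (Fin 6) K) :=
  {MvPolynomial.X 3 ^ 2 - 2 * MvPolynomial.X 2 ^ 2 + MvPolynomial.X 1 ^ 2
      - 2 * MvPolynomial.X 0 ^ 2,
   MvPolynomial.X 4 ^ 2 - 2 * MvPolynomial.X 3 ^ 2 + MvPolynomial.X 2 ^ 2
      - 2 * MvPolynomial.X 0 ^ 2,
   MvPolynomial.X 5 ^ 2 - 2 * MvPolynomial.X 4 ^ 2 + MvPolynomial.X 3 ^ 2
      - 2 * MvPolynomial.X 0 ^ 2}

variable (K) in
/-- The Büchi K3 surface. -/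
def buchiK3 : Set (P5 K) := zeroLocus (buchiEquations K)

/-! ### The pencils attached to quadrics of rank four -/

/-- `Q` defines a quadric of rank four containing the Büchi K3 surface. -/
def IsRankFourQuadricThroughX (Q : QuadraticForm K (Fin 6 → K)) : Prop :=
  quadRank Q = 4 ∧ ∀ p ∈ buchiK3 K, Q p.rep = 0

/-- The linear form with coefficient vector `a`. -/
def linearForm (a : Fin 6 → K) : MvPolynomial (Fin 6) K :=
  ∑ i, MvPolynomial.C (a i) * MvPolynomial.X i

/-- A ruling of the quadric of rank four `Q`: independent linear forms `ℓ₀, ℓ₁, ℓ₂, ℓ₃` with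
`Q = ℓ₀ ℓ₃ - ℓ₁ ℓ₂`.  Projecting from the vertex `ℓ₀ = ℓ₁ = ℓ₂ = ℓ₃ = 0`, the quadric becomes
`ℙ¹ × ℙ¹`, and the ruling is the projection `x ↦ [ℓ₀ x : ℓ₁ x] = [ℓ₂ x : ℓ₃ x]` to one of the
factors.  Exchanging `ℓ₁` and `ℓ₂` gives the projection to the other factor. -/
structure Ruling (Q : QuadraticForm K (Fin 6 → K)) where
  coeffs : Fin 4 → Fin 6 → K
  linearIndependent : LinearIndependent K coeffs
  eq_form : ∀ x : Fin 6 → K,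
    Q x = (coeffs 0 ⬝ᵥ x) * (coeffs 3 ⬝ᵥ x) - (coeffs 1 ⬝ᵥ x) * (coeffs 2 ⬝ᵥ x)

namespace Ruling

variable {Q : QuadraticForm K (Fin 6 → K)}

/-- Equations of the scheme-theoretic fiber over `t = [t₀ : t₁]` of the restriction to the Büchi
K3 surface of the map `[ℓ₀ : ℓ₁] = [ℓ₂ : ℓ₃]`. -/
def fiberEquations (R : Ruling Q) (t : P1 K) : Set (MvPolynomial (Fin 6) K) :=
  buchiEquations K ∪
    {MvPolynomial.C (t.rep 1) * linearForm (R.coeffs 0)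
        - MvPolynomial.C (t.rep 0) * linearForm (R.coeffs 1),
     MvPolynomial.C (t.rep 1) * linearForm (R.coeffs 2)
        - MvPolynomial.C (t.rep 0) * linearForm (R.coeffs 3)}

/-- The fiber over `t`, as a closed subset of projective space. -/
def fiber (R : Ruling Q) (t : P1 K) : Set (P5 K) := zeroLocus (R.fiberEquations t)

/-- The fiber over `t`, as a scheme, is smooth of dimension one at `p`. -/
def FiberSmoothAt (R : Ruling Q) (t : P1 K) (p : P5 K) : Prop :=
  Module.finrank K (coneTangent (R.fiberEquations t) p) = 2

/-- The pencil is an elliptic fibration of the Büchi K3 surface over `ℙ¹`: it has no base points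
and all but finitely many of its (scheme-theoretic) fibers are smooth irreducible curves of genus
one. -/
def IsElliptic (R : Ruling Q) : Prop :=
  (∀ p ∈ buchiK3 K, ∃! t : P1 K, p ∈ R.fiber t) ∧
  {t : P1 K | ¬ (IsSmoothCurveOfGenus 1 (R.fiber t) ∧
    ∀ p ∈ R.fiber t, R.FiberSmoothAt t p)}.Finite

/-- The fiber over `t` is of Kodaira type `I₂`: as a divisor it is `C₁ + C₂` (each component having
multiplicity one), where `C₁` and `C₂` are smooth rational curves meeting in exactly two points and
transversally. -/
def IsFiberOfTypeI2 (R : Ruling Q) (t : P1 K) : Prop :=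
  ∃ C₁ C₂ : Set (P5 K), IsSmoothCurveOfGenus 0 C₁ ∧ IsSmoothCurveOfGenus 0 C₂ ∧
    R.fiber t = C₁ ∪ C₂ ∧
    (∃ p q : P5 K, p ≠ q ∧ C₁ ∩ C₂ = {p, q}) ∧
    (∀ p ∈ C₁ ∩ C₂,
      coneTangent (formsVanishingOn C₁) p ⊓ coneTangent (formsVanishingOn C₂) p = p.submodule) ∧
    ∀ p ∈ R.fiber t, p ∉ C₁ ∩ C₂ → R.FiberSmoothAt t p

end Ruling

end Buchi

end

/-! Sign changes of the coordinates preserve the surface, so a quadric through it has no mixed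
terms; three points of the surface then force it into the net of diagonal forms spanned by the Büchi
equations (`exists_eq_diagQuad_net`). The maximal minors of the coefficient matrix are all nonzero,
so a nonzero member has at most two zero coefficients, and rank four means exactly two, at places
`a` and `b`.

Each fiber of a pencil from such a member lies in a three-space with coordinates `z₀, z₁` along the
ruling and `z₂ = x_a`, `z₃ = x_b`. Two further generators of the net, normalised at `a` and `b`,
restrict to `z₂² = f(z₀, z₁)` and `z₃² = g(z₀, z₁)` with `f, g ≠ 0`
(`Ruling.IsFiberParam.curveModel`). The geometry of the fiber is read off from `f` and `g`. If both
discriminants are nonzero and `f, g` are not proportional, the fiber is irreducible, because `1, √f,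
√g, √(fg)` are independent over `K(z₀, z₁)` (`biquadratic_independent`); with no common root it is a
smooth quartic of genus one. If exactly one of them is a square, or they are proportional with
nonzero discriminant, it is a union of two smooth conics; if both are squares, of four lines.

For (2): a fiber of type `I₂` is reducible but has only two irreducible pieces, so the middle case
holds (`CurveModel.exists_smooth_conics_of_union`).

For (1): restricted to the plane of a conic, the net consists of multiples of one form, so a pencil
in the net vanishes on the plane. Two diagonal forms in six variables with distinct coefficient
ratios have no common isotropic three-space (`not_isotropic_of_distinct`), so some member of that
pencil has rank four. The plane lies in a linear space of one of its two rulings, hence in the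
three-space of a fiber, where a further quadric through the fiber contains the plane; this makes the
fiber reducible. The pencil is elliptic: it has no base points, and the bad fibers come from
finitely many zeros of the two discriminants and finitely many points with `x_a = x_b = 0`
(`IsStandard.isElliptic`). -/

noncomputable section

namespace Buchi

open MvPolynomial

variable {K : Type*} [Field K]

/-! ### Binary quadratic forms -/

/-- The value at `(u, v)` of the binary quadratic form with coefficients `f`. -/
def bq (f : Fin 3 → K) (u v : K) : K := f 0 * u ^ 2 + f 1 * u * v + f 2 * v ^ 2

/-- The discriminant of a binary quadratic form. -/
def bdisc (f : Fin 3 → K) : K := f 1 ^ 2 - 4 * f 0 * f 2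

/-- The binary quadratic form as a polynomial. -/
def bqPoly (f : Fin 3 → K) : MvPolynomial (Fin 2) K :=
  C (f 0) * X 0 ^ 2 + C (f 1) * X 0 * X 1 + C (f 2) * X 1 ^ 2

@[simp] lemma eval_bqPoly (f : Fin 3 → K) (w : Fin 2 → K) :
    eval w (bqPoly f) = bq f (w 0) (w 1) := by
  simp [bqPoly, bq]

lemma bqPoly_isHomogeneous (f : Fin 3 → K) : (bqPoly f).IsHomogeneous 2 := by
  have h0 := (isHomogeneous_C_mul_X_pow (σ := Fin 2) (f 0) 0 2)
  have h1 := (isHomogeneous_C_mul_X (σ := Fin 2) (f 1) 0).mul (isHomogeneous_X K (1 : Fin 2))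
  have h2 := (isHomogeneous_C_mul_X_pow (σ := Fin 2) (f 2) 1 2)
  exact (h0.add h1).add h2

lemma exists_sq_eq [IsAlgClosed K] (a : K) : ∃ b : K, b ^ 2 = a :=
  IsAlgClosed.exists_pow_nat_eq a two_pos

lemma exists_bq_factor [IsAlgClosed K] [CharZero K] (f : Fin 3 → K) :
    ∃ a b c d : K, f 0 = a * c ∧ f 1 = a * d + b * c ∧ f 2 = b * d := by
  by_cases h : f 0 = 0
  · exact ⟨0, 1, f 1, f 2, by simp [h], by simp, by simp⟩
  · obtain ⟨e, he⟩ := exists_sq_eq (bdisc f)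
    refine ⟨f 0, (f 1 - e) / 2, 1, (f 1 + e) / (2 * f 0), by ring, by field_simp; ring, ?_⟩
    rw [bdisc] at he
    field_simp
    linear_combination he

/-- `h` is not a square in the fraction field. -/
def NonSq {D : Type*} [CommRing D] (h : D) : Prop := ∀ p q : D, p ^ 2 = q ^ 2 * h → q = 0

/-- In `p² = q² l k` the prime `l` occurs to an even power on the left and to an odd power on the
right. -/
lemma nonSq_of_prime_mul {D : Type*} [CommRing D] [IsDomain D] [UniqueFactorizationMonoid D]
    {l k : D} (hl : Prime l) (hk : ¬ l ∣ k) : NonSq (l * k) := by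
  intro p q h
  by_contra hq
  have hk0 : k ≠ 0 := fun h0 => hk (h0 ▸ dvd_zero l)
  have hp : p ≠ 0 := by
    rintro rfl
    have : q ^ 2 * (l * k) ≠ 0 := by simp [hq, hl.ne_zero, hk0]
    exact this (by rw [← h]; simp)
  have fq : FiniteMultiplicity l q := FiniteMultiplicity.of_prime_left hl hq
  have fp : FiniteMultiplicity l p := FiniteMultiplicity.of_prime_left hl hp
  have e := congrArg (emultiplicity l) h
  rw [emultiplicity_mul hl, emultiplicity_mul hl, emultiplicity_pow hl, emultiplicity_pow hl,
    emultiplicity_eq_zero.2 hk, fq.emultiplicity_eq_multiplicity,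
    fp.emultiplicity_eq_multiplicity,
    (FiniteMultiplicity.of_prime_left hl hl.ne_zero).emultiplicity_eq_multiplicity,
    multiplicity_self] at e
  norm_cast at e
  omega

lemma prime_linear_binary {a b : K} (h : ¬ (a = 0 ∧ b = 0)) :
    Prime (C a * X 0 + C b * X 1 : MvPolynomial (Fin 2) K) := by
  have key := irreducible_sumSMulX (R := K) (Finsupp.equivFunOnFinite.symm ![a, b]) ?_ ?_
  · have : sumSMulX (Finsupp.equivFunOnFinite.symm ![a, b]) =
        (C a * X 0 + C b * X 1 : MvPolynomial (Fin 2) K) := by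
      rw [sumSMulX, Finsupp.linearCombination_apply, Finsupp.sum_fintype _ _ (by simp)]
      simp [Fin.sum_univ_two, smul_eq_C_mul]
    rw [this] at key
    exact key.prime
  · by_contra hs
    rw [Finset.not_nonempty_iff_eq_empty, Finsupp.support_eq_empty] at hs
    have h0 := DFunLike.congr_fun hs 0
    have h1 := DFunLike.congr_fun hs 1
    simp at h0 h1
    exact h ⟨h0, h1⟩
  · intro r hr
    rw [isUnit_iff_ne_zero]
    rintro rfl
    have h0 := hr 0
    have h1 := hr 1
    simp at h0 h1
    exact h ⟨h0, h1⟩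

lemma nonSq_linear_mul {a b : K} (h : ¬ (a = 0 ∧ b = 0)) (k : MvPolynomial (Fin 2) K)
    (r : Fin 2 → K) (h0 : a * r 0 + b * r 1 = 0) (hk : eval r k ≠ 0) :
    NonSq ((C a * X 0 + C b * X 1) * k) := by
  refine nonSq_of_prime_mul (prime_linear_binary h) ?_
  rintro ⟨m, rfl⟩
  simp [h0] at hk

/-- A root of a form of nonzero discriminant cuts out a linear factor exactly once. -/
lemma exists_bq_factor_of_root [IsAlgClosed K] [CharZero K] {f : Fin 3 → K} (hf : bdisc f ≠ 0)
    {r : Fin 2 → K} (hr : r ≠ 0) (h0 : bq f (r 0) (r 1) = 0) :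
    ∃ a b c d : K, ¬ (a = 0 ∧ b = 0) ∧ a * r 0 + b * r 1 = 0 ∧ c * r 0 + d * r 1 ≠ 0 ∧
      bqPoly f = (C a * X 0 + C b * X 1) * (C c * X 0 + C d * X 1) := by
  obtain ⟨a, b, c, d, e0, e1, e2⟩ := exists_bq_factor f
  have hd : a * d - b * c ≠ 0 := by
    intro hh
    apply hf
    rw [bdisc, e0, e1, e2]
    linear_combination (a * d - b * c) * hh
  have hpoly : bqPoly f = (C a * X 0 + C b * X 1) * (C c * X 0 + C d * X 1) := by
    rw [bqPoly, e0, e1, e2]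
    simp only [map_mul, map_add]
    ring
  have hnot : ¬ (a * r 0 + b * r 1 = 0 ∧ c * r 0 + d * r 1 = 0) := by
    rintro ⟨h1, h2⟩
    apply hr
    have h3 : (a * d - b * c) * r 0 = 0 := by linear_combination d * h1 - b * h2
    have h4 : (a * d - b * c) * r 1 = 0 := by linear_combination a * h2 - c * h1
    ext i
    fin_cases i
    · simpa [hd] using h3
    · simpa [hd] using h4
  have hm : (a * r 0 + b * r 1) * (c * r 0 + d * r 1) = 0 := by
    rw [← h0, bq, e0, e1, e2]; ring
  rcases mul_eq_zero.1 hm with h | h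
  · refine ⟨a, b, c, d, ?_, h, fun h' => hnot ⟨h, h'⟩, hpoly⟩
    rintro ⟨rfl, rfl⟩; simp at hd
  · refine ⟨c, d, a, b, ?_, h, fun h' => hnot ⟨h', h⟩, by rw [hpoly, mul_comm]⟩
    rintro ⟨rfl, rfl⟩; simp at hd

lemma exists_bq_root [IsAlgClosed K] [CharZero K] (f : Fin 3 → K) :
    ∃ r : Fin 2 → K, r ≠ 0 ∧ bq f (r 0) (r 1) = 0 := by
  obtain ⟨a, b, c, d, e0, e1, e2⟩ := exists_bq_factor f
  by_cases h : a = 0 ∧ b = 0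
  · refine ⟨![1, 0], fun h => by simpa using congrFun h 0, ?_⟩
    simp [bq, e0, h.1]
  · refine ⟨![b, -a], fun h' => h ?_, ?_⟩
    · have h0 := congrFun h' 0
      have h1 := congrFun h' 1
      simp at h0 h1
      exact ⟨h1, h0⟩
    · simp [bq, e0, e1, e2]; ring

lemma nonSq_bqPoly [IsAlgClosed K] [CharZero K] {f : Fin 3 → K} (hf : bdisc f ≠ 0) :
    NonSq (bqPoly f) := by
  obtain ⟨r, hr, h0⟩ := exists_bq_root f
  obtain ⟨a, b, c, d, hab, h1, h2, h3⟩ := exists_bq_factor_of_root hf hr h0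
  rw [h3]
  exact nonSq_linear_mul hab _ r h1 (by simpa using h2)

/-- The linear factor of `f` at `r` divides `fg` exactly once: `r` is a simple root of `f` and not a
root of `g`. -/
lemma nonSq_bqPoly_mul [IsAlgClosed K] [CharZero K] {f g : Fin 3 → K} (hf : bdisc f ≠ 0)
    {r : Fin 2 → K} (h0 : bq f (r 0) (r 1) = 0) (hg : bq g (r 0) (r 1) ≠ 0) :
    NonSq (bqPoly f * bqPoly g) := by
  have hr : r ≠ 0 := by
    rintro rfl; simp [bq] at hg
  obtain ⟨a, b, c, d, hab, h1, h2, h3⟩ := exists_bq_factor_of_root hf hr h0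
  rw [h3, mul_assoc]
  exact nonSq_linear_mul hab _ r h1 (by simpa using ⟨h2, hg⟩)

/-- A form of discriminant zero is a square. -/
lemma exists_sq_of_bdisc_eq_zero [IsAlgClosed K] [CharZero K] {f : Fin 3 → K} (hf : bdisc f = 0) :
    ∃ a b : K, ∀ u v, bq f u v = (a * u + b * v) ^ 2 := by
  obtain ⟨a, b, c, d, e0, e1, e2⟩ := exists_bq_factor f
  have hd : a * d - b * c = 0 := by
    rw [bdisc, e0, e1, e2] at hf
    have : (a * d - b * c) ^ 2 = 0 := by linear_combination hf
    simpa using this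
  obtain ⟨s, hs⟩ := exists_sq_eq (f 0)
  obtain ⟨t, ht⟩ := exists_sq_eq (f 2)
  have h4 : (f 1) ^ 2 = (2 * s * t) ^ 2 := by
    rw [bdisc] at hf
    linear_combination hf - 4 * f 2 * hs - 4 * s ^ 2 * ht
  rcases sq_eq_sq_iff_eq_or_eq_neg.1 h4 with h | h
  · exact ⟨s, t, fun u v => by rw [bq, h, ← hs, ← ht]; ring⟩
  · exact ⟨s, -t, fun u v => by rw [bq, h, ← hs, ← ht]; ring⟩

/-- If `g` vanishes at the roots of `f`, which are distinct, it is a multiple of `f`. -/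
lemma exists_eq_smul_of_roots [IsAlgClosed K] [CharZero K] {f g : Fin 3 → K} (hf : bdisc f ≠ 0)
    (h : ∀ r : Fin 2 → K, bq f (r 0) (r 1) = 0 → bq g (r 0) (r 1) = 0) :
    ∃ μ : K, ∀ u v, bq g u v = μ * bq f u v := by
  obtain ⟨a, b, c, d, e0, e1, e2⟩ := exists_bq_factor f
  have hd : a * d - b * c ≠ 0 := by
    intro hh
    apply hf
    rw [bdisc, e0, e1, e2]
    linear_combination (a * d - b * c) * hh
  have h1 := h ![b, -a] (by simp [bq, e0, e1, e2]; ring)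
  have h2 := h ![d, -c] (by simp [bq, e0, e1, e2]; ring)
  simp [bq] at h1 h2
  -- In the coordinates `l = au + bv`, `m = cu + dv` the coefficients of `l²` and `m²` in `g` are,
  -- up to scale, its values at the two roots of `f`, so only the `lm` term survives. Its
  -- coefficient is minus the polar form of `g` at the roots `(b, -a)` and `(d, -c)`, divided by
  -- `(ad - bc)²`.
  refine ⟨-(2 * g 0 * b * d - g 1 * (b * c + a * d) + 2 * g 2 * a * c) / (a * d - b * c) ^ 2,
    fun u v => ?_⟩
  rw [bq, bq, e0, e1, e2, div_mul_eq_mul_div, eq_div_iff (pow_ne_zero 2 hd)]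
  linear_combination (c * u + d * v) ^ 2 * h1 + (a * u + b * v) ^ 2 * h2

/-! ### The curve `z₂² = f(z₀, z₁)`, `z₃² = g(z₀, z₁)` in three-space -/

/-- The affine cone over the curve. -/
def curveCone (f g : Fin 3 → K) : Set (Fin 4 → K) :=
  {z | z 2 ^ 2 = bq f (z 0) (z 1) ∧ z 3 ^ 2 = bq g (z 0) (z 1)}

/-- Binary polynomials as polynomials in four variables. -/
def binaryInc : MvPolynomial (Fin 2) K →ₐ[K] MvPolynomial (Fin 4) K := rename ![0, 1]

/-- The ideal generated by the two equations of the curve. -/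
def curveIdeal (f g : Fin 3 → K) : Ideal (MvPolynomial (Fin 4) K) :=
  Ideal.span {X 2 ^ 2 - binaryInc (bqPoly f), X 3 ^ 2 - binaryInc (bqPoly g)}

/-- Normal forms of polynomials modulo the ideal of the curve. -/
def normalForm (P Q R S : MvPolynomial (Fin 2) K) : MvPolynomial (Fin 4) K :=
  binaryInc P + binaryInc Q * X 2 + binaryInc R * X 3 + binaryInc S * (X 2 * X 3)

lemma eval_binaryInc (P : MvPolynomial (Fin 2) K) (z : Fin 4 → K) :
    eval z (binaryInc P) = eval ![z 0, z 1] P := by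
  rw [binaryInc, eval_rename]
  congr 2
  ext i; fin_cases i <;> rfl

lemma eval_normalForm (P Q R S : MvPolynomial (Fin 2) K) (z : Fin 4 → K) :
    eval z (normalForm P Q R S) = eval ![z 0, z 1] P + eval ![z 0, z 1] Q * z 2 +
      eval ![z 0, z 1] R * z 3 + eval ![z 0, z 1] S * (z 2 * z 3) := by
  simp [normalForm, eval_binaryInc]

lemma eval_eq_zero_of_mem_curveIdeal {f g : Fin 3 → K} {G : MvPolynomial (Fin 4) K}
    (hG : G ∈ curveIdeal f g) {z : Fin 4 → K} (hz : z ∈ curveCone f g) : eval z G = 0 := by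
  have : curveIdeal f g ≤ RingHom.ker (eval z) := by
    rw [curveIdeal, Ideal.span_le]
    rintro _ (rfl | rfl)
    · simp [RingHom.mem_ker, eval_binaryInc, hz.1]
    · simp [RingHom.mem_ker, eval_binaryInc, hz.2]
  exact this hG

lemma binaryInc_isHomogeneous {P : MvPolynomial (Fin 2) K} {n : ℕ} (h : P.IsHomogeneous n) :
    (binaryInc P).IsHomogeneous n := h.rename_isHomogeneous

lemma bqPoly_ne_zero {f : Fin 3 → K} (h : bdisc f ≠ 0) : bqPoly f ≠ 0 := by
  intro h0
  apply h
  have e0 := congrArg (eval ![1, 0]) h0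
  have e1 := congrArg (eval ![0, 1]) h0
  simp [bq] at e0 e1
  have e2 := congrArg (eval ![1, 1]) h0
  simp [bq, e0, e1] at e2
  simp [bdisc, e0, e2]

/-- A normal form vanishing on the curve is zero. -/
lemma normalForm_eq_zero_of_eval [IsAlgClosed K] [CharZero K] {f g : Fin 3 → K}
    (hf : bqPoly f ≠ 0) (hg : bqPoly g ≠ 0) {P Q R S : MvPolynomial (Fin 2) K}
    (h : ∀ z ∈ curveCone f g, eval z (normalForm P Q R S) = 0) :
    P = 0 ∧ Q = 0 ∧ R = 0 ∧ S = 0 := by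
  have key : ∀ w : Fin 2 → K, eval w P = 0 ∧ eval w (Q * bqPoly f) = 0 ∧
      eval w (R * bqPoly g) = 0 ∧ eval w (S * (bqPoly f * bqPoly g)) = 0 := by
    intro w
    obtain ⟨s, hs⟩ := exists_sq_eq (bq f (w 0) (w 1))
    obtain ⟨t, ht⟩ := exists_sq_eq (bq g (w 0) (w 1))
    have hw : ![w 0, w 1] = w := by ext i; fin_cases i <;> rfl
    -- The four sign choices lie on the cone over the same point `w`; their signed sums isolate each
    -- of the four terms, the last three only up to the factors `f`, `g` and `fg`.
    have h1 := h ![w 0, w 1, s, t] ⟨by simpa using hs, by simpa using ht⟩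
    have h2 := h ![w 0, w 1, -s, t] ⟨by simpa using hs, by simpa using ht⟩
    have h3 := h ![w 0, w 1, s, -t] ⟨by simpa using hs, by simpa using ht⟩
    have h4 := h ![w 0, w 1, -s, -t] ⟨by simpa using hs, by simpa using ht⟩
    rw [eval_normalForm] at h1 h2 h3 h4
    simp [hw] at h1 h2 h3 h4
    have four : (4 : K) ≠ 0 := by norm_num
    refine ⟨?_, ?_, ?_, ?_⟩ <;> try simp only [map_mul, eval_bqPoly, ← hs, ← ht]
    all_goals
      apply mul_left_cancel₀ four
    · linear_combination h1 + h2 + h3 + h4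
    · linear_combination s * (h1 - h2 + h3 - h4)
    · linear_combination t * (h1 + h2 - h3 - h4)
    · linear_combination s * t * (h1 - h2 - h3 + h4)
  have z : ∀ T : MvPolynomial (Fin 2) K, (∀ w, eval w T = 0) → T = 0 := fun T hT =>
    MvPolynomial.funext fun w => by simpa using hT w
  refine ⟨z _ fun w => (key w).1, ?_, ?_, ?_⟩
  · simpa [hf] using z _ fun w => (key w).2.1
  · simpa [hg] using z _ fun w => (key w).2.2.1
  · simpa [hf, hg] using z _ fun w => (key w).2.2.2

/-- `1, √f, √g, √(fg)` are linearly independent if `f`, `g` and `fg` are not squares. -/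
lemma biquadratic_independent {D L : Type*} [CommRing D] [IsDomain D] [CommRing L] [IsDomain L]
    [Algebra D L] [FaithfulSMul D L] [CharZero D] {f g : D} (hf : NonSq f) (hg : NonSq g)
    (hfg : NonSq (f * g)) {α β : L} (hα : α ^ 2 = algebraMap D L f) (hβ : β ^ 2 = algebraMap D L g)
    {P Q R S : D} (h : algebraMap D L P + algebraMap D L Q * α + algebraMap D L R * β +
      algebraMap D L S * (α * β) = 0) : P = 0 ∧ Q = 0 ∧ R = 0 ∧ S = 0 := by
  have inj : Function.Injective (algebraMap D L) := FaithfulSMul.algebraMap_injective D L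
  have ind : ∀ (γ : L) (e : D), γ ^ 2 = algebraMap D L e → NonSq e → ∀ A B : D,
      algebraMap D L A + algebraMap D L B * γ = 0 → A = 0 ∧ B = 0 := by
    intro γ e hγ he A B hAB
    have h1 : A ^ 2 = B ^ 2 * e := by
      apply inj
      simp only [map_mul, map_pow, ← hγ]
      linear_combination (algebraMap D L A - algebraMap D L B * γ) * hAB
    have hB := he A B h1
    subst hB
    simpa [map_eq_zero_iff _ inj] using hAB
  have hO : R ^ 2 - S ^ 2 * f = 0 := by
    -- Multiplying the relation by the conjugate `R - Sα` gives `M + Nα = -Oβ` with `O` free of `α`.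
    -- Squaring and comparing the coefficients of `α` gives `MN = 0`; then `O ≠ 0` would make `fg`
    -- or `g` a square.
    set M := P * R - Q * S * f with hM
    set N := Q * R - P * S with hN
    set O := R ^ 2 - S ^ 2 * f with hO
    have e1 : algebraMap D L M + algebraMap D L N * α = - (algebraMap D L O * β) := by
      simp only [hM, hN, hO, map_sub, map_mul, map_pow, ← hα]
      linear_combination (algebraMap D L R - algebraMap D L S * α) * h
    have e2 : algebraMap D L (M ^ 2 + N ^ 2 * f - O ^ 2 * g) + algebraMap D L (2 * M * N) * α = 0 := by
      simp only [map_sub, map_add, map_mul, map_pow, ← hα, ← hβ, map_ofNat]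
      linear_combination (algebraMap D L M + algebraMap D L N * α - algebraMap D L O * β) * e1
    obtain ⟨e3, e4⟩ := ind α f hα hf _ _ e2
    have e5 : M = 0 ∨ N = 0 := by simpa using e4
    rcases e5 with e5 | e5
    · refine hfg (N * f) O ?_
      rw [e5] at e3
      linear_combination f * e3
    · refine hg M O ?_
      rw [e5] at e3
      linear_combination e3
  have hS : S = 0 := hf R S (by linear_combination hO)
  have hR : R = 0 := by simpa [hS] using hO
  subst hS hR
  obtain ⟨hP, hQ⟩ := ind α f hα hf P Q (by simpa using h)
  exact ⟨hP, hQ, rfl, rfl⟩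

/-! ### Homogeneous normal forms: dimension count and the coordinate ring of the curve -/

section

lemma card_degree_eq (n : ℕ) : Nat.card {d : Fin 2 →₀ ℕ | d.degree = n} = n + 1 := by
  have e : {d : Fin 2 →₀ ℕ | d.degree = n} ≃ Fin (n + 1) :=
    { toFun := fun d => ⟨d.1 0, by
        have := d.2
        simp only [Set.mem_ofPred_eq, Finsupp.degree_eq_sum, Fin.sum_univ_two] at this
        omega⟩
      invFun := fun i => ⟨Finsupp.equivFunOnFinite.symm ![i, n - i], by
        simp only [Set.mem_ofPred_eq, Finsupp.degree_eq_sum, Fin.sum_univ_two]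
        simp
        omega⟩
      left_inv := by
        rintro ⟨d, hd⟩
        simp only [Set.mem_ofPred_eq, Finsupp.degree_eq_sum, Fin.sum_univ_two] at hd
        ext i
        fin_cases i
        · simp
        · simp; omega
      right_inv := fun i => by ext; simp }
  rw [Nat.card_congr e, Nat.card_fin]

lemma finrank_homogeneousSubmodule_two (n : ℕ) :
    Module.finrank K (homogeneousSubmodule (Fin 2) K n) = n + 1 := by
  have e := AddMonoidAlgebra.supportedEquivFinsupp (R := K) (S := K)
    {d : Fin 2 →₀ ℕ | d.degree = n}
  rw [homogeneousSubmodule_eq_finsupp_supported]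
  have hc := card_degree_eq n
  have hfin : Finite {d : Fin 2 →₀ ℕ | d.degree = n} :=
    Nat.finite_of_card_ne_zero (by rw [hc]; omega)
  have := Fintype.ofFinite {d : Fin 2 →₀ ℕ | d.degree = n}
  refine e.finrank_eq.trans ?_
  rw [Module.finrank_finsupp_self, ← Nat.card_eq_fintype_card, hc]

instance (n : ℕ) : Module.Finite K (homogeneousSubmodule (Fin 2) K n) :=
  Module.Finite.of_fg (homogeneousSubmodule_fg _ _ n)

/-- `normalForm` as a linear map. -/
def normalFormLin : (MvPolynomial (Fin 2) K × MvPolynomial (Fin 2) K ×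
    MvPolynomial (Fin 2) K × MvPolynomial (Fin 2) K) →ₗ[K] MvPolynomial (Fin 4) K where
  toFun T := normalForm T.1 T.2.1 T.2.2.1 T.2.2.2
  map_add' T T' := by simp only [normalForm, Prod.fst_add, Prod.snd_add, map_add]; ring
  map_smul' c T := by
    simp only [normalForm, Prod.smul_fst, Prod.smul_snd, map_smul, RingHom.id_apply, smul_add,
      smul_mul_assoc]

/-- The coefficients of the normal forms of degree `n`. -/
def normalFormDomain (K : Type*) [Field K] (n : ℕ) : Submodule K (MvPolynomial (Fin 2) K ×
    MvPolynomial (Fin 2) K × MvPolynomial (Fin 2) K × MvPolynomial (Fin 2) K) :=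
  (homogeneousSubmodule (Fin 2) K n).prod ((homogeneousSubmodule (Fin 2) K (n - 1)).prod
    ((homogeneousSubmodule (Fin 2) K (n - 1)).prod (homogeneousSubmodule (Fin 2) K (n - 2))))

/-- A product of submodules as a product of modules. -/
def prodSubmoduleEquiv {V W : Type*} [AddCommGroup V] [Module K V] [AddCommGroup W] [Module K W]
    (p : Submodule K V) (q : Submodule K W) : p.prod q ≃ₗ[K] p × q where
  toFun x := (⟨x.1.1, x.2.1⟩, ⟨x.1.2, x.2.2⟩)
  invFun x := ⟨(x.1.1, x.2.1), x.1.2, x.2.2⟩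
  map_add' _ _ := rfl
  map_smul' _ _ := rfl

lemma finrank_normalFormDomain {n : ℕ} (hn : 2 ≤ n) :
    Module.finrank K (normalFormDomain K n) = 4 * n := by
  have e := (prodSubmoduleEquiv (K := K) (homogeneousSubmodule (Fin 2) K n) _).trans
    ((LinearEquiv.refl K _).prodCongr ((prodSubmoduleEquiv (homogeneousSubmodule (Fin 2) K (n - 1))
      _).trans ((LinearEquiv.refl K _).prodCongr (prodSubmoduleEquiv
        (homogeneousSubmodule (Fin 2) K (n - 1)) (homogeneousSubmodule (Fin 2) K (n - 2))))))
  refine e.finrank_eq.trans ?_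
  simp only [Module.finrank_prod, finrank_homogeneousSubmodule_two]
  omega

/-- Replacing `z₂²` by `f` and `z₃²` by `g` preserves the degree and leaves only the parities of the
two exponents. An odd exponent forces the degree to be large enough for the subtractions in
`normalFormDomain` not to truncate. -/
lemma exists_normalForm_monomial (f g : Fin 3 → K) (d : Fin 4 →₀ ℕ) (c : K) :
    ∃ T ∈ normalFormDomain K d.degree,
      monomial d c - normalFormLin T ∈ curveIdeal f g := by
  set A : MvPolynomial (Fin 2) K :=
    C c * X 0 ^ d 0 * X 1 ^ d 1 * bqPoly f ^ (d 2 / 2) * bqPoly g ^ (d 3 / 2) with hA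
  have hAh : A.IsHomogeneous (d 0 + d 1 + 2 * (d 2 / 2) + 2 * (d 3 / 2)) :=
    (((isHomogeneous_C_mul_X_pow c 0 (d 0)).mul (isHomogeneous_X_pow 1 (d 1))).mul
      ((bqPoly_isHomogeneous f).pow _)).mul ((bqPoly_isHomogeneous g).pow _)
  have hdeg : d.degree = d 0 + d 1 + d 2 + d 3 := by
    rw [Finsupp.degree_eq_sum, Fin.sum_univ_four]
  have hA' : ∀ n, d 0 + d 1 + 2 * (d 2 / 2) + 2 * (d 3 / 2) = n → A ∈ homogeneousSubmodule _ K n :=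
    fun n hn => hn ▸ hAh
  have hmon : monomial d c = C c * X 0 ^ d 0 * X 1 ^ d 1 * X 2 ^ d 2 * X 3 ^ d 3 := by
    rw [monomial_eq, Finsupp.prod_fintype _ _ (by simp), Fin.prod_univ_four]; ring
  have q2 : Ideal.Quotient.mk (curveIdeal f g) (X 2) ^ 2 =
      Ideal.Quotient.mk (curveIdeal f g) (binaryInc (bqPoly f)) := by
    rw [← map_pow, Ideal.Quotient.eq]
    exact Ideal.subset_span (by simp)
  have q3 : Ideal.Quotient.mk (curveIdeal f g) (X 3) ^ 2 =
      Ideal.Quotient.mk (curveIdeal f g) (binaryInc (bqPoly g)) := by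
    rw [← map_pow, Ideal.Quotient.eq]
    exact Ideal.subset_span (by simp)
  have i0 : binaryInc (X 0 : MvPolynomial (Fin 2) K) = X 0 := by simp [binaryInc]
  have i1 : binaryInc (X 1 : MvPolynomial (Fin 2) K) = X 1 := by simp [binaryInc]
  have iC : binaryInc (C c : MvPolynomial (Fin 2) K) = C c := by simp [binaryInc]
  have hq : Ideal.Quotient.mk (curveIdeal f g) (monomial d c) =
      Ideal.Quotient.mk (curveIdeal f g) (binaryInc A * X 2 ^ (d 2 % 2) * X 3 ^ (d 3 % 2)) := by
    rw [hmon]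
    conv_lhs => rw [← Nat.div_add_mod (d 2) 2, ← Nat.div_add_mod (d 3) 2]
    simp only [hA, map_mul, map_pow, i0, i1, iC, pow_add, pow_mul, q2, q3]
    ring
  rcases Nat.mod_two_eq_zero_or_one (d 2) with h2 | h2 <;>
    rcases Nat.mod_two_eq_zero_or_one (d 3) with h3 | h3
  · refine ⟨(A, 0, 0, 0), ⟨hA' _ (by omega), zero_mem _, zero_mem _, zero_mem _⟩, ?_⟩
    rw [← Ideal.Quotient.eq, hq, h2, h3]
    simp [normalFormLin, normalForm]
  · refine ⟨(0, 0, A, 0), ⟨zero_mem _, zero_mem _, hA' _ (by omega), zero_mem _⟩, ?_⟩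
    rw [← Ideal.Quotient.eq, hq, h2, h3]
    simp [normalFormLin, normalForm]
  · refine ⟨(0, A, 0, 0), ⟨zero_mem _, hA' _ (by omega), zero_mem _, zero_mem _⟩, ?_⟩
    rw [← Ideal.Quotient.eq, hq, h2, h3]
    simp [normalFormLin, normalForm]
  · refine ⟨(0, 0, 0, A), ⟨zero_mem _, zero_mem _, zero_mem _, hA' _ (by omega)⟩, ?_⟩
    rw [← Ideal.Quotient.eq, hq, h2, h3]
    simp [normalFormLin, normalForm, mul_assoc]

lemma exists_normalForm (f g : Fin 3 → K) {n : ℕ} {G : MvPolynomial (Fin 4) K}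
    (hG : G.IsHomogeneous n) :
    ∃ T ∈ normalFormDomain K n, G - normalFormLin T ∈ curveIdeal f g := by
  have key : G ∈ (curveIdeal f g).restrictScalars K ⊔ (normalFormDomain K n).map normalFormLin := by
    rw [G.as_sum]
    refine Submodule.sum_mem _ fun d hd => ?_
    obtain ⟨T, hT, h⟩ := exists_normalForm_monomial f g d (coeff d G)
    have hdn : d.degree = n := by
      by_contra hne
      exact (mem_support_iff.1 hd) (hG.coeff_eq_zero hne)
    rw [hdn] at hT
    rw [← sub_add_cancel (monomial d (coeff d G)) (normalFormLin T)]
    exact Submodule.add_mem_sup h (Submodule.mem_map_of_mem hT)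
  obtain ⟨I, hI, _, ⟨T, hT, rfl⟩, rfl⟩ := Submodule.mem_sup.1 key
  exact ⟨T, hT, by simpa using hI⟩

section

variable [IsAlgClosed K] [CharZero K] {f g : Fin 3 → K}

/-- An explicit Nullstellensatz: the normal form of `G` vanishes on the curve, hence is zero, so no
radical is needed. -/
lemma mem_curveIdeal_of_eval (hf : bqPoly f ≠ 0) (hg : bqPoly g ≠ 0) {n : ℕ}
    {G : MvPolynomial (Fin 4) K} (hG : G.IsHomogeneous n)
    (h : ∀ z ∈ curveCone f g, eval z G = 0) : G ∈ curveIdeal f g := by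
  obtain ⟨T, -, hT⟩ := exists_normalForm f g hG
  have h0 := normalForm_eq_zero_of_eval hf hg (P := T.1) (Q := T.2.1) (R := T.2.2.1)
    (S := T.2.2.2) fun z hz => by
      have := eval_eq_zero_of_mem_curveIdeal hT hz
      rw [map_sub, h z hz, zero_sub, neg_eq_zero] at this
      exact this
  have hT0 : T = 0 := Prod.ext h0.1 (Prod.ext h0.2.1 (Prod.ext h0.2.2.1 h0.2.2.2))
  simpa [hT0] using hT

/-- The coordinate ring of the curve is a domain. -/
lemma eval_eq_zero_or_of_mul (hf : NonSq (bqPoly f)) (hg : NonSq (bqPoly g))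
    (hfg : NonSq (bqPoly f * bqPoly g)) (hf0 : bqPoly f ≠ 0) (hg0 : bqPoly g ≠ 0) {m n : ℕ}
    {F G : MvPolynomial (Fin 4) K} (hF : F.IsHomogeneous m) (hG : G.IsHomogeneous n)
    (h : ∀ z ∈ curveCone f g, eval z (F * G) = 0) :
    (∀ z ∈ curveCone f g, eval z F = 0) ∨ ∀ z ∈ curveCone f g, eval z G = 0 := by
  -- A generic point of the curve: `z₂` and `z₃` go to square roots of `f` and `g` in a field. A
  -- form vanishes on the curve exactly when it vanishes at this point, and a field has no zero
  -- divisors.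
  let L := AlgebraicClosure (FractionRing (MvPolynomial (Fin 2) K))
  let ι := algebraMap (MvPolynomial (Fin 2) K) L
  have : FaithfulSMul (MvPolynomial (Fin 2) K) L :=
    FaithfulSMul.trans _ (FractionRing (MvPolynomial (Fin 2) K)) L
  obtain ⟨α, hα⟩ : ∃ α : L, α ^ 2 = ι (bqPoly f) := exists_sq_eq _
  obtain ⟨β, hβ⟩ : ∃ β : L, β ^ 2 = ι (bqPoly g) := exists_sq_eq _
  let φ : MvPolynomial (Fin 4) K →+* L := eval₂Hom (ι.comp C) ![ι (X 0), ι (X 1), α, β]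
  have hφ : ∀ P, φ (binaryInc P) = ι P := by
    intro P
    change (φ.comp (binaryInc : MvPolynomial (Fin 2) K →ₐ[K] _).toRingHom) P = ι P
    congr 1
    apply MvPolynomial.ringHom_ext
    · intro r; simp [φ, binaryInc]
    · intro i; fin_cases i <;> simp [φ, binaryInc]
  have hφ2 : φ (X 2) = α := by simp [φ]
  have hφ3 : φ (X 3) = β := by simp [φ]
  have hker : ∀ H ∈ curveIdeal f g, φ H = 0 := by
    have : curveIdeal f g ≤ RingHom.ker φ := by
      rw [curveIdeal, Ideal.span_le]
      rintro _ (rfl | rfl)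
      · simp [RingHom.mem_ker, hφ, hφ2, hα]
      · simp [RingHom.mem_ker, hφ, hφ3, hβ]
    exact this
  have hzero : ∀ {k : ℕ} {H : MvPolynomial (Fin 4) K}, H.IsHomogeneous k → φ H = 0 →
      ∀ z ∈ curveCone f g, eval z H = 0 := by
    intro k H hH h0 z hz
    obtain ⟨T, -, hT⟩ := exists_normalForm f g hH
    have h1 := hker _ hT
    rw [map_sub, h0, zero_sub, neg_eq_zero] at h1
    obtain ⟨p0, q0, r0, s0⟩ := biquadratic_independent hf hg hfg hα hβ (P := T.1) (Q := T.2.1)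
      (R := T.2.2.1) (S := T.2.2.2) (by
        simpa [normalFormLin, normalForm, hφ, hφ2, hφ3] using h1)
    have hT0 : T = 0 := Prod.ext p0 (Prod.ext q0 (Prod.ext r0 s0))
    exact eval_eq_zero_of_mem_curveIdeal (by simpa [hT0] using hT) hz
  have h0 := hker _ (mem_curveIdeal_of_eval hf0 hg0 (hF.mul hG) h)
  rw [map_mul] at h0
  exact (mul_eq_zero.1 h0).imp (hzero hF) (hzero hG)

end

end

section

/-! ### Zariski closed sets -/

lemma eval_smul_of_isHomogeneous {σ : Type*} [Fintype σ] {F : MvPolynomial σ K} {n : ℕ}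
    (hF : F.IsHomogeneous n) (a : K) (x : σ → K) : eval (a • x) F = a ^ n * eval x F := by
  classical
  rw [eval_eq', eval_eq', Finset.mul_sum]
  refine Finset.sum_congr rfl fun d hd => ?_
  have hd' : d.degree = n := by
    by_contra hne
    exact (mem_support_iff.1 hd) (hF.coeff_eq_zero hne)
  rw [Finsupp.degree_eq_sum] at hd'
  simp only [Pi.smul_apply, smul_eq_mul, mul_pow, Finset.prod_mul_distrib, Finset.prod_pow_eq_pow_sum]
  rw [hd']
  ring

lemma exists_rep_eq {V : Type*} [AddCommGroup V] [Module K V] {x : V} (hx : x ≠ 0) :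
    ∃ a : K, a ≠ 0 ∧ (Projectivization.mk K x hx).rep = a • x := by
  obtain ⟨a, ha⟩ := Projectivization.exists_smul_eq_mk_rep K x hx
  exact ⟨a, a.ne_zero, by rw [← ha]; rfl⟩

lemma eval_rep_eq_zero_iff {F : MvPolynomial (Fin 6) K} {n : ℕ} (hF : F.IsHomogeneous n)
    {x : Fin 6 → K} (hx : x ≠ 0) :
    eval (Projectivization.mk K x hx).rep F = 0 ↔ eval x F = 0 := by
  obtain ⟨a, ha, h⟩ := exists_rep_eq (K := K) hx
  rw [h, eval_smul_of_isHomogeneous hF]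
  simp [ha]

lemma IsZariskiClosed.inter {A B : Set (P5 K)} (hA : IsZariskiClosed A) (hB : IsZariskiClosed B) :
    IsZariskiClosed (A ∩ B) := by
  obtain ⟨S, hS, rfl⟩ := hA
  obtain ⟨T, hT, rfl⟩ := hB
  refine ⟨S ∪ T, fun f hf => hf.elim (hS f) (hT f), ?_⟩
  ext p
  simp only [zeroLocus, Set.mem_inter_iff, Set.mem_ofPred_eq, Set.mem_union]
  exact ⟨fun h f hf => hf.elim (h.1 f) (h.2 f), fun h => ⟨fun f hf => h f (.inl hf),
    fun f hf => h f (.inr hf)⟩⟩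

lemma subset_or_subset_of_not_isReducible {C A B : Set (P5 K)} (hC : ¬ IsReducible C)
    (hcl : IsZariskiClosed C) (hA : IsZariskiClosed A) (hB : IsZariskiClosed B) (h : C ⊆ A ∪ B) :
    C ⊆ A ∨ C ⊆ B := by
  by_contra! hn
  refine hC ⟨C ∩ A, C ∩ B, hcl.inter hA, hcl.inter hB, fun e => hn.1 ?_, fun e => hn.2 ?_, ?_⟩
  · exact Set.inter_eq_left.1 e
  · exact Set.inter_eq_left.1 e
  · rw [← Set.inter_union_distrib_left, Set.inter_eq_left.2 h]

lemma linearForm_isHomogeneous (a : Fin 6 → K) : (linearForm a).IsHomogeneous 1 :=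
  IsHomogeneous.sum _ _ _ fun i _ => isHomogeneous_C_mul_X (a i) i

@[simp] lemma eval_linearForm (a x : Fin 6 → K) : eval x (linearForm a) = a ⬝ᵥ x := by
  simp [linearForm, dotProduct]

/-- The coefficients of a linear functional. -/
def functionalCoeffs (φ : (Fin 6 → K) →ₗ[K] K) : Fin 6 → K := fun i => φ (Pi.single i 1)

lemma functionalCoeffs_dotProduct (φ : (Fin 6 → K) →ₗ[K] K) (x : Fin 6 → K) :
    functionalCoeffs φ ⬝ᵥ x = φ x := by
  rw [LinearMap.pi_apply_eq_sum_univ φ x]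
  simp only [dotProduct, functionalCoeffs, smul_eq_mul]
  refine Finset.sum_congr rfl fun i _ => ?_
  rw [mul_comm]
  congr 2
  ext j
  simp [Pi.single_apply, eq_comm]

lemma isZariskiClosed_hyperplane (φ : (Fin 6 → K) →ₗ[K] K) :
    IsZariskiClosed {p : P5 K | φ p.rep = 0} := by
  refine ⟨{linearForm (functionalCoeffs φ)}, ?_, ?_⟩
  · rintro _ rfl
    exact ⟨1, linearForm_isHomogeneous _⟩
  · ext p
    simp [zeroLocus, functionalCoeffs_dotProduct]

lemma eq_of_rep_smul {p q : P5 K} {a : K} (h : p.rep = a • q.rep) : p = q := by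
  have ha : a ≠ 0 := by
    rintro rfl
    exact p.rep_nonzero (by simpa using h)
  rw [← p.mk_rep, ← q.mk_rep, Projectivization.mk_eq_mk_iff']
  exact ⟨a, h.symm⟩

/-- Two distinct points form a reducible set. -/
lemma isReducible_pair {p q : P5 K} (h : p ≠ q) : IsReducible ({p, q} : Set (P5 K)) := by
  have cl : ∀ r : P5 K, IsZariskiClosed {r} := by
    intro r
    refine ⟨Set.range fun ij : Fin 6 × Fin 6 =>
      C (r.rep ij.1) * X ij.2 - C (r.rep ij.2) * X ij.1, ?_, ?_⟩
    · rintro _ ⟨ij, rfl⟩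
      exact ⟨1, (isHomogeneous_C_mul_X _ _).sub (isHomogeneous_C_mul_X _ _)⟩
    · ext s
      simp only [Set.mem_singleton_iff, zeroLocus, Set.mem_ofPred_eq, Set.forall_mem_range]
      constructor
      · rintro rfl ij
        simp [mul_comm]
      · intro hs
        obtain ⟨i, hi⟩ : ∃ i, r.rep i ≠ 0 := by
          by_contra! h0
          exact r.rep_nonzero (funext h0)
        apply eq_of_rep_smul (a := s.rep i / r.rep i)
        ext j
        have := hs (i, j)
        simp at this
        simp only [Pi.smul_apply, smul_eq_mul]
        field_simp
        linear_combination this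
  refine ⟨{p}, {q}, cl p, cl q, ?_, ?_, rfl⟩
  · intro e
    have : q ∈ ({p} : Set (P5 K)) := e ▸ (by simp)
    exact h this.symm
  · intro e
    have : p ∈ ({q} : Set (P5 K)) := e ▸ (by simp)
    exact h this

lemma normalFormLin_isHomogeneous {n : ℕ} (hn : 2 ≤ n) {T : MvPolynomial (Fin 2) K ×
    MvPolynomial (Fin 2) K × MvPolynomial (Fin 2) K × MvPolynomial (Fin 2) K}
    (hT : T ∈ normalFormDomain K n) : (normalFormLin T).IsHomogeneous n := by
  obtain ⟨m, rfl⟩ := Nat.exists_eq_add_of_le' hn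
  obtain ⟨h1, h2, h3, h4⟩ := hT
  exact (((binaryInc_isHomogeneous h1).add
    ((binaryInc_isHomogeneous h2).mul (isHomogeneous_X K 2))).add
    ((binaryInc_isHomogeneous h3).mul (isHomogeneous_X K 3))).add
    ((binaryInc_isHomogeneous h4).mul ((isHomogeneous_X K 2).mul (isHomogeneous_X K 3)))

/-! ### Projective models of the curve -/

/-- `Z` is the image of the curve `z₂² = f(z₀, z₁)`, `z₃² = g(z₀, z₁)` under the linear
embedding `M`. -/
structure CurveModel (Z : Set (P5 K)) (M : (Fin 4 → K) →ₗ[K] (Fin 6 → K)) (f g : Fin 3 → K) :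
    Prop where
  inj : Function.Injective M
  mem_iff : ∀ p : P5 K, p ∈ Z ↔ ∃ z ∈ curveCone f g, M z = p.rep

section

variable {ι κ : Type*} [Fintype ι] [DecidableEq ι]

/-- Pulling back polynomials along a linear map. -/
def pullback (M : (ι → K) →ₗ[K] (κ → K)) : MvPolynomial κ K →ₐ[K] MvPolynomial ι K :=
  aeval fun i => ∑ j, C (M (Pi.single j 1) i) * X j

lemma apply_eq_sum (M : (ι → K) →ₗ[K] (κ → K)) (z : ι → K) (i : κ) :
    M z i = ∑ j, M (Pi.single j 1) i * z j := by
  conv_lhs => rw [LinearMap.pi_apply_eq_sum_univ M z]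
  simp only [Finset.sum_apply, Pi.smul_apply, smul_eq_mul]
  refine Finset.sum_congr rfl fun j _ => ?_
  rw [mul_comm]
  congr 1
  refine congrArg (fun y => M y i) ?_
  funext k
  simp [Pi.single_apply, eq_comm]

lemma eval_pullback (M : (ι → K) →ₗ[K] (κ → K)) (F : MvPolynomial κ K) (z : ι → K) :
    eval z (pullback M F) = eval (M z) F := by
  have : (eval z).comp (pullback M).toRingHom = eval (M z) := by
    apply MvPolynomial.ringHom_ext
    · intro r; simp [pullback]
    · intro i; simp [pullback, apply_eq_sum M z i]
  exact congrArg (fun h => h F) this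

lemma pullback_isHomogeneous (M : (ι → K) →ₗ[K] (κ → K)) {F : MvPolynomial κ K} {n : ℕ}
    (hF : F.IsHomogeneous n) : (pullback M F).IsHomogeneous n := by
  have := hF.aeval (n := 1) (fun i => ∑ j, C (M (Pi.single j 1) i) * X j)
    fun i => IsHomogeneous.sum _ _ _ fun j _ => isHomogeneous_C_mul_X _ _
  rwa [one_mul] at this

end

lemma smul_mem_curveCone {f g : Fin 3 → K} {z : Fin 4 → K} (hz : z ∈ curveCone f g) (a : K) :
    a • z ∈ curveCone f g := by
  obtain ⟨h1, h2⟩ := hz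
  constructor <;> simp only [bq, Pi.smul_apply, smul_eq_mul] at *
  · linear_combination a ^ 2 * h1
  · linear_combination a ^ 2 * h2

lemma exists_mem_curveCone [IsAlgClosed K] (f g : Fin 3 → K) (u v : K) :
    ∃ z ∈ curveCone f g, z 0 = u ∧ z 1 = v := by
  obtain ⟨s, hs⟩ := exists_sq_eq (bq f u v)
  obtain ⟨t, ht⟩ := exists_sq_eq (bq g u v)
  exact ⟨![u, v, s, t], ⟨by simpa using hs, by simpa using ht⟩, rfl, rfl⟩

namespace CurveModel

variable {Z : Set (P5 K)} {M : (Fin 4 → K) →ₗ[K] (Fin 6 → K)} {f g : Fin 3 → K}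

lemma map_ne_zero (h : CurveModel Z M f g) {z : Fin 4 → K} (hz : z ≠ 0) : M z ≠ 0 :=
  fun h0 => hz (h.inj (by simpa using h0))

lemma mk_mem (h : CurveModel Z M f g) {z : Fin 4 → K} (hz : z ∈ curveCone f g) (h0 : z ≠ 0) :
    Projectivization.mk K (M z) (h.map_ne_zero h0) ∈ Z := by
  obtain ⟨a, -, ha⟩ := exists_rep_eq (K := K) (h.map_ne_zero h0)
  exact (h.mem_iff _).2 ⟨a • z, smul_mem_curveCone hz a, by rw [map_smul, ha]⟩

/-- Exchanging `z₂` and `z₃` lets statements about `f` be applied to `g`. -/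
lemma swap (h : CurveModel Z M f g) :
    CurveModel Z (M ∘ₗ LinearMap.funLeft K K (Equiv.swap 2 3)) g f := by
  have hs : ∀ z : Fin 4 → K, LinearMap.funLeft K K (Equiv.swap 2 3)
      (LinearMap.funLeft K K (Equiv.swap 2 3) z) = z := by
    intro z; ext i; simp [LinearMap.funLeft_apply]
  have hc : ∀ (f g : Fin 3 → K) (z : Fin 4 → K), z ∈ curveCone f g →
      LinearMap.funLeft K K (Equiv.swap (2 : Fin 4) 3) z ∈ curveCone g f := by
    intro f g z hz
    have h0 : (Equiv.swap (2 : Fin 4) 3) 0 = 0 := by decide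
    have h1 : (Equiv.swap (2 : Fin 4) 3) 1 = 1 := by decide
    exact ⟨by simpa [LinearMap.funLeft_apply, h0, h1] using hz.2,
      by simpa [LinearMap.funLeft_apply, h0, h1] using hz.1⟩
  refine ⟨h.inj.comp (Function.LeftInverse.injective hs), fun p => ?_⟩
  rw [h.mem_iff]
  constructor
  · rintro ⟨z, hz, e⟩
    exact ⟨_, hc _ _ _ hz, by rw [LinearMap.comp_apply, hs, e]⟩
  · rintro ⟨z, hz, e⟩
    exact ⟨_, hc _ _ _ hz, e⟩

lemma nonempty [IsAlgClosed K] (h : CurveModel Z M f g) : Z.Nonempty := by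
  obtain ⟨z, hz, h0, -⟩ := exists_mem_curveCone f g 1 0
  exact ⟨_, h.mk_mem hz (by rintro rfl; simp at h0)⟩

lemma vanish_iff [IsAlgClosed K] (h : CurveModel Z M f g) {n : ℕ} {F : MvPolynomial (Fin 6) K}
    (hF : F.IsHomogeneous n) : (∀ p ∈ Z, eval p.rep F = 0) ↔
      ∀ z ∈ curveCone f g, eval z (pullback M F) = 0 := by
  constructor
  · intro hZ
    have key : ∀ z ∈ curveCone f g, z ≠ 0 → eval (M z) F = 0 := fun z hz h0 =>
      (eval_rep_eq_zero_iff hF _).1 (hZ _ (h.mk_mem hz h0))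
    intro z hz
    rw [eval_pullback]
    by_cases h0 : z = 0
    -- The vertex of the cone is not a projective point; scaling a nonzero point of the cone to `0`
    -- settles it, constant forms included.
    · obtain ⟨y, hy, hy0, -⟩ := exists_mem_curveCone f g 1 0
      have := key y hy (by rintro rfl; simp at hy0)
      rw [h0, map_zero, ← zero_smul K (M y), eval_smul_of_isHomogeneous hF, this, mul_zero]
    · exact key z hz h0
  · intro hz p hp
    obtain ⟨z, hzc, e⟩ := (h.mem_iff p).1 hp
    rw [← e, ← eval_pullback]
    exact hz z hzc

lemma exists_leftInverse (h : CurveModel Z M f g) :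
    ∃ L : (Fin 6 → K) →ₗ[K] (Fin 4 → K), ∀ z, L (M z) = z := by
  obtain ⟨L, hL⟩ := LinearMap.exists_leftInverse_of_injective M (LinearMap.ker_eq_bot.2 h.inj)
  exact ⟨L, fun z => by rw [← LinearMap.comp_apply, hL]; rfl⟩

/-- The curve is irreducible if `f` and `g` have distinct roots and not the same roots. -/
lemma not_isReducible [IsAlgClosed K] [CharZero K] (h : CurveModel Z M f g) (hf : bdisc f ≠ 0)
    (hg : bdisc g ≠ 0) {r : Fin 2 → K} (h0 : bq f (r 0) (r 1) = 0) (h1 : bq g (r 0) (r 1) ≠ 0) :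
    ¬ IsReducible Z := by
  rintro ⟨A, B, ⟨S, hS, rfl⟩, ⟨T, hT, rfl⟩, hA, hB, hAB⟩
  have key : ∀ U : Set (MvPolynomial (Fin 6) K), zeroLocus U ≠ Z → zeroLocus U ⊆ Z →
      ∃ F ∈ U, ∃ p ∈ Z, eval p.rep F ≠ 0 := by
    intro U hU hsub
    by_contra! hn
    exact hU (hsub.antisymm fun p hp F hF => hn F hF p hp)
  obtain ⟨F, hFS, p, hp, hFp⟩ := key S hA (hAB ▸ Set.subset_union_left)
  obtain ⟨G, hGT, q, hq, hGq⟩ := key T hB (hAB ▸ Set.subset_union_right)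
  obtain ⟨m, hm⟩ := hS F hFS
  obtain ⟨n, hn⟩ := hT G hGT
  have hv : ∀ s ∈ Z, eval s.rep (F * G) = 0 := by
    intro s hs
    rw [hAB] at hs
    rcases hs with hs | hs
    · simp [hs F hFS]
    · simp [hs G hGT]
  have hv' := (h.vanish_iff (hm.mul hn)).1 hv
  rw [map_mul] at hv'
  rcases eval_eq_zero_or_of_mul (nonSq_bqPoly hf) (nonSq_bqPoly hg) (nonSq_bqPoly_mul hf h0 h1)
    (bqPoly_ne_zero hf) (bqPoly_ne_zero hg) (pullback_isHomogeneous M hm)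
    (pullback_isHomogeneous M hn) hv' with h' | h'
  · exact hFp ((h.vanish_iff hm).2 h' p hp)
  · exact hGq ((h.vanish_iff hn).2 h' q hq)

lemma hilbertFunction_eq [IsAlgClosed K] [CharZero K] (h : CurveModel Z M f g) (hf : bdisc f ≠ 0)
    (hg : bdisc g ≠ 0) {n : ℕ} (hn : 2 ≤ n) : hilbertFunction Z n = 4 * n := by
  obtain ⟨L, hL⟩ := h.exists_leftInverse
  let ev : MvPolynomial (Fin 4) K →ₗ[K] (curveCone f g → K) :=
    LinearMap.pi fun z => (aeval (R := K) z.1).toLinearMap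
  have hev : ∀ G z, ev G z = eval z.1 G := fun G z => by simp [ev, aeval_eq_eval]
  -- `Ω` restricts forms of the ambient space to the curve, with kernel the forms vanishing on `Z`;
  -- `Θ` restricts normal forms and is injective. The images agree: pullbacks reduce to normal
  -- forms, and every normal form is a pullback thanks to the left inverse `L`.
  let Ω : homogeneousSubmodule (Fin 6) K n →ₗ[K] (curveCone f g → K) :=
    ev ∘ₗ (pullback M).toLinearMap ∘ₗ (homogeneousSubmodule (Fin 6) K n).subtype
  let Θ : normalFormDomain K n →ₗ[K] (curveCone f g → K) :=
    ev ∘ₗ normalFormLin ∘ₗ (normalFormDomain K n).subtype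
  have hker : LinearMap.ker Ω = (vanishingSubmodule Z).comap
      (homogeneousSubmodule (Fin 6) K n).subtype := by
    ext F
    have hF : F.1.IsHomogeneous n := F.2
    have := h.vanish_iff hF
    rw [LinearMap.mem_ker, funext_iff]
    simp only [vanishingSubmodule, Submodule.mem_comap, Submodule.mem_iInf, LinearMap.mem_ker]
    simp only [Ω, LinearMap.comp_apply, hev, Subtype.forall]
    simp only [aeval_eq_eval, AlgHom.toLinearMap_apply] at *
    exact this.symm
  have hrange : LinearMap.range Ω = LinearMap.range Θ := by
    apply le_antisymm
    · rintro _ ⟨F, rfl⟩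
      obtain ⟨T, hT, hFT⟩ := exists_normalForm f g (pullback_isHomogeneous M F.2)
      refine ⟨⟨T, hT⟩, ?_⟩
      ext z
      have := eval_eq_zero_of_mem_curveIdeal hFT z.2
      rw [map_sub, sub_eq_zero] at this
      simp only [Ω, Θ, LinearMap.comp_apply, hev]
      exact this.symm
    · rintro _ ⟨⟨T, hT⟩, rfl⟩
      have hTh := normalFormLin_isHomogeneous hn hT
      refine ⟨⟨pullback L (normalFormLin T), pullback_isHomogeneous L hTh⟩, ?_⟩
      ext z
      simp only [Ω, Θ, LinearMap.comp_apply, hev]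
      exact (eval_pullback M _ _).trans ((eval_pullback L _ _).trans (by rw [hL]; rfl))
  have hinj : Function.Injective Θ := by
    rw [← LinearMap.ker_eq_bot, LinearMap.ker_eq_bot']
    rintro ⟨T, hT⟩ h0
    have h0' := normalForm_eq_zero_of_eval (bqPoly_ne_zero hf) (bqPoly_ne_zero hg) (P := T.1)
      (Q := T.2.1) (R := T.2.2.1) (S := T.2.2.2) fun z hz => by
        have := congrFun h0 ⟨z, hz⟩
        exact this
    have hT0 : T = 0 := Prod.ext h0'.1 (Prod.ext h0'.2.1 (Prod.ext h0'.2.2.1 h0'.2.2.2))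
    exact Subtype.ext hT0
  rw [hilbertFunction, ← hker, (LinearMap.quotKerEquivRange Ω).finrank_eq, hrange,
    LinearMap.finrank_range_of_inj hinj, finrank_normalFormDomain hn]

end CurveModel

end

section

/-! ### Tangent spaces -/

section

variable {ι κ : Type*} [Fintype ι] [Fintype κ]

/-- The derivative of `F` at `x` in the direction `y`. -/
def dirDeriv (x y : ι → K) (F : MvPolynomial ι K) : K := ∑ i, eval x (pderiv i F) * y i

lemma dirDeriv_add (x y : ι → K) (F G : MvPolynomial ι K) :
    dirDeriv x y (F + G) = dirDeriv x y F + dirDeriv x y G := by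
  simp [dirDeriv, add_mul, Finset.sum_add_distrib]

lemma dirDeriv_mul (x y : ι → K) (F G : MvPolynomial ι K) :
    dirDeriv x y (F * G) = dirDeriv x y F * eval x G + eval x F * dirDeriv x y G := by
  simp only [dirDeriv, Finset.sum_mul, Finset.mul_sum, ← Finset.sum_add_distrib]
  refine Finset.sum_congr rfl fun i _ => ?_
  simp
  ring

@[simp] lemma dirDeriv_C (x y : ι → K) (a : K) : dirDeriv x y (C a) = 0 := by simp [dirDeriv]

@[simp] lemma dirDeriv_X (x y : ι → K) (i : ι) : dirDeriv x y (X i) = y i := by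
  classical
  simp [dirDeriv, pderiv_X, Pi.single_apply, apply_ite (eval x)]

lemma dirDeriv_sub (x y : ι → K) (F G : MvPolynomial ι K) :
    dirDeriv x y (F - G) = dirDeriv x y F - dirDeriv x y G := by
  simp [dirDeriv, sub_mul, Finset.sum_sub_distrib]

lemma dirDeriv_sum {τ : Type*} (x y : ι → K) (s : Finset τ) (F : τ → MvPolynomial ι K) :
    dirDeriv x y (∑ j ∈ s, F j) = ∑ j ∈ s, dirDeriv x y (F j) := by
  simp only [dirDeriv, map_sum, Finset.sum_mul]
  rw [Finset.sum_comm]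

lemma dirDeriv_pullback [DecidableEq ι] (M : (ι → K) →ₗ[K] (κ → K)) (x y : ι → K) (F : MvPolynomial κ K) :
    dirDeriv x y (pullback M F) = dirDeriv (M x) (M y) F := by
  induction F using MvPolynomial.induction_on with
  | C a => simp [pullback]
  | add F G hF hG => rw [map_add, dirDeriv_add, hF, hG, dirDeriv_add]
  | mul_X F i hF =>
    have h : dirDeriv x y (pullback M (X i)) = M y i := by
      rw [pullback, aeval_X, dirDeriv_sum, apply_eq_sum M y i]
      refine Finset.sum_congr rfl fun j _ => ?_
      simp [dirDeriv_mul]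
    rw [map_mul, dirDeriv_mul, hF, dirDeriv_mul, h, eval_pullback, eval_pullback, dirDeriv_X]

end

lemma mem_coneTangent {S : Set (MvPolynomial (Fin 6) K)} {p : P5 K} {y : Fin 6 → K} :
    y ∈ coneTangent S p ↔ ∀ F ∈ S, dirDeriv p.rep y F = 0 := by
  simp [coneTangent, dirDeriv]

lemma coneTangent_anti {S T : Set (MvPolynomial (Fin 6) K)} (h : S ⊆ T) (p : P5 K) :
    coneTangent T p ≤ coneTangent S p := fun _ hy =>
  mem_coneTangent.2 fun F hF => mem_coneTangent.1 hy F (h hF)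

/-- The differential of a binary quadratic form. -/
def bqDeriv (f : Fin 3 → K) (z y : Fin 4 → K) : K :=
  (2 * f 0 * z 0 + f 1 * z 1) * y 0 + (f 1 * z 0 + 2 * f 2 * z 1) * y 1

/-- The differentials of the equations of the curve. -/
def curveDifferential (f g : Fin 3 → K) (z : Fin 4 → K) : (Fin 4 → K) →ₗ[K] (Fin 2 → K) where
  toFun y := ![2 * z 2 * y 2 - bqDeriv f z y, 2 * z 3 * y 3 - bqDeriv g z y]
  map_add' x y := by ext i; fin_cases i <;> simp [bqDeriv] <;> ring
  map_smul' c y := by ext i; fin_cases i <;> simp [bqDeriv] <;> ring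

lemma mem_ker_curveDifferential {f g : Fin 3 → K} {z y : Fin 4 → K} :
    y ∈ LinearMap.ker (curveDifferential f g z) ↔
      2 * z 2 * y 2 = bqDeriv f z y ∧ 2 * z 3 * y 3 = bqDeriv g z y := by
  rw [LinearMap.mem_ker, funext_iff, Fin.forall_fin_two]
  simp [curveDifferential, sub_eq_zero]

lemma dirDeriv_bqPoly (f : Fin 3 → K) (z y : Fin 4 → K) :
    dirDeriv z y (binaryInc (bqPoly f)) = bqDeriv f z y := by
  simp [bqPoly, binaryInc, dirDeriv_add, dirDeriv_mul, pow_two, bqDeriv]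
  ring

/-- By the product rule, where an equation `E` vanishes the derivative of `aE` is `a` times that of
`E`. -/
lemma dirDeriv_eq_zero_of_mem_curveIdeal {f g : Fin 3 → K} {G : MvPolynomial (Fin 4) K}
    (hG : G ∈ curveIdeal f g) {z y : Fin 4 → K} (hz : z ∈ curveCone f g)
    (hy : y ∈ LinearMap.ker (curveDifferential f g z)) : dirDeriv z y G = 0 := by
  rw [mem_ker_curveDifferential] at hy
  obtain ⟨a, b, rfl⟩ := Ideal.mem_span_pair.1 hG
  have e1 := hz.1
  have e2 := hz.2
  simp only [dirDeriv_add, dirDeriv_mul, dirDeriv_sub, pow_two, dirDeriv_X, dirDeriv_bqPoly,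
    map_sub, map_mul, eval_X, eval_binaryInc, eval_bqPoly, Matrix.cons_val_zero,
    Matrix.cons_val_one]
  linear_combination dirDeriv z y a * e1 + dirDeriv z y b * e2 + eval z a * hy.1 + eval z b * hy.2

/-- The two partial derivatives are linear forms with determinant `-bdisc f`, so they have no common
zero besides the origin. -/
lemma exists_deriv_eq [CharZero K] {f : Fin 3 → K} (hf : bdisc f ≠ 0) {z : Fin 4 → K}
    (hz : ¬ (z 0 = 0 ∧ z 1 = 0)) (s : K) :
    ∃ a b : K, (2 * f 0 * z 0 + f 1 * z 1) * a + (f 1 * z 0 + 2 * f 2 * z 1) * b = s := by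
  by_cases h1 : 2 * f 0 * z 0 + f 1 * z 1 = 0
  · by_cases h2 : f 1 * z 0 + 2 * f 2 * z 1 = 0
    · exfalso
      have e0 : bdisc f * z 0 = 0 := by rw [bdisc]; linear_combination f 1 * h2 - 2 * f 2 * h1
      have e1 : bdisc f * z 1 = 0 := by rw [bdisc]; linear_combination f 1 * h1 - 2 * f 0 * h2
      simp [hf] at e0 e1
      exact hz ⟨e0, e1⟩
    · exact ⟨0, s / (f 1 * z 0 + 2 * f 2 * z 1), by rw [mul_div_cancel₀ _ h2]; ring⟩
  · exact ⟨s / (2 * f 0 * z 0 + f 1 * z 1), 0, by rw [mul_div_cancel₀ _ h1]; ring⟩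

/-- The curve is smooth if `f` and `g` have no multiple and no common roots. -/
lemma finrank_ker_curveDifferential [CharZero K] {f g : Fin 3 → K} (hf : bdisc f ≠ 0)
    (hg : bdisc g ≠ 0) {z : Fin 4 → K} (hz : z ∈ curveCone f g) (h0 : z ≠ 0)
    (hfg : ¬ (bq f (z 0) (z 1) = 0 ∧ bq g (z 0) (z 1) = 0)) :
    Module.finrank K (LinearMap.ker (curveDifferential f g z)) = 2 := by
  have hz01 : ¬ (z 0 = 0 ∧ z 1 = 0) := by
    rintro ⟨h0', h1'⟩
    obtain ⟨h2', h3'⟩ := hz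
    simp [h0', h1', bq] at h2' h3'
    apply h0
    ext i; fin_cases i <;> simp [*]
  have hsurj : LinearMap.range (curveDifferential f g z) = ⊤ := by
    rw [LinearMap.range_eq_top]
    intro w
    -- If `z₂ = 0` then `f` vanishes at the point, so `g` does not and `z₃ ≠ 0`; the first equation
    -- is then handled by the nonzero differential of `f`, the second by `y₃`. The case `z₃ = 0` is
    -- symmetric.
    by_cases h2 : z 2 = 0
    · have h3 : z 3 ≠ 0 := fun h3 => hfg ⟨by rw [← hz.1, h2]; ring, by rw [← hz.2, h3]; ring⟩
      obtain ⟨a, b, hab⟩ := exists_deriv_eq hf hz01 (-w 0)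
      refine ⟨![a, b, 0, (w 1 + bqDeriv g z ![a, b, 0, 0]) / (2 * z 3)], ?_⟩
      ext i; fin_cases i
      · simp [curveDifferential, bqDeriv, hab]
      · simp [curveDifferential, bqDeriv]; field_simp; ring
    · by_cases h3 : z 3 = 0
      · obtain ⟨a, b, hab⟩ := exists_deriv_eq hg hz01 (-w 1)
        refine ⟨![a, b, (w 0 + bqDeriv f z ![a, b, 0, 0]) / (2 * z 2), 0], ?_⟩
        ext i; fin_cases i
        · simp [curveDifferential, bqDeriv]; field_simp; ring
        · simp [curveDifferential, bqDeriv, hab]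
      · refine ⟨![0, 0, w 0 / (2 * z 2), w 1 / (2 * z 3)], ?_⟩
        ext i; fin_cases i
        · simp [curveDifferential, bqDeriv]; field_simp
        · simp [curveDifferential, bqDeriv]; field_simp
  have := LinearMap.finrank_range_add_finrank_ker (curveDifferential f g z)
  rw [hsurj, finrank_top, Module.finrank_fin_fun, Module.finrank_fin_fun] at this
  omega

namespace CurveModel

variable {M : (Fin 4 → K) →ₗ[K] (Fin 6 → K)} {f g : Fin 3 → K}

/-- Three tangent spaces are squeezed together: that of the equations `S` lies in the image of the
Jacobian kernel by `hT`, this lies in that of all vanishing forms since they pull back into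
`curveIdeal`, and the latter lies in the first. The Hilbert function `4n` means degree four and
genus one. -/
lemma smooth_genus_one [IsAlgClosed K] [CharZero K] {S : Set (MvPolynomial (Fin 6) K)}
    (hS : ∀ F ∈ S, ∃ n, F.IsHomogeneous n) (h : CurveModel (zeroLocus S) M f g)
    (hT : ∀ (p : P5 K) (z : Fin 4 → K), z ∈ curveCone f g → M z = p.rep →
      coneTangent S p ≤ (LinearMap.ker (curveDifferential f g z)).map M)
    (hf : bdisc f ≠ 0) (hg : bdisc g ≠ 0)
    (hfg : ∀ z : Fin 4 → K, z ∈ curveCone f g → z 2 = 0 → z 3 = 0 → z = 0) :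
    IsSmoothCurveOfGenus 1 (zeroLocus S) ∧
      ∀ p ∈ zeroLocus S, Module.finrank K (coneTangent S p) = 2 := by
  have hbase : ∀ u v : K, bq f u v = 0 → bq g u v = 0 → u = 0 ∧ v = 0 := by
    intro u v h1 h2
    have := hfg ![u, v, 0, 0] ⟨by simpa using h1.symm, by simpa using h2.symm⟩ rfl rfl
    exact ⟨congrFun this 0, congrFun this 1⟩
  have hsub : S ⊆ formsVanishingOn (zeroLocus S) := fun F hF => ⟨hS F hF, fun p hp => hp F hF⟩
  have htan : ∀ p ∈ zeroLocus S, Module.finrank K (coneTangent S p) = 2 ∧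
      coneTangent (formsVanishingOn (zeroLocus S)) p = coneTangent S p := by
    intro p hp
    obtain ⟨z, hz, e⟩ := (h.mem_iff p).1 hp
    have h1 := hT p z hz e
    have h2 : (LinearMap.ker (curveDifferential f g z)).map M ≤
        coneTangent (formsVanishingOn (zeroLocus S)) p := by
      rintro _ ⟨y, hy, rfl⟩
      rw [mem_coneTangent]
      rintro F ⟨⟨n, hn⟩, hF⟩
      rw [← e, ← dirDeriv_pullback]
      exact dirDeriv_eq_zero_of_mem_curveIdeal (mem_curveIdeal_of_eval (bqPoly_ne_zero hf)
        (bqPoly_ne_zero hg) (pullback_isHomogeneous M hn) ((h.vanish_iff hn).1 hF)) hz hy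
    have h3 := coneTangent_anti hsub p
    have h4 : coneTangent S p = (LinearMap.ker (curveDifferential f g z)).map M :=
      le_antisymm h1 (h2.trans h3)
    refine ⟨?_, le_antisymm h3 (h1.trans h2)⟩
    have hz0 : z ≠ 0 := by
      rintro rfl
      exact p.rep_nonzero (by rw [← e, map_zero])
    rw [h4, ← (Submodule.equivMapOfInjective M h.inj _).finrank_eq, finrank_ker_curveDifferential hf hg hz hz0]
    rintro ⟨h5, h6⟩
    refine hz0 (hfg z hz ?_ ?_)
    · simpa [h5] using hz.1
    · simpa [h6] using hz.2
  refine ⟨⟨⟨S, hS, rfl⟩, h.nonempty, ?_, ⟨4, by norm_num, ?_⟩, fun p hp => ?_⟩,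
    fun p hp => (htan p hp).1⟩
  · obtain ⟨r, hr, h0⟩ := exists_bq_root f
    refine h.not_isReducible hf hg h0 fun h1 => hr ?_
    obtain ⟨e0, e1⟩ := hbase _ _ h0 h1
    ext i; fin_cases i
    · exact e0
    · exact e1
  · filter_upwards [Filter.eventually_ge_atTop 2] with n hn
    rw [h.hilbertFunction_eq hf hg hn]
    push_cast
    ring
  · rw [(htan p hp).2, (htan p hp).1]

end CurveModel

end

section

/-! ### Curves that split into conics -/

/-- The ternary quadratic form `w² - g(u, v)`. -/
def conicForm (g : Fin 3 → K) : QuadraticForm K (Fin 3 → K) :=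
  QuadraticMap.linMulLin (LinearMap.proj 2) (LinearMap.proj 2)
    - g 0 • QuadraticMap.linMulLin (LinearMap.proj 0) (LinearMap.proj 0)
    - g 1 • QuadraticMap.linMulLin (LinearMap.proj 0) (LinearMap.proj 1)
    - g 2 • QuadraticMap.linMulLin (LinearMap.proj 1) (LinearMap.proj 1)

lemma conicForm_apply (g : Fin 3 → K) (y : Fin 3 → K) :
    conicForm g y = y 2 ^ 2 - bq g (y 0) (y 1) := by
  simp [conicForm, bq]; ring

lemma quadRank_conicForm_comp [CharZero K] {g : Fin 3 → K} (hg : bdisc g ≠ 0) {W : Type*}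
    [AddCommGroup W] [Module K W] (e : W ≃ₗ[K] (Fin 3 → K)) :
    quadRank ((conicForm g).comp e.toLinearMap) = 3 := by
  have : Module.Finite K W := Module.Finite.equiv e.symm
  have hker : LinearMap.ker ((conicForm g).comp e.toLinearMap).polarBilin = ⊥ := by
    rw [LinearMap.ker_eq_bot']
    intro x hx
    have h : ∀ y : Fin 3 → K, 2 * e x 2 * y 2 - (2 * g 0 * e x 0 + g 1 * e x 1) * y 0
        - (g 1 * e x 0 + 2 * g 2 * e x 1) * y 1 = 0 := by
      intro y
      have := LinearMap.congr_fun hx (e.symm y)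
      simp [QuadraticMap.polar, conicForm_apply, bq] at this
      linear_combination this
    have h0 := h ![1, 0, 0]
    have h1 := h ![0, 1, 0]
    have h2 := h ![0, 0, 1]
    simp at h0 h1 h2
    have e0 : bdisc g * e x 0 = 0 := by rw [bdisc]; linear_combination 2 * g 2 * h0 - g 1 * h1
    have e1 : bdisc g * e x 1 = 0 := by rw [bdisc]; linear_combination 2 * g 0 * h1 - g 1 * h0
    simp [hg] at e0 e1
    apply e.injective
    rw [map_zero]
    ext i; fin_cases i <;> simp [*]
  have := LinearMap.finrank_range_add_finrank_ker ((conicForm g).comp e.toLinearMap).polarBilin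
  rw [hker, finrank_bot, e.finrank_eq, Module.finrank_fin_fun] at this
  simpa [quadRank] using this

lemma exists_bq_ne_zero [CharZero K] {f : Fin 3 → K} (hf : bqPoly f ≠ 0) :
    ∃ u v, bq f u v ≠ 0 := by
  by_contra! h
  exact hf (MvPolynomial.funext fun w => by simp [h])

/-- The functional `z₂ - a z₀ - b z₁ - c z₃`. -/
def planeFunctional (a b c : K) : (Fin 4 → K) →ₗ[K] K :=
  LinearMap.proj 2 - a • LinearMap.proj 0 - b • LinearMap.proj 1 - c • LinearMap.proj 3

lemma planeFunctional_apply (a b c : K) (z : Fin 4 → K) :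
    planeFunctional a b c z = z 2 - (a * z 0 + b * z 1 + c * z 3) := by
  simp [planeFunctional]; ring

/-- A parametrization of the kernel of `planeFunctional`. -/
def planeParam (a b c : K) : (Fin 3 → K) →ₗ[K] (Fin 4 → K) where
  toFun y := ![y 0, y 1, a * y 0 + b * y 1 + c * y 2, y 2]
  map_add' x y := by ext i; fin_cases i <;> simp; ring
  map_smul' s y := by ext i; fin_cases i <;> simp; ring

namespace CurveModel

variable {Z : Set (P5 K)} {M : (Fin 4 → K) →ₗ[K] (Fin 6 → K)} {f g : Fin 3 → K}

/-- In the plane `z₂ = az₀ + bz₁ + cz₃`, `H` makes the equation for `z₂` a consequence of `z₃² = g`,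
leaving a conic of rank three. The coefficients `a, b` serve the case where `f` is a square, and `c`
the case where `f` is a multiple of `g`. -/
lemma isSmoothConic [CharZero K] (h : CurveModel Z M f g) (hg : bdisc g ≠ 0)
    {L : (Fin 6 → K) →ₗ[K] (Fin 4 → K)} (hL : ∀ z, L (M z) = z) {a b c : K}
    (H : ∀ u v w, w ^ 2 = bq g u v → (a * u + b * v + c * w) ^ 2 = bq f u v) :
    IsSmoothConic (Z ∩ {p | planeFunctional a b c (L p.rep) = 0}) := by
  have hinj : Function.Injective (M ∘ₗ planeParam a b c) := by
    refine h.inj.comp fun x y hxy => ?_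
    ext i; fin_cases i
    · exact congrFun hxy 0
    · exact congrFun hxy 1
    · exact congrFun hxy 3
  let e := LinearEquiv.ofInjective _ hinj
  refine ⟨LinearMap.range (M ∘ₗ planeParam a b c), (conicForm g).comp e.symm.toLinearMap,
    ?_, quadRank_conicForm_comp hg e.symm, ?_⟩
  · rw [LinearMap.finrank_range_of_inj hinj, Module.finrank_fin_fun]
  · have he : ∀ y (hy : (M ∘ₗ planeParam a b c) y ∈ LinearMap.range (M ∘ₗ planeParam a b c)),
        e.symm ⟨_, hy⟩ = y := fun y hy => by
      rw [LinearEquiv.symm_apply_eq]; rfl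
    ext p
    constructor
    · rintro ⟨hp, hφ⟩
      obtain ⟨z, hz, ez⟩ := (h.mem_iff p).1 hp
      rw [Set.mem_ofPred_eq, ← ez, hL, planeFunctional_apply] at hφ
      have hN : (M ∘ₗ planeParam a b c) ![z 0, z 1, z 3] = p.rep := by
        rw [← ez, LinearMap.comp_apply]
        congr 1
        ext i; fin_cases i <;> simp [planeParam]
        linear_combination -hφ
      refine ⟨⟨_, hN⟩, ?_⟩
      have := he ![z 0, z 1, z 3] ⟨_, rfl⟩
      simp only [hN] at this
      rw [QuadraticMap.comp_apply, LinearEquiv.coe_coe, this, conicForm_apply]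
      simpa [sub_eq_zero] using hz.2
    · rintro ⟨⟨y, hy⟩, hq⟩
      have := he y ⟨_, rfl⟩
      simp only [hy] at this
      rw [QuadraticMap.comp_apply, LinearEquiv.coe_coe, this, conicForm_apply, sub_eq_zero] at hq
      refine ⟨(h.mem_iff p).2 ⟨planeParam a b c y, ⟨?_, ?_⟩, hy⟩, ?_⟩
      · exact H _ _ _ hq
      · exact hq
      · rw [Set.mem_ofPred_eq, ← hy, LinearMap.comp_apply, hL, planeFunctional_apply]
        simp [planeParam]

lemma eq_union_of_sq (h : CurveModel Z M f g) {L : (Fin 6 → K) →ₗ[K] (Fin 4 → K)}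
    (hL : ∀ z, L (M z) = z) {a b c : K}
    (H : ∀ u v w, w ^ 2 = bq g u v → (a * u + b * v + c * w) ^ 2 = bq f u v) :
    Z = (Z ∩ {p | planeFunctional a b c (L p.rep) = 0}) ∪
      (Z ∩ {p | planeFunctional (-a) (-b) (-c) (L p.rep) = 0}) := by
  rw [← Set.inter_union_distrib_left, eq_comm, Set.inter_eq_left]
  intro p hp
  obtain ⟨z, hz, ez⟩ := (h.mem_iff p).1 hp
  have h1 : z 2 ^ 2 = (a * z 0 + b * z 1 + c * z 3) ^ 2 := by rw [H _ _ _ hz.2, hz.1]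
  simp only [Set.mem_union, Set.mem_ofPred_eq, ← ez, hL, planeFunctional_apply]
  rcases sq_eq_sq_iff_eq_or_eq_neg.1 h1 with h2 | h2
  · left; rw [h2]; ring
  · right; rw [h2]; ring

/-- Distinguishes the two halves of the curve: over a point with `f ≠ 0` the two values of `z₂`
differ. -/
lemma exists_mem_plane_of_sq [IsAlgClosed K] [CharZero K] (h : CurveModel Z M f g)
    (hf : bqPoly f ≠ 0) {L : (Fin 6 → K) →ₗ[K] (Fin 4 → K)} (hL : ∀ z, L (M z) = z) {a b c : K}
    (H : ∀ u v w, w ^ 2 = bq g u v → (a * u + b * v + c * w) ^ 2 = bq f u v) :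
    ∃ p ∈ Z, planeFunctional a b c (L p.rep) = 0 ∧
      planeFunctional (-a) (-b) (-c) (L p.rep) ≠ 0 := by
  obtain ⟨u, v, huv⟩ := exists_bq_ne_zero hf
  obtain ⟨w, hw⟩ := exists_sq_eq (bq g u v)
  have hl := H u v w hw
  have hz : ![u, v, a * u + b * v + c * w, w] ∈ curveCone f g :=
    ⟨by simpa using hl, by simpa using hw⟩
  have hl0 : a * u + b * v + c * w ≠ 0 := fun h0 => huv (by rw [← hl, h0]; ring)
  have hz0 : ![u, v, a * u + b * v + c * w, w] ≠ 0 := fun h0 => hl0 (by simpa using congrFun h0 2)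
  obtain ⟨s, hs, hrep⟩ := exists_rep_eq (K := K) (h.map_ne_zero hz0)
  refine ⟨_, h.mk_mem hz hz0, ?_, fun h0 => hl0 ?_⟩
  · rw [hrep, map_smul, hL, map_smul, planeFunctional_apply]
    simp
  · rw [hrep, map_smul, hL, map_smul, planeFunctional_apply] at h0
    simp [hs] at h0
    have h2 : 2 * (a * u + b * v + c * w) = 0 := by linear_combination h0
    simpa using h2

lemma neg_sq_of_sq {a b c : K}
    (H : ∀ u v w, w ^ 2 = bq g u v → (a * u + b * v + c * w) ^ 2 = bq f u v) :
    ∀ u v w, w ^ 2 = bq g u v → (-a * u + -b * v + -c * w) ^ 2 = bq f u v :=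
  fun u v w hw => by rw [← H u v w hw]; ring

/-- If `f` is a square on the curve, then the curve is the union of two smooth conics. -/
lemma exists_smooth_conics [IsAlgClosed K] [CharZero K] (h : CurveModel Z M f g)
    (hf : bqPoly f ≠ 0) (hg : bdisc g ≠ 0) {a b c : K}
    (H : ∀ u v w, w ^ 2 = bq g u v → (a * u + b * v + c * w) ^ 2 = bq f u v) :
    ∃ C₁ C₂ : Set (P5 K), IsSmoothConic C₁ ∧ IsSmoothConic C₂ ∧ C₁ ≠ C₂ ∧ Z = C₁ ∪ C₂ := by
  obtain ⟨L, hL⟩ := h.exists_leftInverse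
  refine ⟨_, _, h.isSmoothConic hg hL H, h.isSmoothConic hg hL (neg_sq_of_sq H), fun hne => ?_,
    h.eq_union_of_sq hL H⟩
  obtain ⟨p, hp, h1, h2⟩ := h.exists_mem_plane_of_sq hf hL H
  have hmem : p ∈ Z ∩ {p | planeFunctional a b c (L p.rep) = 0} := ⟨hp, h1⟩
  rw [hne] at hmem
  exact h2 hmem.2

/-- If `f` is a square on the curve, then the curve is reducible. -/
lemma isReducible_of_sq [IsAlgClosed K] [CharZero K] (h : CurveModel Z M f g)
    (hZ : IsZariskiClosed Z) (hf : bqPoly f ≠ 0) {a b c : K}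
    (H : ∀ u v w, w ^ 2 = bq g u v → (a * u + b * v + c * w) ^ 2 = bq f u v) :
    IsReducible Z := by
  obtain ⟨L, hL⟩ := h.exists_leftInverse
  refine ⟨_, _, hZ.inter (isZariskiClosed_hyperplane (planeFunctional a b c ∘ₗ L)),
    hZ.inter (isZariskiClosed_hyperplane (planeFunctional (-a) (-b) (-c) ∘ₗ L)),
    fun hne => ?_, fun hne => ?_, h.eq_union_of_sq hL H⟩
  · obtain ⟨p, hp, -, h2⟩ := h.exists_mem_plane_of_sq hf hL (neg_sq_of_sq H)
    rw [neg_neg, neg_neg, neg_neg] at h2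
    exact h2 (Set.inter_eq_left.1 hne hp)
  · obtain ⟨p, hp, -, h2⟩ := h.exists_mem_plane_of_sq hf hL H
    exact h2 (Set.inter_eq_left.1 hne hp)

/-- An irreducible closed subset of the curve on which `f` is the square of `a u + b v` lies in one
of the planes `z₂ = ± (a z₀ + b z₁)`. -/
lemma exists_sign_of_not_isReducible (h : CurveModel Z M f g)
    {C : Set (P5 K)} (hC : ¬ IsReducible C) (hcl : IsZariskiClosed C) (hCZ : C ⊆ Z) {a b : K}
    (H : ∀ u v, bq f u v = (a * u + b * v) ^ 2) :
    ∃ ε : K, (ε = 1 ∨ ε = -1) ∧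
      ∀ z (hz : M z ≠ 0), Projectivization.mk K (M z) hz ∈ C → z 2 = ε * (a * z 0 + b * z 1) := by
  obtain ⟨L, hL⟩ := h.exists_leftInverse
  have hsub : C ⊆ {p : P5 K | planeFunctional a b 0 (L p.rep) = 0} ∪
      {p : P5 K | planeFunctional (-a) (-b) 0 (L p.rep) = 0} := by
    intro p hp
    obtain ⟨z, hz, ez⟩ := (h.mem_iff p).1 (hCZ hp)
    have h1 : z 2 ^ 2 = (a * z 0 + b * z 1) ^ 2 := by rw [← H, hz.1]
    simp only [Set.mem_union, Set.mem_ofPred_eq, ← ez, hL, planeFunctional_apply]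
    rcases sq_eq_sq_iff_eq_or_eq_neg.1 h1 with h2 | h2
    · left; rw [h2]; ring
    · right; rw [h2]; ring
  rcases subset_or_subset_of_not_isReducible hC hcl
    (isZariskiClosed_hyperplane (planeFunctional a b 0 ∘ₗ L))
    (isZariskiClosed_hyperplane (planeFunctional (-a) (-b) 0 ∘ₗ L)) hsub with h' | h'
  · refine ⟨1, .inl rfl, fun z hz hm => ?_⟩
    obtain ⟨s, hs, hrep⟩ := exists_rep_eq (K := K) hz
    have := h' hm
    rw [Set.mem_ofPred_eq, hrep, map_smul, LinearMap.comp_apply, hL, planeFunctional_apply] at this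
    simp [hs] at this
    linear_combination this
  · refine ⟨-1, .inr rfl, fun z hz hm => ?_⟩
    obtain ⟨s, hs, hrep⟩ := exists_rep_eq (K := K) hz
    have := h' hm
    rw [Set.mem_ofPred_eq, hrep, map_smul, LinearMap.comp_apply, hL, planeFunctional_apply] at this
    simp [hs] at this
    linear_combination this

/-- A curve which is the union of two irreducible closed sets meeting in two points is a union of
two smooth conics. -/
lemma exists_smooth_conics_of_union [IsAlgClosed K] [CharZero K] (h : CurveModel Z M f g)
    (hf : bqPoly f ≠ 0) (hg : bqPoly g ≠ 0) {C₁ C₂ : Set (P5 K)}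
    (hC₁ : IsZariskiClosed C₁) (hC₂ : IsZariskiClosed C₂) (hi₁ : ¬ IsReducible C₁)
    (hi₂ : ¬ IsReducible C₂) (hZ : Z = C₁ ∪ C₂) {p q : P5 K} (hpq : p ≠ q)
    (hint : C₁ ∩ C₂ = {p, q}) :
    ∃ C₁ C₂ : Set (P5 K), IsSmoothConic C₁ ∧ IsSmoothConic C₂ ∧ C₁ ≠ C₂ ∧ Z = C₁ ∪ C₂ := by
  -- If one piece were all of `Z`, the other would equal the intersection, a pair of points, which
  -- is reducible.
  have hred : IsReducible Z := by
    refine ⟨C₁, C₂, hC₁, hC₂, fun e => hi₂ ?_, fun e => hi₁ ?_, hZ⟩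
    · rw [← e, eq_comm, Set.union_eq_left] at hZ
      rw [← Set.inter_eq_right.2 hZ, hint]
      exact isReducible_pair hpq
    · rw [← e, eq_comm, Set.union_eq_right] at hZ
      rw [← Set.inter_eq_left.2 hZ, hint]
      exact isReducible_pair hpq
  by_cases df : bdisc f = 0
  · obtain ⟨a, b, hab⟩ := exists_sq_of_bdisc_eq_zero df
    by_cases dg : bdisc g = 0
    -- Both forms are squares, so the curve is the union of four lines given by the signs of `z₂`
    -- and `z₃`. Each irreducible piece has a single pair of signs, and two pieces cannot cover four
    -- pairs.
    · exfalso
      obtain ⟨a', b', hab'⟩ := exists_sq_of_bdisc_eq_zero dg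
      obtain ⟨ε₁, hε₁, h1⟩ := h.exists_sign_of_not_isReducible hi₁ hC₁
        (hZ ▸ Set.subset_union_left) hab
      obtain ⟨ε₂, hε₂, h2⟩ := h.exists_sign_of_not_isReducible hi₂ hC₂
        (hZ ▸ Set.subset_union_right) hab
      obtain ⟨δ₁, hδ₁, h1'⟩ := h.swap.exists_sign_of_not_isReducible hi₁ hC₁
        (hZ ▸ Set.subset_union_left) hab'
      obtain ⟨δ₂, hδ₂, h2'⟩ := h.swap.exists_sign_of_not_isReducible hi₂ hC₂
        (hZ ▸ Set.subset_union_right) hab'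
      obtain ⟨w, hw⟩ : ∃ w, eval w (bqPoly f * bqPoly g) ≠ 0 := by
        by_contra! h0
        exact mul_ne_zero hf hg (MvPolynomial.funext fun w => by simpa using h0 w)
      simp only [map_mul, eval_bqPoly, hab, hab', ne_eq, mul_eq_zero, not_or] at hw
      set l := a * w 0 + b * w 1
      set m := a' * w 0 + b' * w 1
      have hl : l ≠ 0 := by simpa using hw.1
      have hm : m ≠ 0 := by simpa using hw.2
      -- Over a point where neither form vanishes, all four sign pairs occur on the curve.
      have key : ∀ s t : K, (s = 1 ∨ s = -1) → (t = 1 ∨ t = -1) →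
          (s = ε₁ ∧ t = δ₁) ∨ (s = ε₂ ∧ t = δ₂) := by
        intro s t hs ht
        have hz : ![w 0, w 1, s * l, t * m] ∈ curveCone f g := by
          constructor
          · simp only [Matrix.cons_val]
            rw [hab]
            rcases hs with rfl | rfl <;> ring
          · simp only [Matrix.cons_val]
            rw [hab']
            rcases ht with rfl | rfl <;> ring
        have hz0 : ![w 0, w 1, s * l, t * m] ≠ 0 := by
          intro h0
          have := congrFun h0 2
          rcases hs with rfl | rfl <;> simp [hl] at this
        have hM := h.map_ne_zero hz0
        have hsw : M ![w 0, w 1, s * l, t * m] =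
            (M ∘ₗ LinearMap.funLeft K K (Equiv.swap 2 3)) ![w 0, w 1, t * m, s * l] := by
          rw [LinearMap.comp_apply]
          congr 1
          ext i; fin_cases i <;> rfl
        have hmem := h.mk_mem hz hz0
        replace hmem := hZ.subset hmem
        rcases hmem with hmem | hmem
        · left
          have e1 := h1 _ _ hmem
          simp only [hsw] at hmem
          have e2 := h1' _ _ hmem
          exact ⟨mul_right_cancel₀ hl e1, mul_right_cancel₀ hm e2⟩
        · right
          have e1 := h2 _ _ hmem
          simp only [hsw] at hmem
          have e2 := h2' _ _ hmem
          exact ⟨mul_right_cancel₀ hl e1, mul_right_cancel₀ hm e2⟩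
      have neg : ∀ s : K, (s = 1 ∨ s = -1) → (-s = 1 ∨ -s = -1) ∧ -s ≠ s := by
        rintro s (rfl | rfl) <;> norm_num
      have k1 := key (-ε₁) δ₁ (neg _ hε₁).1 hδ₁
      have k2 := key ε₁ (-δ₁) hε₁ (neg _ hδ₁).1
      have n1 := (neg _ hε₁).2
      have n2 := (neg _ hδ₁).2
      rcases k1 with k1 | k1
      · exact n1 k1.1
      · rcases k2 with k2 | k2
        · exact n2 k2.2
        · exact n1 (k1.1.trans k2.1.symm)
    · exact h.exists_smooth_conics hf dg (a := a) (b := b) (c := 0) fun u v w _ => by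
        rw [hab]; ring
  · by_cases dg : bdisc g = 0
    · obtain ⟨a, b, hab⟩ := exists_sq_of_bdisc_eq_zero dg
      exact h.swap.exists_smooth_conics hg df (a := a) (b := b) (c := 0) fun u v w _ => by
        rw [hab]; ring
    -- A root of `f` that is not a root of `g` would make the curve irreducible, so `g = μ f`.
    · obtain ⟨μ, hμ⟩ := exists_eq_smul_of_roots (g := g) df fun r hr => by
        by_contra hr'
        exact h.not_isReducible df dg hr hr' hred
      obtain ⟨c, hc⟩ := exists_sq_eq μ
      exact h.swap.exists_smooth_conics hg df (a := 0) (b := 0) (c := c) fun u v w hw => by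
        rw [hμ, ← hw, ← hc]; ring

end CurveModel

end

section

/-! ### The net of diagonal quadrics through the Büchi surface -/

/-- The coefficients of the three Büchi equations. -/
def netCoeff : Matrix (Fin 6) (Fin 3) ℤ :=
  !![-2, -2, -2; 1, 0, 0; -2, 1, 0; 1, -2, 1; 0, 1, -2; 0, 0, 1]

/-- The coefficients of the member of the net with parameter `s`. -/
def net : (Fin 3 → K) →ₗ[K] (Fin 6 → K) := (netCoeff.map (Int.cast : ℤ → K)).mulVecLin

/-- The diagonal quadratic form with coefficients `c`. -/
def diagForm (c x : Fin 6 → K) : K := ∑ i, c i * x i ^ 2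

lemma net_apply (s : Fin 3 → K) (i : Fin 6) : net s i = ∑ j, (netCoeff i j : K) * s j := by
  simp [net, Matrix.mulVec, dotProduct]

lemma net_eq (s : Fin 3 → K) : net s = ![-2 * (s 0 + s 1 + s 2), s 0, -2 * s 0 + s 1,
    s 0 - 2 * s 1 + s 2, s 1 - 2 * s 2, s 2] := by
  ext i
  rw [net_apply, Fin.sum_univ_three]
  fin_cases i <;> simp [netCoeff] <;> ring

lemma diagForm_add (c d x : Fin 6 → K) : diagForm (c + d) x = diagForm c x + diagForm d x := by
  simp [diagForm, add_mul, Finset.sum_add_distrib]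

lemma diagForm_smul (a : K) (c x : Fin 6 → K) : diagForm (a • c) x = a * diagForm c x := by
  simp [diagForm, Finset.mul_sum, mul_assoc]

/-- The cone over the Büchi surface. -/
def buchiCone (K : Type*) [Field K] : Set (Fin 6 → K) := {x | ∀ s, diagForm (net s) x = 0}

lemma mem_buchiCone_of_eqs {x : Fin 6 → K} (h1 : x 3 ^ 2 - 2 * x 2 ^ 2 + x 1 ^ 2 - 2 * x 0 ^ 2 = 0)
    (h2 : x 4 ^ 2 - 2 * x 3 ^ 2 + x 2 ^ 2 - 2 * x 0 ^ 2 = 0)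
    (h3 : x 5 ^ 2 - 2 * x 4 ^ 2 + x 3 ^ 2 - 2 * x 0 ^ 2 = 0) : x ∈ buchiCone K := by
  intro s
  rw [diagForm, net_eq, Fin.sum_univ_six]
  simp only [Matrix.cons_val]
  linear_combination s 0 * h1 + s 1 * h2 + s 2 * h3

lemma mem_buchiK3_iff {p : P5 K} : p ∈ buchiK3 K ↔ p.rep ∈ buchiCone K := by
  constructor
  · intro h
    apply mem_buchiCone_of_eqs
    · simpa using h _ (Or.inl rfl)
    · simpa using h _ (Or.inr (Or.inl rfl))
    · simpa using h _ (Or.inr (Or.inr rfl))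
  · intro h F hF
    have e := fun s => h s
    simp only [diagForm, net_eq, Fin.sum_univ_six, Matrix.cons_val] at e
    rcases hF with rfl | rfl | rfl
    · have := e ![1, 0, 0]
      simp at this ⊢
      linear_combination this
    · have := e ![0, 1, 0]
      simp at this ⊢
      linear_combination this
    · have := e ![0, 0, 1]
      simp at this ⊢
      linear_combination this

lemma smul_mem_buchiCone {x : Fin 6 → K} (hx : x ∈ buchiCone K) (a : K) :
    a • x ∈ buchiCone K := by
  intro s
  have : diagForm (net s) (a • x) = a ^ 2 * diagForm (net s) x := by
    simp only [diagForm, Finset.mul_sum, Pi.smul_apply, smul_eq_mul]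
    exact Finset.sum_congr rfl fun i _ => by ring
  rw [this, hx s, mul_zero]

/-- The net is in general position; this is a finite check over `ℤ`, carried to `K` by
characteristic zero. -/
lemma netCoeff_det : ∀ i j k : Fin 6, i ≠ j → i ≠ k → j ≠ k →
    (netCoeff.submatrix ![i, j, k] id).det ≠ 0 := by
  simp only [Matrix.det_fin_three]
  decide

/-- A nonzero member of the net has at most two zero coefficients. -/
lemma eq_zero_of_net_eq_zero [CharZero K] {s : Fin 3 → K} {i j k : Fin 6} (hij : i ≠ j)
    (hik : i ≠ k) (hjk : j ≠ k) (hi : net s i = 0) (hj : net s j = 0) (hk : net s k = 0) :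
    s = 0 := by
  have hd := netCoeff_det i j k hij hik hjk
  have hd' : ((netCoeff.submatrix ![i, j, k] id).map (Int.castRingHom K)).det ≠ 0 := by
    rw [← RingHom.mapMatrix_apply, ← RingHom.map_det]
    simpa using hd
  apply Matrix.eq_zero_of_mulVec_eq_zero hd'
  rw [net_apply] at hi hj hk
  ext m
  fin_cases m <;> simpa [Matrix.mulVec, dotProduct]

lemma polarBilin_eq_of_orthogonal [CharZero K] {Q : QuadraticForm K (Fin 6 → K)}
    (h : ∀ i j, i ≠ j → QuadraticMap.polar Q (Pi.single i 1) (Pi.single j 1) = 0)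
    (x y : Fin 6 → K) :
    Q.polarBilin x y = ∑ i, 2 * Q (Pi.single i 1) * x i * y i := by
  have hx : x = ∑ i, x i • Pi.single i (1 : K) := by
    ext j; simp [Finset.sum_apply, Pi.single_apply]
  have hy : y = ∑ i, y i • Pi.single i (1 : K) := by
    ext j; simp [Finset.sum_apply, Pi.single_apply]
  conv_lhs => rw [hx, hy]
  simp only [map_sum, map_smul, LinearMap.sum_apply, LinearMap.smul_apply, smul_eq_mul,
    QuadraticMap.polarBilin_apply_apply]
  refine Finset.sum_congr rfl fun i _ => ?_
  rw [Finset.sum_eq_single i]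
  · rw [QuadraticMap.polar_self]
    simp; ring
  · intro j _ hj
    rw [h j i hj]
    simp
  · simp

open Classical in
lemma quadRank_of_orthogonal [CharZero K] {Q : QuadraticForm K (Fin 6 → K)}
    (h : ∀ i j, i ≠ j → QuadraticMap.polar Q (Pi.single i 1) (Pi.single j 1) = 0) :
    quadRank Q = Fintype.card {i // 2 * Q (Pi.single i (1 : K)) ≠ 0} := by
  let e := ((Pi.basisFun K (Fin 6)).constr K (M' := K)).symm
  have hc : (e.toLinearMap ∘ₗ Q.polarBilin : (Fin 6 → K) →ₗ[K] (Fin 6 → K)) =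
      (Matrix.diagonal fun i => 2 * Q (Pi.single i (1 : K))).mulVecLin := by
    ext x i
    simp only [LinearMap.comp_apply, LinearMap.coe_single, Matrix.mulVecLin_apply]
    change Q.polarBilin (Pi.single x 1) (Pi.basisFun K (Fin 6) i) = _
    rw [polarBilin_eq_of_orthogonal h, Matrix.mulVec_diagonal]
    simp [Pi.single_apply]
  rw [← Matrix.rank_diagonal, Matrix.rank, ← hc, LinearMap.range_comp, quadRank,
    LinearEquiv.finrank_map_eq]

/-- The diagonal quadratic form with coefficients `c`. -/
def diagQuad (c : Fin 6 → K) : QuadraticForm K (Fin 6 → K) :=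
  ∑ i, c i • QuadraticMap.linMulLin (LinearMap.proj i) (LinearMap.proj i)

@[simp] lemma diagQuad_apply (c x : Fin 6 → K) : diagQuad c x = diagForm c x := by
  simp [diagQuad, diagForm, pow_two]

lemma diagForm_single (c : Fin 6 → K) (i : Fin 6) : diagForm c (Pi.single i 1) = c i := by
  simp [diagForm, Pi.single_apply]

open Classical in
lemma quadRank_diagQuad [CharZero K] (c : Fin 6 → K) :
    quadRank (diagQuad c) = Fintype.card {i // c i ≠ 0} := by
  rw [quadRank_of_orthogonal]
  · simp only [diagQuad_apply, diagForm_single, ne_eq, mul_eq_zero, two_ne_zero, false_or]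
  · intro i j hij
    simp only [QuadraticMap.polar, diagQuad_apply, diagForm, ← Finset.sum_sub_distrib]
    refine Finset.sum_eq_zero fun k _ => ?_
    by_cases hki : k = i
    · subst hki; simp [hij]
    · simp [hki]

/-- The quadrics through the Büchi surface are the members of the net. -/
lemma exists_eq_diagQuad_net [IsAlgClosed K] [CharZero K] {Q : QuadraticForm K (Fin 6 → K)}
    (hQ : ∀ p ∈ buchiK3 K, Q p.rep = 0) : ∃ s, Q = diagQuad (net s) := by
  have hX : ∀ x ∈ buchiCone K, Q x = 0 := by
    intro x hx
    by_cases h0 : x = 0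
    · rw [h0, map_zero]
    · obtain ⟨a, ha, hr⟩ := exists_rep_eq (K := K) h0
      have := hQ (Projectivization.mk K x h0)
        (mem_buchiK3_iff.2 (by rw [hr]; exact smul_mem_buchiCone hx a))
      rw [hr, QuadraticMap.map_smul] at this
      simpa [ha] using this
  -- The cone is invariant under changing the sign of one coordinate. Comparing `Q` at a point and
  -- at its reflection determines its polar value with the basis vector.
  have flip : ∀ x ∈ buchiCone K, ∀ i, x - (2 * x i) • Pi.single i 1 ∈ buchiCone K := by
    intro x hx i s
    rw [← hx s, diagForm, diagForm]
    refine Finset.sum_congr rfl fun j _ => ?_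
    by_cases hj : j = i
    · subst hj; simp; left; ring
    · simp [hj]
  have hpol : ∀ x ∈ buchiCone K, ∀ i, x i ≠ 0 →
      QuadraticMap.polar Q x (Pi.single i 1) = 2 * x i * Q (Pi.single i 1) := by
    intro x hx i hi
    have h1 := hX _ (flip x hx i)
    rw [sub_eq_add_neg, ← neg_smul, QuadraticMap.map_add Q, hX x hx, QuadraticMap.map_smul,
      QuadraticMap.polar_smul_right] at h1
    apply mul_left_cancel₀ (mul_ne_zero two_ne_zero hi)
    simp only [smul_eq_mul] at h1
    linear_combination -h1
  -- Consecutive squares have second difference `2`, so this point lies on the cone; all its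
  -- coordinates are nonzero.
  let x₀ : Fin 6 → K := ![1, 1, 2, 3, 4, 5]
  have hx₀ : x₀ ∈ buchiCone K := by
    apply mem_buchiCone_of_eqs <;> simp [x₀] <;> norm_num
  have hx₀' : ∀ i, x₀ i ≠ 0 := by intro i; fin_cases i <;> simp [x₀]
  have horth : ∀ i j, i ≠ j → QuadraticMap.polar Q (Pi.single i 1) (Pi.single j 1) = 0 := by
    intro i j hij
    -- Reflecting `x₀` in coordinate `i` leaves coordinate `j` and hence the right-hand side
    -- unchanged, while the left-hand side changes by `2 x_i` times the mixed polar value.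
    have h1 := hpol x₀ hx₀ j (hx₀' j)
    have h2 := hpol _ (flip x₀ hx₀ i) j (by simpa [hij.symm] using hx₀' j)
    rw [sub_eq_add_neg, ← neg_smul, QuadraticMap.polar_add_left,
      QuadraticMap.polar_smul_left, h1] at h2
    simp [hij.symm] at h2
    exact h2.resolve_left (hx₀' i)
  have hval : ∀ x, Q x = ∑ i, Q (Pi.single i 1) * x i ^ 2 := by
    intro x
    have h1 := polarBilin_eq_of_orthogonal horth x x
    rw [QuadraticMap.polarBilin_apply_apply, QuadraticMap.polar_self] at h1
    apply mul_left_cancel₀ (two_ne_zero (α := K))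
    rw [Finset.mul_sum]
    simp only [nsmul_eq_mul, Nat.cast_ofNat] at h1
    rw [h1]
    exact Finset.sum_congr rfl fun i _ => by ring
  obtain ⟨c, hc⟩ : ∃ c : Fin 6 → K, ∀ i, Q (Pi.single i 1) = c i := ⟨_, fun _ => rfl⟩
  simp only [hc] at hval
  choose r hr using fun n : ℕ => exists_sq_eq (n : K)
  -- The vectors of squares of these three points are `(0,1,1,1,1,1)`, `(0,1,2,3,4,5)` and
  -- `(1,1,4,9,16,25)`. They span the orthogonal complement of the net, so orthogonality to them
  -- puts `c` in the net.
  have k1 := hX ![0, 1, 1, 1, 1, 1] (by apply mem_buchiCone_of_eqs <;> simp <;> norm_num)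
  have k2 := hX ![0, r 1, r 2, r 3, r 4, r 5] (by
    apply mem_buchiCone_of_eqs <;> simp [hr] <;> norm_num)
  have k3 := hX x₀ hx₀
  rw [hval, Fin.sum_univ_six] at k1 k2 k3
  simp [hr, x₀] at k1 k2 k3
  have hs : c = net ![c 1, c 4 + 2 * c 5, c 5] := by
    rw [net_eq]
    ext i
    fin_cases i <;> simp
    · linear_combination k3 + 6 * k1 - 5 * k2
    · linear_combination 3 * k1 - k2
    · linear_combination k2 - 2 * k1
  refine ⟨![c 1, c 4 + 2 * c 5, c 5], ?_⟩
  ext x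
  rw [diagQuad_apply, ← hs, hval, diagForm]

lemma IsRankFourQuadricThroughX.exists_net [IsAlgClosed K] [CharZero K]
    {Q : QuadraticForm K (Fin 6 → K)} (hQ : IsRankFourQuadricThroughX Q) :
    ∃ s a b, a ≠ b ∧ s ≠ 0 ∧ net s a = 0 ∧ net s b = 0 ∧ Q = diagQuad (net s) := by
  classical
  obtain ⟨s, rfl⟩ := exists_eq_diagQuad_net hQ.2
  have h4 := hQ.1
  rw [quadRank_diagQuad] at h4
  have hcard := Fintype.card_subtype_compl (fun i => net s i ≠ 0)
  rw [h4, Fintype.card_fin, Fintype.card_subtype] at hcard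
  obtain ⟨a, b, hab, h⟩ := Finset.card_eq_two.1 hcard
  have ha : a ∈ Finset.univ.filter fun i => ¬ net s i ≠ 0 := h ▸ (by simp)
  have hb : b ∈ Finset.univ.filter fun i => ¬ net s i ≠ 0 := h ▸ (by simp)
  refine ⟨s, a, b, hab, ?_, by simpa using ha, by simpa using hb, rfl⟩
  rintro rfl
  simp at h4

lemma isRankFourQuadricThroughX_diagQuad [CharZero K] {s : Fin 3 → K} (hs : s ≠ 0) {a b : Fin 6}
    (hab : a ≠ b) (ha : net s a = 0) (hb : net s b = 0) :
    IsRankFourQuadricThroughX (diagQuad (net s)) := by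
  classical
  refine ⟨?_, fun p hp => ?_⟩
  · have : ∀ i, net s i ≠ 0 ↔ i ∉ ({a, b} : Finset (Fin 6)) := by
      intro i
      simp only [Finset.mem_insert, Finset.mem_singleton, not_or]
      constructor
      · intro hi
        exact ⟨fun e => hi (e ▸ ha), fun e => hi (e ▸ hb)⟩
      · rintro ⟨hia, hib⟩ h0
        exact hs (eq_zero_of_net_eq_zero hab (Ne.symm hia) (Ne.symm hib) ha hb h0)
    rw [quadRank_diagQuad, Fintype.card_subtype]
    simp only [this]
    rw [Finset.filter_notMem_eq_sdiff, Finset.card_sdiff_of_subset (Finset.subset_univ _),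
      Finset.card_pair hab]
    rfl
  · rw [diagQuad_apply]
    exact mem_buchiK3_iff.1 hp s

end

section

/-! ### Common isotropic subspaces and plane conics -/

lemma sum_mul_eq_zero_of_isotropic [CharZero K] {ι : Type*} [Fintype ι] {a : ι → K}
    {W : Submodule K (ι → K)} (h : ∀ x ∈ W, ∑ i, a i * x i ^ 2 = 0) {x y : ι → K} (hx : x ∈ W)
    (hy : y ∈ W) : ∑ i, a i * x i * y i = 0 := by
  have h1 := h _ (W.add_mem hx hy)
  have h2 : ∑ i, a i * (x + y) i ^ 2 =
      ∑ i, a i * x i ^ 2 + ∑ i, a i * y i ^ 2 + 2 * ∑ i, a i * x i * y i := by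
    rw [Finset.mul_sum, ← Finset.sum_add_distrib, ← Finset.sum_add_distrib]
    exact Finset.sum_congr rfl fun i _ => by rw [Pi.add_apply]; ring
  rw [h2, h x hx, h y hy] at h1
  simpa using h1

/-- Two diagonal quadratic forms with distinct ratios of coefficients have no common isotropic
subspace of half the dimension. -/
lemma not_isotropic_of_distinct [IsAlgClosed K] [CharZero K] {ι : Type*} [Fintype ι]
    {a b : ι → K} (hab : ∀ i j, i ≠ j → a i * b j ≠ a j * b i) {W : Submodule K (ι → K)}
    (hW : 2 * Module.finrank K W = Fintype.card ι) (h0 : Module.finrank K W ≠ 0)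
    (ha : ∀ x ∈ W, ∑ i, a i * x i ^ 2 = 0) (hb : ∀ x ∈ W, ∑ i, b i * x i ^ 2 = 0) : False := by
  classical
  have : Nontrivial ι := Fintype.one_lt_card_iff_nontrivial.1 (by omega)
  -- The pencil contains a nondegenerate form: the product of the coefficients is a nonzero
  -- polynomial in `c`.
  obtain ⟨c, hc⟩ : ∃ c : K, ∀ i, a i + c * b i ≠ 0 := by
    by_contra! hn
    have hz : ∏ i, (Polynomial.C (a i) + Polynomial.C (b i) * Polynomial.X) = 0 := by
      apply Polynomial.funext
      intro c
      obtain ⟨i, hi⟩ := hn c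
      rw [Polynomial.eval_prod, Polynomial.eval_zero]
      refine Finset.prod_eq_zero (Finset.mem_univ i) ?_
      simp
      linear_combination hi
    obtain ⟨i, -, hi⟩ := Finset.prod_eq_zero_iff.1 hz
    obtain ⟨j, hj⟩ := exists_ne i
    have e0 := congrArg (Polynomial.eval 0) hi
    have e1 := congrArg (Polynomial.eval 1) hi
    simp at e0 e1
    simp [e0] at e1
    exact hab j i hj (by simp [e0, e1])
  set a' : ι → K := fun i => a i + c * b i with ha'
  have hiso : ∀ x ∈ W, ∑ i, a' i * x i ^ 2 = 0 := by
    intro x hx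
    have : ∑ i, a' i * x i ^ 2 = ∑ i, a i * x i ^ 2 + c * ∑ i, b i * x i ^ 2 := by
      rw [Finset.mul_sum, ← Finset.sum_add_distrib]
      exact Finset.sum_congr rfl fun i _ => by simp only [ha']; ring
    rw [this, ha x hx, hb x hx]; simp
  let B : LinearMap.BilinForm K (ι → K) := Matrix.toBilin' (Matrix.diagonal a')
  have hB : ∀ x y, B x y = ∑ i, a' i * x i * y i := by
    intro x y
    simp only [B, Matrix.toBilin'_apply', dotProduct, Matrix.mulVec_diagonal]
    exact Finset.sum_congr rfl fun i _ => by ring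
  have hBnd : B.Nondegenerate := by
    apply (LinearMap.BilinForm.nondegenerate_toBilin'_iff_det_ne_zero).2
    rw [Matrix.det_diagonal]
    exact Finset.prod_ne_zero_iff.2 fun i _ => hc i
  have hBs : B.IsRefl := by
    intro x y hxy
    rw [hB] at hxy ⊢
    rw [← hxy]
    exact Finset.sum_congr rfl fun i _ => by ring
  -- An isotropic subspace of half the dimension is its own orthogonal complement.
  have horth : B.orthogonal W = W := by
    symm
    apply Submodule.eq_of_le_of_finrank_eq
    · intro x hx y hy
      change B y x = 0
      rw [hB]
      exact sum_mul_eq_zero_of_isotropic hiso hy hx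
    · rw [LinearMap.BilinForm.finrank_orthogonal hBnd, Module.finrank_fintype_fun_eq_card]
      omega
  -- `T` compares the two forms: `B(y, Tx)` is the bilinear form of `b`, so `T` preserves `W` and
  -- has an eigenvector there. The eigenvalues of `T` on the coordinate axes are distinct, so this
  -- vector lies on an axis, where `B` is not isotropic.
  let T : Module.End K (ι → K) := (Matrix.diagonal fun i => b i / a' i).mulVecLin
  have hT : ∀ x i, T x i = b i / a' i * x i := fun x i => by
    simp [T, Matrix.mulVec_diagonal]
  have hTW : ∀ x ∈ W, T x ∈ W := by
    intro x hx
    rw [← horth]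
    intro y hy
    change B y (T x) = 0
    rw [hB, ← sum_mul_eq_zero_of_isotropic hb hy hx]
    refine Finset.sum_congr rfl fun i _ => ?_
    rw [hT]
    have := hc i
    change a' i ≠ 0 at this
    field_simp
  have : Nontrivial W := Module.nontrivial_of_finrank_pos (R := K) (Nat.pos_of_ne_zero h0)
  obtain ⟨μ, hμ⟩ := Module.End.exists_eigenvalue (T.restrict hTW)
  obtain ⟨w, hw⟩ := hμ.exists_hasEigenvector
  have hw1 : ∀ i, b i / a' i * w.1 i = μ * w.1 i := by
    intro i
    rw [← hT]
    exact congrFun (congrArg Subtype.val hw.apply_eq_smul) i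
  have hw0 : w.1 ≠ 0 := fun h => hw.2 (Subtype.ext h)
  obtain ⟨i, hi⟩ := Function.ne_iff.1 hw0
  have hother : ∀ j, j ≠ i → w.1 j = 0 := by
    intro j hji
    by_contra hj
    have h1 := mul_right_cancel₀ hi (hw1 i)
    have h2 := mul_right_cancel₀ hj (hw1 j)
    have h3 := h1.trans h2.symm
    rw [div_eq_div_iff (hc i) (hc j)] at h3
    exact hab j i hji (by linear_combination h3)
  have := hiso w.1 w.2
  rw [Finset.sum_eq_single i (fun j _ hj => by rw [hother j hj]; ring) (by simp)] at this
  have h4 : w.1 i ≠ 0 := hi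
  exact mul_ne_zero (hc i) (pow_ne_zero 2 h4) this

/-! ### Quadratic forms vanishing on a plane conic -/

section

variable {V : Type*} [AddCommGroup V] [Module K V]

lemma map_add_smul (q : QuadraticForm K V) (x y : V) (t : K) :
    q (x + t • y) = q x + t * QuadraticMap.polar q x y + t ^ 2 * q y := by
  rw [QuadraticMap.map_add q, QuadraticMap.map_smul, QuadraticMap.polar_smul_right]
  rw [smul_eq_mul, smul_eq_mul]
  ring

/-- There are `w` and `x₀` spanning a line that meets the quadric in two distinct points. -/
lemma exists_secant [CharZero K] [FiniteDimensional K V] {q : QuadraticForm K V}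
    (hq : 2 ≤ quadRank q) : ∃ w x₀, q w ≠ 0 ∧
      QuadraticMap.polar q x₀ w ^ 2 - 4 * q x₀ * q w ≠ 0 := by
  by_contra! hn
  have hrank : ∀ φ : Module.Dual K V, LinearMap.range q.polarBilin ≤ K ∙ φ → False := by
    intro φ h
    have h1 := Submodule.finrank_mono h
    have h2 : Module.finrank K (K ∙ φ) ≤ 1 := by
      simpa using finrank_span_le_card (R := K) ({φ} : Set (Module.Dual K V))
    have h3 : 2 ≤ 1 := hq.trans (h1.trans h2)
    omega
  by_cases h0 : ∃ w, q w ≠ 0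
  · obtain ⟨w, hw⟩ := h0
    apply hrank (q.polarBilin w)
    rintro _ ⟨x, rfl⟩
    rw [Submodule.mem_span_singleton]
    -- If every line through `w` is tangent, polarising the identity of vanishing discriminants
    -- expresses each functional `polar q x` as a multiple of `polar q w`, so the rank is at most
    -- one.
    refine ⟨QuadraticMap.polar q x w / (2 * q w), ?_⟩
    ext y
    simp only [LinearMap.smul_apply, QuadraticMap.polarBilin_apply_apply, smul_eq_mul]
    have e1 := hn w x hw
    have e2 := hn w y hw
    have e3 := hn w (x + y) hw
    rw [QuadraticMap.polar_add_left, QuadraticMap.map_add q] at e3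
    rw [QuadraticMap.polar_comm q w y]
    field_simp
    linear_combination (e3 - e1 - e2) / 2
  · push Not at h0
    apply hrank 0
    rintro _ ⟨x, rfl⟩
    rw [Submodule.mem_span_singleton]
    refine ⟨0, ?_⟩
    ext y
    simp [QuadraticMap.polar, h0]

/-- For a quadric of rank at least two there is a point `w` such that a quadratic form vanishing
on the quadric and at `w` is zero. -/
lemma exists_point_of_two_le_quadRank [IsAlgClosed K] [CharZero K] [FiniteDimensional K V]
    {q : QuadraticForm K V} (hq : 2 ≤ quadRank q) : ∃ w, ∀ q' : QuadraticForm K V,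
      (∀ x, q x = 0 → q' x = 0) → q' w = 0 → ∀ x, q' x = 0 := by
  obtain ⟨w, x₀, hw, hx₀⟩ := exists_secant hq
  refine ⟨w, fun q' hq' hw' x => ?_⟩
  -- The line through `y` in direction `w` meets the quadric in two distinct points. On it `q'` is
  -- affine linear in the parameter, because `q' w = 0`, and has two zeros.
  have gen : ∀ y, QuadraticMap.polar q y w ^ 2 - 4 * q y * q w ≠ 0 → q' y = 0 := by
    intro y hy
    obtain ⟨e, he⟩ := exists_sq_eq (QuadraticMap.polar q y w ^ 2 - 4 * q y * q w)
    have he0 : e ≠ 0 := by rintro rfl; simp at he; exact hy he.symm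
    have root : ∀ e, e ^ 2 = QuadraticMap.polar q y w ^ 2 - 4 * q y * q w →
        q' y + (e - QuadraticMap.polar q y w) / (2 * q w) * QuadraticMap.polar q' y w = 0 := by
      intro e he
      have h1 := hq' (y + ((e - QuadraticMap.polar q y w) / (2 * q w)) • w) (by
        rw [map_add_smul]
        field_simp
        linear_combination he)
      rw [map_add_smul, hw'] at h1
      linear_combination h1
    have r1 := root e he
    have r2 := root (-e) (by rw [← he]; ring)
    have h3 : e / q w * QuadraticMap.polar q' y w = 0 := by
      field_simp at r1 r2 ⊢
      linear_combination (r1 - r2) / 2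
    have h4 : QuadraticMap.polar q' y w = 0 := by
      simpa [he0, hw] using h3
    simpa [h4] using r1
  -- Along `x₀ + t x` the product of `q'` and the discriminant vanishes identically. The
  -- discriminant is nonzero at `t = 0`, so `q'` vanishes as a polynomial in `t`, and `q' x` is its
  -- coefficient of `t²`.
  have hprod : (Polynomial.C (q' x₀) + Polynomial.C (QuadraticMap.polar q' x₀ x) * Polynomial.X +
      Polynomial.C (q' x) * Polynomial.X ^ 2) *
      ((Polynomial.C (QuadraticMap.polar q x₀ w) + Polynomial.C (QuadraticMap.polar q x w) *
        Polynomial.X) ^ 2 - 4 * (Polynomial.C (q x₀) + Polynomial.C (QuadraticMap.polar q x₀ x) *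
        Polynomial.X + Polynomial.C (q x) * Polynomial.X ^ 2) * Polynomial.C (q w)) = 0 := by
    apply Polynomial.funext
    intro t
    have h1 := gen (x₀ + t • x)
    rw [map_add_smul, map_add_smul, QuadraticMap.polar_add_left, QuadraticMap.polar_smul_left] at h1
    simp only [smul_eq_mul] at h1
    simp only [Polynomial.eval_mul, Polynomial.eval_add, Polynomial.eval_sub, Polynomial.eval_pow,
      Polynomial.eval_C, Polynomial.eval_X, Polynomial.eval_ofNat, Polynomial.eval_zero,
      mul_eq_zero]
    by_contra! hne
    apply hne.1
    rw [← h1 fun h => hne.2 ?_]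
    · ring
    · rw [← h]; ring
  rcases mul_eq_zero.1 hprod with h | h
  · have := congrArg (fun p => Polynomial.coeff p 2) h
    simpa [Polynomial.coeff_X, Polynomial.coeff_C] using this
  · exfalso
    apply hx₀
    have := congrArg (Polynomial.eval 0) h
    simpa using this

end

/-- The net of quadrics through the Büchi surface, restricted to the plane of a conic, is
determined by the value at one point. -/
lemma exists_point_of_conic [IsAlgClosed K] [CharZero K] {W : Submodule K (Fin 6 → K)}
    {q : QuadraticForm K W} (hq : 2 ≤ quadRank q) (hX : planeConic W q ⊆ buchiK3 K) :
    ∃ w, ∀ s, diagForm (net s) w = 0 → ∀ x ∈ W, diagForm (net s) x = 0 := by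
  obtain ⟨w, hw⟩ := exists_point_of_two_le_quadRank hq
  refine ⟨w, fun s hs x hx => ?_⟩
  have := hw ((diagQuad (net s)).comp W.subtype) ?_ (by simpa using hs) ⟨x, hx⟩
  · simpa using this
  · rintro ⟨y, hy⟩ hqy
    simp only [QuadraticMap.comp_apply, Submodule.subtype_apply, diagQuad_apply]
    by_cases h0 : y = 0
    · simp [h0, diagForm]
    · obtain ⟨a, ha, hr⟩ := exists_rep_eq (K := K) h0
      have hmem : Projectivization.mk K y h0 ∈ planeConic W q := by
        refine ⟨by rw [hr]; exact W.smul_mem a hy, ?_⟩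
        have : (⟨(Projectivization.mk K y h0).rep, by rw [hr]; exact W.smul_mem a hy⟩ : W) =
            a • ⟨y, hy⟩ := Subtype.ext hr
        rw [this, QuadraticMap.map_smul, hqy, smul_zero]
      have h1 := mem_buchiK3_iff.1 (hX hmem)
      rw [hr] at h1
      have h2 := smul_mem_buchiCone h1 a⁻¹
      rw [inv_smul_smul₀ ha] at h2
      exact h2 s

/-- The plane of a conic on the Büchi surface lies in a quadric of rank four of the net. -/
lemma exists_rank_four_of_plane [IsAlgClosed K] [CharZero K] {W : Submodule K (Fin 6 → K)}
    (hW : Module.finrank K W = 3) {w : Fin 6 → K}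
    (hw : ∀ s, diagForm (net s) w = 0 → ∀ x ∈ W, diagForm (net s) x = 0) :
    ∃ s a b, a ≠ b ∧ s ≠ 0 ∧ net s a = 0 ∧ net s b = 0 ∧ ∀ x ∈ W, diagForm (net s) x = 0 := by
  let τ : (Fin 3 → K) →ₗ[K] K :=
    { toFun := fun s => diagForm (net s) w
      map_add' := fun s t => by rw [map_add, diagForm_add]
      map_smul' := fun c s => by rw [map_smul, diagForm_smul]; rfl }
  -- Vanishing at `w` is a single linear condition on a three-dimensional net.
  have hker : 1 < Module.finrank K (LinearMap.ker τ) := by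
    have h1 := LinearMap.finrank_range_add_finrank_ker τ
    have h2 := (LinearMap.range τ).finrank_le
    rw [Module.finrank_fin_fun] at h1
    rw [Module.finrank_self] at h2
    omega
  obtain ⟨s, hs0⟩ : ∃ s : LinearMap.ker τ, s ≠ 0 :=
    have := Module.nontrivial_of_finrank_pos (R := K) (Nat.lt_of_succ_lt hker)
    exists_ne 0
  obtain ⟨t, hst⟩ := exists_linearIndependent_pair_of_one_lt_finrank hker hs0
  have hs : ∀ x ∈ W, diagForm (net s.1) x = 0 := hw _ s.2
  have ht : ∀ x ∈ W, diagForm (net t.1) x = 0 := hw _ t.2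
  have comb : ∀ α β : K, ¬ (α = 0 ∧ β = 0) → α • s.1 + β • t.1 ≠ 0 ∧
      ∀ x ∈ W, diagForm (net (α • s.1 + β • t.1)) x = 0 := by
    intro α β h
    refine ⟨fun h0 => h (LinearIndependent.pair_iff.1 hst α β (Subtype.ext h0)), fun x hx => ?_⟩
    rw [map_add, map_smul, map_smul, diagForm_add, diagForm_smul, diagForm_smul, hs x hx, ht x hx]
    simp
  by_contra! hn
  -- If the coefficient ratios of `s` and `t` agreed at two places, a combination of them would
  -- vanish at both and have rank four.
  refine not_isotropic_of_distinct (a := net s.1) (b := net t.1) (fun i j hij heq => ?_)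
    (by rw [hW]; rfl) (by rw [hW]; norm_num) hs ht
  have key : ∀ α β : K, ¬ (α = 0 ∧ β = 0) → α * net s.1 i + β * net t.1 i = 0 →
      α * net s.1 j + β * net t.1 j = 0 → False := by
    intro α β h hi hj
    obtain ⟨h1, h2⟩ := comb α β h
    obtain ⟨x, hx, hx'⟩ := hn _ i j hij h1 (by simpa using hi) (by simpa using hj)
    exact hx' (h2 x hx)
  by_cases hi : net s.1 i = 0 ∧ net t.1 i = 0
  · by_cases hj : net s.1 j = 0 ∧ net t.1 j = 0
    · exact key 1 0 (by simp) (by simp [hi.1]) (by simp [hj.1])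
    · exact key (net t.1 j) (-net s.1 j) (fun h => hj ⟨by simpa using h.2, h.1⟩)
        (by simp [hi.1, hi.2]) (by ring)
  · exact key (net t.1 i) (-net s.1 i) (fun h => hi ⟨by simpa using h.2, h.1⟩)
      (by ring) (by linear_combination -heq)

end

section

/-! ### Members of rank four of the net -/

/-- The member of the net with parameter `s` has rank four, with zero coefficients at `a`, `b`. -/
structure IsRankFourMember (s : Fin 3 → K) (a b : Fin 6) : Prop where
  ne : a ≠ b
  ne_zero : s ≠ 0
  left : net s a = 0
  right : net s b = 0

/-- The coefficients of a member of the net can be prescribed at three places. -/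
lemma exists_net_eq [CharZero K] {i j k : Fin 6} (hij : i ≠ j) (hik : i ≠ k) (hjk : j ≠ k)
    (v : Fin 3 → K) : ∃ s : Fin 3 → K, net s i = v 0 ∧ net s j = v 1 ∧ net s k = v 2 := by
  let A : (Fin 3 → K) →ₗ[K] (Fin 3 → K) := LinearMap.funLeft K K ![i, j, k] ∘ₗ net
  have hA : ∀ s, A s = ![net s i, net s j, net s k] := by
    intro s; ext m; fin_cases m <;> rfl
  have hinj : Function.Injective A := by
    rw [← LinearMap.ker_eq_bot, LinearMap.ker_eq_bot']
    intro s hs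
    rw [hA] at hs
    exact eq_zero_of_net_eq_zero hij hik hjk (congrFun hs 0) (congrFun hs 1) (congrFun hs 2)
  obtain ⟨s, hs⟩ := LinearMap.injective_iff_surjective.1 hinj v
  rw [hA] at hs
  exact ⟨s, congrFun hs 0, congrFun hs 1, congrFun hs 2⟩

/-- A vector orthogonal to the net with three zero coordinates is zero. -/
lemma eq_zero_of_orthogonal_net [CharZero K] {y : Fin 6 → K} (hy : ∀ s, ∑ i, net s i * y i = 0)
    {a b d : Fin 6} (hab : a ≠ b) (had : a ≠ d) (hbd : b ≠ d) (ha : y a = 0) (hb : y b = 0)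
    (hd : y d = 0) : y = 0 := by
  ext i
  by_cases hi : i = a ∨ i = b ∨ i = d
  · rcases hi with rfl | rfl | rfl <;> assumption
  · push Not at hi
    have hcard : (({a, b, d, i} : Finset (Fin 6))ᶜ).card = 2 := by
      rw [Finset.card_compl, Fintype.card_fin, Finset.card_insert_of_notMem,
        Finset.card_insert_of_notMem, Finset.card_insert_of_notMem, Finset.card_singleton]
      · simpa using hi.2.2.symm
      · simpa using ⟨hbd, hi.2.1.symm⟩
      · simpa using ⟨hab, had, hi.1.symm⟩
    obtain ⟨j, k, hjk, hcompl⟩ := Finset.card_eq_two.1 hcard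
    have hmem : ∀ m, m ∈ ({a, b, d, i} : Finset (Fin 6)) ∨ m = j ∨ m = k := by
      intro m
      by_cases hm : m ∈ ({a, b, d, i} : Finset (Fin 6))
      · exact .inl hm
      · right
        rw [← Finset.mem_compl, hcompl] at hm
        simpa using hm
    have hij : i ≠ j := by
      rintro rfl
      have : i ∈ ({a, b, d, i} : Finset (Fin 6))ᶜ := hcompl ▸ (by simp)
      simp at this
    have hik : i ≠ k := by
      rintro rfl
      have : i ∈ ({a, b, d, i} : Finset (Fin 6))ᶜ := hcompl ▸ (by simp)
      simp at this
    -- A member that is `1` at `i` and `0` at the two other unconstrained places reduces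
    -- orthogonality to `y i = 0`.
    obtain ⟨s, h1, h2, h3⟩ := exists_net_eq hij hik hjk (![1, 0, 0] : Fin 3 → K)
    have := hy s
    rw [Finset.sum_eq_single i] at this
    · simpa [h1] using this
    · intro m _ hm
      rcases hmem m with h | rfl | rfl
      · simp only [Finset.mem_insert, Finset.mem_singleton] at h
        rcases h with rfl | rfl | rfl | rfl
        · simp [ha]
        · simp [hb]
        · simp [hd]
        · exact absurd rfl hm
      · simp [h2]
      · simp [h3]
    · simp

/-- Two members of the net which span it together with a member of rank four. -/
structure IsComplement (s sa sb : Fin 3 → K) (a b : Fin 6) : Prop where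
  left_left : net sa a = 1
  left_right : net sa b = 0
  right_left : net sb a = 0
  right_right : net sb b = 1
  span : ∀ r, ∃ x y z : K, r = x • s + y • sa + z • sb

lemma IsComplement.mem_buchiCone_iff {s sa sb : Fin 3 → K} {a b : Fin 6}
    (h : IsComplement s sa sb a b) {x : Fin 6 → K} : x ∈ buchiCone K ↔
      diagForm (net s) x = 0 ∧ diagForm (net sa) x = 0 ∧ diagForm (net sb) x = 0 := by
  refine ⟨fun hx => ⟨hx _, hx _, hx _⟩, fun hx r => ?_⟩
  obtain ⟨i, j, k, rfl⟩ := h.span r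
  simp [diagForm_add, diagForm_smul, hx]

namespace IsRankFourMember

variable {s : Fin 3 → K} {a b : Fin 6}

lemma swap (h : IsRankFourMember s a b) : IsRankFourMember s b a :=
  ⟨h.ne.symm, h.ne_zero, h.right, h.left⟩

variable [CharZero K]

lemma net_ne_zero (h : IsRankFourMember s a b) {i : Fin 6} (hia : i ≠ a) (hib : i ≠ b) :
    net s i ≠ 0 :=
  fun h0 => h.ne_zero (eq_zero_of_net_eq_zero h.ne hia.symm hib.symm h.left h.right h0)

lemma exists_complement (h : IsRankFourMember s a b) : ∃ sa sb, IsComplement s sa sb a b := by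
  obtain ⟨d, hd⟩ : ∃ d, d ∉ ({a, b} : Finset (Fin 6)) :=
    Finset.exists_mem_notMem_of_card_lt_card (s := {a, b}) (t := Finset.univ)
      (by rw [Finset.card_pair h.ne]; simp) |>.imp fun _ h => h.2
  simp only [Finset.mem_insert, Finset.mem_singleton, not_or] at hd
  have hda := Ne.symm hd.1
  have hdb := Ne.symm hd.2
  obtain ⟨sa, h1, h2, h3⟩ := exists_net_eq h.ne hda hdb (![1, 0, 0] : Fin 3 → K)
  obtain ⟨sb, h4, h5, h6⟩ := exists_net_eq h.ne hda hdb (![0, 1, 0] : Fin 3 → K)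
  simp at h1 h2 h3 h4 h5 h6
  refine ⟨sa, sb, h1, h2, h4, h5, fun r => ⟨net r d / net s d, net r a, net r b, ?_⟩⟩
  rw [← sub_eq_zero]
  have hne := h.net_ne_zero hd.1 hd.2
  apply eq_zero_of_net_eq_zero h.ne hda hdb
  · simp [h.left, h1, h4]
  · simp [h.right, h2, h5]
  · simp [h3, h6, hne]

/-- Equal ratios at `i` and `j` would give a combination of `s` and `r` with zeros at `b`, `i` and
`j`, hence zero; but its coefficient at `a` is not. -/
lemma ratio_ne (h : IsRankFourMember s a b) {r : Fin 3 → K} (hra : net r a = 1)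
    (hrb : net r b = 0) {i j : Fin 6} (hij : i ≠ j) (hib : i ≠ b) (hja : j ≠ a)
    (hjb : j ≠ b) : net s i * net r j ≠ net s j * net r i := by
  intro he
  have h0 : net r j • s - net s j • r = 0 := by
    apply eq_zero_of_net_eq_zero hib.symm hjb.symm hij
    · simp [h.right, hrb]
    · simp; linear_combination he
    · simp; ring
  have h1 := congrFun (congrArg net h0) a
  simp [h.left, hra] at h1
  exact h.net_ne_zero hja hjb h1

/-- The points of the Büchi surface with `x_a = x_b = 0` are finite in number. -/
lemma finite_points (h : IsRankFourMember s a b) :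
    {p : P5 K | p ∈ buchiK3 K ∧ p.rep a = 0 ∧ p.rep b = 0}.Finite := by
  obtain ⟨d, hd⟩ : ∃ d, d ∉ ({a, b} : Finset (Fin 6)) :=
    Finset.exists_mem_notMem_of_card_lt_card (s := {a, b}) (t := Finset.univ)
      (by rw [Finset.card_pair h.ne]; simp) |>.imp fun _ h => h.2
  simp only [Finset.mem_insert, Finset.mem_singleton, not_or] at hd
  have hda := Ne.symm hd.1
  have hdb := Ne.symm hd.2
  rcases Set.eq_empty_or_nonempty {p : P5 K | p ∈ buchiK3 K ∧ p.rep a = 0 ∧ p.rep b = 0} with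
    he | ⟨p₀, hp₀⟩
  · rw [he]; exact Set.finite_empty
  let ν : P5 K → (Fin 6 → K) := fun p => (p.rep d)⁻¹ • p.rep
  have hne : ∀ p : P5 K, p ∈ buchiK3 K ∧ p.rep a = 0 ∧ p.rep b = 0 → p.rep d ≠ 0 := by
    rintro p ⟨hp, hpa, hpb⟩ hpd
    have := eq_zero_of_orthogonal_net (y := fun i => p.rep i ^ 2) (mem_buchiK3_iff.1 hp) h.ne hda
      hdb (by simp [hpa]) (by simp [hpb]) (by simp [hpd])
    exact p.rep_nonzero (funext fun i => by simpa using congrFun this i)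
  have hfin : (Set.pi Set.univ fun i => ({ν p₀ i, -ν p₀ i} : Set K)).Finite :=
    Set.Finite.pi fun i => (Set.finite_singleton _).insert _
  refine Set.Finite.of_injOn (f := ν) ?_ ?_ hfin
  · intro p hp i _
    -- After normalising `x_d = 1`, the vectors of squares of two such points differ by a vector
    -- orthogonal to the net with zeros at `a, b, d`. So all coordinates agree up to sign.
    have hsub : (fun i => ν p i ^ 2 - ν p₀ i ^ 2) = 0 := by
      apply eq_zero_of_orthogonal_net _ h.ne hda hdb
      · simp [ν, hp.2.1, hp₀.2.1]
      · simp [ν, hp.2.2, hp₀.2.2]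
      · simp [ν, hne p hp, hne p₀ hp₀]
      · intro s
        have h1 := smul_mem_buchiCone (mem_buchiK3_iff.1 hp.1) (p.rep d)⁻¹ s
        have h2 := smul_mem_buchiCone (mem_buchiK3_iff.1 hp₀.1) (p₀.rep d)⁻¹ s
        simp only [mul_sub, Finset.sum_sub_distrib]
        rw [sub_eq_zero]
        exact h1.trans h2.symm
    exact sq_eq_sq_iff_eq_or_eq_neg.1 (sub_eq_zero.1 (congrFun hsub i))
  · intro p hp q hq hpq
    apply eq_of_rep_smul (a := p.rep d * (q.rep d)⁻¹)
    have : (p.rep d)⁻¹ • p.rep = (q.rep d)⁻¹ • q.rep := hpq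
    rw [mul_smul, ← this, smul_inv_smul₀ (hne p hp)]

end IsRankFourMember

/-! ### Fibers of the pencils -/

lemma diagForm_add_vec (c x y : Fin 6 → K) :
    diagForm c (x + y) = diagForm c x + diagForm c y + 2 * ∑ i, c i * x i * y i := by
  simp only [diagForm, Finset.mul_sum, ← Finset.sum_add_distrib]
  exact Finset.sum_congr rfl fun i _ => by rw [Pi.add_apply]; ring

lemma exists_of_cross_eq {t₀ t₁ x y : K} (ht : ¬ (t₀ = 0 ∧ t₁ = 0)) (h : t₁ * x = t₀ * y) :
    ∃ u, x = t₀ * u ∧ y = t₁ * u := by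
  by_cases h0 : t₀ = 0
  · have h1 : t₁ ≠ 0 := fun h1 => ht ⟨h0, h1⟩
    refine ⟨y / t₁, ?_, by field_simp⟩
    rw [h0] at h ⊢
    simpa [h1] using h
  · refine ⟨x / t₀, by field_simp, ?_⟩
    field_simp
    linear_combination -h

/-- The binary quadratic form obtained by restricting minus the diagonal form with coefficients `c`
to the plane `z₂ = z₃ = 0`. -/
def restrictForm (M : (Fin 4 → K) →ₗ[K] (Fin 6 → K)) (c : Fin 6 → K) : Fin 3 → K :=
  ![-∑ i, c i * M (Pi.single 0 1) i ^ 2,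
    -2 * ∑ i, c i * M (Pi.single 0 1) i * M (Pi.single 1 1) i,
    -∑ i, c i * M (Pi.single 1 1) i ^ 2]

lemma bq_restrictForm (M : (Fin 4 → K) →ₗ[K] (Fin 6 → K)) (c : Fin 6 → K) (u v : K) :
    bq (restrictForm M c) u v =
      -∑ i, c i * (u * M (Pi.single 0 1) i + v * M (Pi.single 1 1) i) ^ 2 := by
  have : ∑ i, c i * (u * M (Pi.single 0 1) i + v * M (Pi.single 1 1) i) ^ 2 =
      u ^ 2 * ∑ i, c i * M (Pi.single 0 1) i ^ 2 +
      2 * u * v * ∑ i, c i * M (Pi.single 0 1) i * M (Pi.single 1 1) i +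
      v ^ 2 * ∑ i, c i * M (Pi.single 1 1) i ^ 2 := by
    simp only [Finset.mul_sum, ← Finset.sum_add_distrib]
    exact Finset.sum_congr rfl fun i _ => by ring
  rw [this, bq, restrictForm]
  simp
  ring

namespace Ruling

variable {s : Fin 3 → K} {a b : Fin 6} (R : Ruling (diagQuad (net s)))

lemma eq_diagForm (x : Fin 6 → K) : diagForm (net s) x =
    (R.coeffs 0 ⬝ᵥ x) * (R.coeffs 3 ⬝ᵥ x) - (R.coeffs 1 ⬝ᵥ x) * (R.coeffs 2 ⬝ᵥ x) := by
  rw [← R.eq_form, diagQuad_apply]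

/-- A common zero of the four forms lies in the radical of `Q`, which is spanned by the coordinate
axes with zero coefficient. -/
lemma eq_zero_of_coeffs [CharZero K] {x : Fin 6 → K} (hx : ∀ k, R.coeffs k ⬝ᵥ x = 0) {i : Fin 6}
    (hi : net s i ≠ 0) : x i = 0 := by
  have h1 := diagForm_add_vec (net s) x (Pi.single i 1)
  simp only [R.eq_diagForm, dotProduct_add, hx] at h1
  have h2 : ∑ j, net s j * x j * (Pi.single i 1 : Fin 6 → K) j = net s i * x i := by
    simp [Pi.single_apply]
  rw [h2] at h1
  have h3 : net s i * x i = 0 := by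
    apply mul_left_cancel₀ (two_ne_zero (α := K))
    linear_combination -h1
  simpa [hi] using h3

/-- A parametrization of the linear space of dimension three containing a fiber. -/
structure IsFiberParam (t₀ t₁ : K) (a b : Fin 6) (M : (Fin 4 → K) →ₗ[K] (Fin 6 → K)) : Prop where
  inj : Function.Injective M
  coord_a : ∀ z, M z a = z 2
  coord_b : ∀ z, M z b = z 3
  form_zero : ∀ z, R.coeffs 0 ⬝ᵥ M z = t₀ * z 0
  form_one : ∀ z, R.coeffs 1 ⬝ᵥ M z = t₁ * z 0
  form_two : ∀ z, R.coeffs 2 ⬝ᵥ M z = t₀ * z 1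
  form_three : ∀ z, R.coeffs 3 ⬝ᵥ M z = t₁ * z 1
  surj : ∀ x, t₁ * (R.coeffs 0 ⬝ᵥ x) = t₀ * (R.coeffs 1 ⬝ᵥ x) →
    t₁ * (R.coeffs 2 ⬝ᵥ x) = t₀ * (R.coeffs 3 ⬝ᵥ x) → ∃ z, M z = x

lemma IsFiberParam.diagForm_net_eq_zero {t₀ t₁ : K}
    {M : (Fin 4 → K) →ₗ[K] (Fin 6 → K)} (hM : R.IsFiberParam t₀ t₁ a b M) (z : Fin 4 → K) :
    diagForm (net s) (M z) = 0 := by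
  rw [R.eq_diagForm, hM.form_zero, hM.form_one, hM.form_two, hM.form_three]
  ring

lemma mem_fiber_iff {t : P1 K} {p : P5 K} : p ∈ R.fiber t ↔ p ∈ buchiK3 K ∧
    t.rep 1 * (R.coeffs 0 ⬝ᵥ p.rep) = t.rep 0 * (R.coeffs 1 ⬝ᵥ p.rep) ∧
    t.rep 1 * (R.coeffs 2 ⬝ᵥ p.rep) = t.rep 0 * (R.coeffs 3 ⬝ᵥ p.rep) := by
  simp only [fiber, zeroLocus, fiberEquations, buchiK3, Set.mem_ofPred_eq, Set.mem_union,
    or_imp, forall_and, Set.mem_insert_iff, Set.mem_singleton_iff, forall_eq]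
  simp [sub_eq_zero]

variable [CharZero K]

/-- The four forms of the ruling together with `x_a` and `x_b` are coordinates on the whole space,
in which the fiber conditions are solved directly. -/
lemma exists_fiberParam (h : IsRankFourMember s a b) {t₀ t₁ : K} (ht : ¬ (t₀ = 0 ∧ t₁ = 0)) :
    ∃ M, R.IsFiberParam t₀ t₁ a b M := by
  let ℓ : Fin 4 → (Fin 6 → K) →ₗ[K] K := fun k => dotProductBilin K K (R.coeffs k)
  have hℓ : ∀ k x, ℓ k x = R.coeffs k ⬝ᵥ x := fun k x => rfl
  let Λ : (Fin 6 → K) →ₗ[K] (Fin 6 → K) := LinearMap.pi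
    ![ℓ 0, ℓ 1, ℓ 2, ℓ 3, LinearMap.proj a, LinearMap.proj b]
  have hΛ : ∀ x, Λ x = ![R.coeffs 0 ⬝ᵥ x, R.coeffs 1 ⬝ᵥ x, R.coeffs 2 ⬝ᵥ x, R.coeffs 3 ⬝ᵥ x,
      x a, x b] := by
    intro x; ext i; fin_cases i <;> rfl
  have hinj : Function.Injective Λ := by
    rw [← LinearMap.ker_eq_bot, LinearMap.ker_eq_bot']
    intro x hx
    rw [hΛ] at hx
    have hk : ∀ k, R.coeffs k ⬝ᵥ x = 0 := by
      intro k
      fin_cases k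
      · exact congrFun hx 0
      · exact congrFun hx 1
      · exact congrFun hx 2
      · exact congrFun hx 3
    ext i
    by_cases hia : i = a
    · subst hia; exact congrFun hx 4
    · by_cases hib : i = b
      · subst hib; exact congrFun hx 5
      · exact R.eq_zero_of_coeffs hk (h.net_ne_zero hia hib)
  let e := LinearEquiv.ofInjectiveEndo Λ hinj
  let N : (Fin 4 → K) →ₗ[K] (Fin 6 → K) :=
    LinearMap.pi ![t₀ • LinearMap.proj 0, t₁ • LinearMap.proj 0, t₀ • LinearMap.proj 1,
      t₁ • LinearMap.proj 1, LinearMap.proj 2, LinearMap.proj 3]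
  have hN : ∀ z, N z = ![t₀ * z 0, t₁ * z 0, t₀ * z 1, t₁ * z 1, z 2, z 3] := by
    intro z; ext i; fin_cases i <;> rfl
  have hM : ∀ z, Λ ((e.symm.toLinearMap ∘ₗ N) z) = N z := fun z => e.apply_symm_apply (N z)
  have hM' : ∀ z, ![R.coeffs 0 ⬝ᵥ (e.symm.toLinearMap ∘ₗ N) z,
      R.coeffs 1 ⬝ᵥ (e.symm.toLinearMap ∘ₗ N) z, R.coeffs 2 ⬝ᵥ (e.symm.toLinearMap ∘ₗ N) z,
      R.coeffs 3 ⬝ᵥ (e.symm.toLinearMap ∘ₗ N) z, (e.symm.toLinearMap ∘ₗ N) z a,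
      (e.symm.toLinearMap ∘ₗ N) z b] = ![t₀ * z 0, t₁ * z 0, t₀ * z 1, t₁ * z 1, z 2, z 3] :=
    fun z => by rw [← hΛ, hM, hN]
  refine ⟨e.symm.toLinearMap ∘ₗ N, ?_, fun z => congrFun (hM' z) 4, fun z => congrFun (hM' z) 5,
    fun z => congrFun (hM' z) 0, fun z => congrFun (hM' z) 1, fun z => congrFun (hM' z) 2,
    fun z => congrFun (hM' z) 3, fun x h1 h2 => ?_⟩
  · refine e.symm.injective.comp ?_
    rw [← LinearMap.ker_eq_bot, LinearMap.ker_eq_bot']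
    intro z hz
    rw [hN] at hz
    have e0 := congrFun hz 0
    have e1 := congrFun hz 1
    have e2 := congrFun hz 2
    have e3 := congrFun hz 3
    have e4 := congrFun hz 4
    have e5 := congrFun hz 5
    simp at e0 e1 e2 e3 e4 e5
    ext i
    fin_cases i <;> simp <;> tauto
  · obtain ⟨u, hu, hu'⟩ := exists_of_cross_eq ht h1
    obtain ⟨v, hv, hv'⟩ := exists_of_cross_eq ht h2
    refine ⟨![u, v, x a, x b], hinj ?_⟩
    rw [hM, hN, hΛ]
    simp [hu, hu', hv, hv']

namespace IsFiberParam

variable {R} {t₀ t₁ : K} {M : (Fin 4 → K) →ₗ[K] (Fin 6 → K)}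

lemma apply_eq (hM : R.IsFiberParam t₀ t₁ a b M) (h : IsRankFourMember s a b) (z : Fin 4 → K)
    (i : Fin 6) : M z i = z 0 * M (Pi.single 0 1) i + z 1 * M (Pi.single 1 1) i +
      (if i = a then z 2 else 0) + (if i = b then z 3 else 0) := by
  by_cases hia : i = a
  · subst hia; simp [hM.coord_a, h.ne]
  · by_cases hib : i = b
    · subst hib; simp [hM.coord_b, h.ne.symm]
    · have : (M z - z 0 • M (Pi.single 0 1) - z 1 • M (Pi.single 1 1)) i = 0 := by
        refine R.eq_zero_of_coeffs (fun k => ?_) (h.net_ne_zero hia hib)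
        fin_cases k <;>
          simp [dotProduct_sub, hM.form_zero, hM.form_one, hM.form_two, hM.form_three] <;> ring
      simp only [Pi.sub_apply, Pi.smul_apply, smul_eq_mul] at this
      simp only [hia, hib, if_false]
      linear_combination this

/-- The parameters `z₂` and `z₃` enter only the coordinates `a` and `b`, on which `z₀` and `z₁` have
no influence, so there are no cross terms. -/
lemma diagForm_apply (hM : R.IsFiberParam t₀ t₁ a b M) (h : IsRankFourMember s a b)
    (c : Fin 6 → K) (z : Fin 4 → K) : diagForm c (M z) =
      c a * z 2 ^ 2 + c b * z 3 ^ 2 - bq (restrictForm M c) (z 0) (z 1) := by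
  have hterm : ∀ i, c i * M z i ^ 2 =
      c i * (z 0 * M (Pi.single 0 1) i + z 1 * M (Pi.single 1 1) i) ^ 2 +
        (if i = a then c i * z 2 ^ 2 else 0) + (if i = b then c i * z 3 ^ 2 else 0) := by
    intro i
    rw [hM.apply_eq h z i]
    by_cases hia : i = a
    · subst hia; simp [hM.coord_a, h.ne]
    · by_cases hib : i = b
      · subst hib; simp [hM.coord_b, h.ne.symm]
      · simp [hia, hib]
  rw [bq_restrictForm, diagForm, Finset.sum_congr rfl fun i _ => hterm i, Finset.sum_add_distrib,
    Finset.sum_add_distrib]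
  simp
  ring

lemma curveModel {t : P1 K} (hM : R.IsFiberParam (t.rep 0) (t.rep 1) a b M)
    (h : IsRankFourMember s a b) {sa sb : Fin 3 → K} (hc : IsComplement s sa sb a b) :
    CurveModel (R.fiber t) M (restrictForm M (net sa)) (restrictForm M (net sb)) := by
  have hcone : ∀ z, M z ∈ buchiCone K ↔
      z ∈ curveCone (restrictForm M (net sa)) (restrictForm M (net sb)) := by
    intro z
    rw [hc.mem_buchiCone_iff, hM.diagForm_apply h (net sa), hM.diagForm_apply h (net sb),
      hc.left_left, hc.left_right, hc.right_left, hc.right_right]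
    simp [hM.diagForm_net_eq_zero, curveCone, sub_eq_zero]
  refine ⟨hM.inj, fun p => ?_⟩
  rw [R.mem_fiber_iff, mem_buchiK3_iff]
  constructor
  · rintro ⟨h1, h2, h3⟩
    obtain ⟨z, hz⟩ := hM.surj _ h2 h3
    exact ⟨z, (hcone z).1 (hz ▸ h1), hz⟩
  · rintro ⟨z, hz, e⟩
    rw [← e]
    refine ⟨(hcone z).2 hz, ?_, ?_⟩
    · rw [hM.form_zero, hM.form_one]; ring
    · rw [hM.form_two, hM.form_three]; ring

end IsFiberParam

end Ruling

end

/-! ### Tangent spaces and nonvanishing of the forms on fibers; fibers of type `I₂` -/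

section

lemma fiberEquations_isHomogeneous {Q : QuadraticForm K (Fin 6 → K)} (R : Ruling Q) (t : P1 K) :
    ∀ F ∈ R.fiberEquations t, ∃ n, F.IsHomogeneous n := by
  have hsq : ∀ i : Fin 6, (X i ^ 2 : MvPolynomial (Fin 6) K).IsHomogeneous 2 :=
    fun i => isHomogeneous_X_pow i 2
  have htwo : ∀ i : Fin 6, (2 * X i ^ 2 : MvPolynomial (Fin 6) K).IsHomogeneous 2 := fun i => by
    rw [← map_ofNat C 2]
    exact isHomogeneous_C_mul_X_pow _ _ _
  rintro F ((rfl | rfl | rfl) | (rfl | rfl))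
  · exact ⟨2, (((hsq _).sub (htwo _)).add (hsq _)).sub (htwo _)⟩
  · exact ⟨2, (((hsq _).sub (htwo _)).add (hsq _)).sub (htwo _)⟩
  · exact ⟨2, (((hsq _).sub (htwo _)).add (hsq _)).sub (htwo _)⟩
  · exact ⟨1, ((linearForm_isHomogeneous _).C_mul _).sub ((linearForm_isHomogeneous _).C_mul _)⟩
  · exact ⟨1, ((linearForm_isHomogeneous _).C_mul _).sub ((linearForm_isHomogeneous _).C_mul _)⟩

lemma dirDeriv_linearForm (x y c : Fin 6 → K) : dirDeriv x y (linearForm c) = c ⬝ᵥ y := by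
  simp [linearForm, dirDeriv_sum, dirDeriv_mul, dotProduct]

lemma rep_ne_zero_pair (t : P1 K) : ¬ (t.rep 0 = 0 ∧ t.rep 1 = 0) := by
  rintro ⟨h0, h1⟩
  apply t.rep_nonzero
  ext i; fin_cases i
  · exact h0
  · exact h1

lemma sum_eq_zero_of_buchiEquations [CharZero K] {x y : Fin 6 → K}
    (h : ∀ F ∈ buchiEquations K, dirDeriv x y F = 0) (s : Fin 3 → K) :
    ∑ i, net s i * x i * y i = 0 := by
  have two : ∀ F : MvPolynomial (Fin 6) K, dirDeriv x y (2 * F) = 2 * dirDeriv x y F := fun F => by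
    rw [← map_ofNat C 2, dirDeriv_mul]; simp
  have h1 := h _ (Or.inl rfl)
  have h2 := h _ (Or.inr (Or.inl rfl))
  have h3 := h _ (Or.inr (Or.inr rfl))
  simp only [dirDeriv_sub, dirDeriv_add, two, pow_two, dirDeriv_mul, dirDeriv_X, eval_X] at h1 h2 h3
  rw [net_eq, Fin.sum_univ_six]
  simp only [Matrix.cons_val]
  linear_combination (s 0 * h1 + s 1 * h2 + s 2 * h3) / 2

namespace Ruling

variable [CharZero K] {s : Fin 3 → K} {a b : Fin 6} {R : Ruling (diagQuad (net s))}

namespace IsFiberParam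

variable {t₀ t₁ : K} {M : (Fin 4 → K) →ₗ[K] (Fin 6 → K)}

lemma two_mul_sum (hM : R.IsFiberParam t₀ t₁ a b M) (h : IsRankFourMember s a b)
    (c : Fin 6 → K) (z y : Fin 4 → K) : 2 * ∑ i, c i * M z i * M y i =
      c a * (2 * z 2 * y 2) + c b * (2 * z 3 * y 3) - bqDeriv (restrictForm M c) z y := by
  have h1 := diagForm_add_vec c (M z) (M y)
  rw [← map_add] at h1
  simp only [hM.diagForm_apply h] at h1
  simp only [bq, Pi.add_apply] at h1
  rw [bqDeriv]
  linear_combination -h1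

lemma coneTangent_le {t : P1 K} (hM : R.IsFiberParam (t.rep 0) (t.rep 1) a b M)
    (h : IsRankFourMember s a b) {sa sb : Fin 3 → K} (hc : IsComplement s sa sb a b)
    (p : P5 K) (z : Fin 4 → K) (hz : M z = p.rep) : coneTangent (R.fiberEquations t) p ≤
      (LinearMap.ker (curveDifferential (restrictForm M (net sa))
        (restrictForm M (net sb)) z)).map M := by
  intro y hy
  rw [mem_coneTangent] at hy
  have h1 := hy _ (Or.inr (Or.inl rfl))
  have h2 := hy _ (Or.inr (Or.inr rfl))
  simp only [dirDeriv_sub, dirDeriv_mul, dirDeriv_C, dirDeriv_linearForm, eval_C, zero_mul,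
    zero_add, sub_eq_zero] at h1 h2
  obtain ⟨y, rfl⟩ := hM.surj _ h1 h2
  refine ⟨y, ?_, rfl⟩
  have h3 := sum_eq_zero_of_buchiEquations (fun F hF => hy F (Or.inl hF))
  rw [← hz] at h3
  have ea := hM.two_mul_sum h (net sa) z y
  have eb := hM.two_mul_sum h (net sb) z y
  rw [h3, hc.left_left, hc.left_right] at ea
  rw [h3, hc.right_left, hc.right_right] at eb
  refine mem_ker_curveDifferential.2 ⟨?_, ?_⟩
  · linear_combination -ea
  · linear_combination -eb

/-- If the form were zero, the line `z₂ = z₃ = 0` would give a two-dimensional space, in the four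
coordinates other than `a` and `b`, isotropic for both `s` and `r`; the distinct ratios exclude
this. -/
lemma bqPoly_ne_zero [IsAlgClosed K] (hM : R.IsFiberParam t₀ t₁ a b M)
    (h : IsRankFourMember s a b) {r : Fin 3 → K} (hr : ∀ i j, i ≠ j → i ≠ a → i ≠ b → j ≠ a →
      j ≠ b → net s i * net r j ≠ net s j * net r i) :
    bqPoly (restrictForm M (net r)) ≠ 0 := by
  intro h0
  let ι := {i : Fin 6 // i ∉ ({a, b} : Finset (Fin 6))}
  have hι : Fintype.card ι = 4 := by
    simp only [ι]
    rw [Fintype.card_subtype, Finset.filter_notMem_eq_sdiff,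
      Finset.card_sdiff_of_subset (Finset.subset_univ _), Finset.card_pair h.ne]
    rfl
  let inc : (Fin 2 → K) →ₗ[K] (Fin 4 → K) :=
    LinearMap.pi ![LinearMap.proj 0, LinearMap.proj 1, 0, 0]
  have hinc : ∀ w, inc w = ![w 0, w 1, 0, 0] := by
    intro w; ext i; fin_cases i <;> rfl
  let N : (Fin 2 → K) →ₗ[K] (ι → K) := LinearMap.funLeft K K Subtype.val ∘ₗ M ∘ₗ inc
  have hN : ∀ w i, N w i = M (inc w) i.1 := fun w i => rfl
  have hsum : ∀ (c : Fin 6 → K) (w : Fin 2 → K), ∑ i : ι, c i.1 * N w i ^ 2 =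
      diagForm c (M (inc w)) := by
    intro c w
    simp only [hN, diagForm]
    rw [← Finset.sum_subtype ({a, b} : Finset (Fin 6))ᶜ (fun i => Finset.mem_compl)
      (fun i => c i * M (inc w) i ^ 2)]
    refine Finset.sum_subset (Finset.subset_univ _) fun i _ hi => ?_
    simp only [Finset.mem_compl, not_not, Finset.mem_insert, Finset.mem_singleton] at hi
    rcases hi with rfl | rfl
    · rw [hM.coord_a, hinc]; simp
    · rw [hM.coord_b, hinc]; simp
  have hinj : Function.Injective N := by
    rw [← LinearMap.ker_eq_bot, LinearMap.ker_eq_bot']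
    intro w hw
    have hMw : M (inc w) = 0 := by
      ext i
      by_cases hi : i ∈ ({a, b} : Finset (Fin 6))
      · simp only [Finset.mem_insert, Finset.mem_singleton] at hi
        rcases hi with rfl | rfl
        · rw [hM.coord_a, hinc]; rfl
        · rw [hM.coord_b, hinc]; rfl
      · exact congrFun hw ⟨i, hi⟩
    have := hM.inj (hMw.trans (map_zero M).symm)
    rw [hinc] at this
    ext i; fin_cases i
    · exact congrFun this 0
    · exact congrFun this 1
  have hrank : Module.finrank K (LinearMap.range N) = 2 := by
    rw [LinearMap.finrank_range_of_inj hinj, Module.finrank_fin_fun]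
  refine not_isotropic_of_distinct (a := fun i : ι => net s i.1) (b := fun i : ι => net r i.1)
    (W := LinearMap.range N) (fun i j hij => ?_) (by rw [hrank, hι]) (by rw [hrank]; norm_num) ?_ ?_
  · have hi := i.2
    have hj := j.2
    simp only [Finset.mem_insert, Finset.mem_singleton, not_or] at hi hj
    exact hr _ _ (fun e => hij (Subtype.ext e)) hi.1 hi.2 hj.1 hj.2
  · rintro _ ⟨w, rfl⟩
    rw [hsum, hM.diagForm_net_eq_zero]
  · rintro _ ⟨w, rfl⟩
    rw [hsum, hM.diagForm_apply h, hinc]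
    have := congrArg (eval w) h0
    rw [eval_bqPoly, map_zero] at this
    simp [this]

lemma bqPoly_left_ne_zero [IsAlgClosed K] (hM : R.IsFiberParam t₀ t₁ a b M)
    (h : IsRankFourMember s a b) {sa sb : Fin 3 → K} (hc : IsComplement s sa sb a b) :
    bqPoly (restrictForm M (net sa)) ≠ 0 :=
  hM.bqPoly_ne_zero h fun _ _ hij _ hib hja hjb =>
    h.ratio_ne hc.left_left hc.left_right hij hib hja hjb

lemma bqPoly_right_ne_zero [IsAlgClosed K] (hM : R.IsFiberParam t₀ t₁ a b M)
    (h : IsRankFourMember s a b) {sa sb : Fin 3 → K} (hc : IsComplement s sa sb a b) :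
    bqPoly (restrictForm M (net sb)) ≠ 0 :=
  hM.bqPoly_ne_zero h fun _ _ hij hia _ hja hjb =>
    h.swap.ratio_ne hc.right_right hc.right_left hij hia hjb hja

end IsFiberParam

/-- A fiber of type `I₂` is the union of two smooth conics. -/
lemma exists_smooth_conics_of_I2 [IsAlgClosed K] {Q : QuadraticForm K (Fin 6 → K)}
    (hQ : IsRankFourQuadricThroughX Q) (R : Ruling Q) (t : P1 K) (hI : R.IsFiberOfTypeI2 t) :
    ∃ C₁ C₂ : Set (P5 K), IsSmoothConic C₁ ∧ IsSmoothConic C₂ ∧ C₁ ≠ C₂ ∧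
      R.fiber t = C₁ ∪ C₂ := by
  obtain ⟨s, a, b, hab, hs, ha, hb, rfl⟩ := hQ.exists_net
  have h : IsRankFourMember s a b := ⟨hab, hs, ha, hb⟩
  obtain ⟨sa, sb, hc⟩ := h.exists_complement
  obtain ⟨M, hM⟩ := R.exists_fiberParam h (rep_ne_zero_pair t)
  obtain ⟨C₁, C₂, h1, h2, hun, ⟨p, q, hpq, hint⟩, -, -⟩ := hI
  exact (hM.curveModel h hc).exists_smooth_conics_of_union
    (hM.bqPoly_left_ne_zero h hc) (hM.bqPoly_right_ne_zero h hc) h1.1 h2.1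
    h1.2.2.1 h2.2.2.1 hun hpq hint

end Ruling

end

/-! ### Reducible fibers from planes -/

lemma eq_zero_or_eq_zero_of_mul {V : Type*} [AddCommGroup V] [Module K V] {p q : V →ₗ[K] K}
    (h : ∀ x, p x * q x = 0) : p = 0 ∨ q = 0 := by
  by_contra! hn
  obtain ⟨x, hx⟩ := DFunLike.ne_iff.1 hn.1
  obtain ⟨y, hy⟩ := DFunLike.ne_iff.1 hn.2
  rw [LinearMap.zero_apply] at hx hy
  have h1 : q x = 0 := by simpa [hx] using h x
  have h2 : p y = 0 := by simpa [hy] using h y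
  have h3 := h (x + y)
  rw [map_add, map_add, h1, h2] at h3
  simp [hx, hy] at h3

/-- A linear space on a quadric `ℓ₀ ℓ₃ = ℓ₁ ℓ₂` lies in a member of one of the two rulings. -/
lemma exists_ruling_member {V : Type*} [AddCommGroup V] [Module K V] {l₀ l₁ l₂ l₃ : V →ₗ[K] K}
    (h : ∀ x, l₀ x * l₃ x = l₁ x * l₂ x) : ∃ t₀ t₁ : K, ¬ (t₀ = 0 ∧ t₁ = 0) ∧
      ((∀ x, t₁ * l₀ x = t₀ * l₁ x ∧ t₁ * l₂ x = t₀ * l₃ x) ∨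
        ∀ x, t₁ * l₀ x = t₀ * l₂ x ∧ t₁ * l₁ x = t₀ * l₃ x) := by
  by_cases h0 : l₀ = 0
  · subst h0
    refine ⟨0, 1, by simp, ?_⟩
    rcases eq_zero_or_eq_zero_of_mul (p := l₁) (q := l₂) fun x => by simp [← h x] with rfl | rfl
    · right; simp
    · left; simp
  · obtain ⟨e, he⟩ := DFunLike.ne_iff.1 h0
    rw [LinearMap.zero_apply] at he
    -- On the kernel of `l₀` the product `l₁ l₂` vanishes; projecting to this kernel along `e` gives
    -- the identity, so `l₁` or `l₂` is a multiple of `l₀`.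
    have key : ∀ x, (l₁ - (l₁ e / l₀ e) • l₀) x * (l₂ - (l₂ e / l₀ e) • l₀) x = 0 := by
      intro x
      have h1 := h (x - (l₀ x / l₀ e) • e)
      simp only [map_sub, map_smul, smul_eq_mul, LinearMap.sub_apply, LinearMap.smul_apply] at h1 ⊢
      have h2 : l₀ x - l₀ x / l₀ e * l₀ e = 0 := by field_simp; ring
      rw [h2, zero_mul] at h1
      rw [h1]
      ring
    rcases eq_zero_or_eq_zero_of_mul key with h1 | h1
    · have h2 : ∀ x, l₁ x = l₁ e / l₀ e * l₀ x := fun x => by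
        simpa [sub_eq_zero] using LinearMap.congr_fun h1 x
      have h3 := (eq_zero_or_eq_zero_of_mul (p := l₀) (q := l₃ - (l₁ e / l₀ e) • l₂) fun x => by
        simp only [LinearMap.sub_apply, LinearMap.smul_apply, smul_eq_mul]
        linear_combination h x + l₂ x * h2 x).resolve_left h0
      refine ⟨1, l₁ e / l₀ e, by simp, .inl fun x => ⟨by rw [h2 x]; ring, ?_⟩⟩
      have := LinearMap.congr_fun h3 x
      simp only [LinearMap.sub_apply, LinearMap.smul_apply, smul_eq_mul, LinearMap.zero_apply] at this
      linear_combination -this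
    · have h2 : ∀ x, l₂ x = l₂ e / l₀ e * l₀ x := fun x => by
        simpa [sub_eq_zero] using LinearMap.congr_fun h1 x
      have h3 := (eq_zero_or_eq_zero_of_mul (p := l₀) (q := l₃ - (l₂ e / l₀ e) • l₁) fun x => by
        simp only [LinearMap.sub_apply, LinearMap.smul_apply, smul_eq_mul]
        linear_combination h x + l₁ x * h2 x).resolve_left h0
      refine ⟨1, l₂ e / l₀ e, by simp, .inr fun x => ⟨by rw [h2 x]; ring, ?_⟩⟩
      have := LinearMap.congr_fun h3 x
      simp only [LinearMap.sub_apply, LinearMap.smul_apply, smul_eq_mul, LinearMap.zero_apply] at this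
      linear_combination -this

lemma exists_functional_of_finrank_eq_three {W : Submodule K (Fin 4 → K)}
    (hW : Module.finrank K W = 3) : ∃ p : Fin 4 → K, p ≠ 0 ∧ ∀ z,
      p 0 * z 0 + p 1 * z 1 + p 2 * z 2 + p 3 * z 3 = 0 → z ∈ W := by
  have hlt : W < ⊤ := by
    rw [lt_top_iff_ne_top]
    rintro rfl
    simp at hW
  obtain ⟨φ, hφ, hle⟩ := Submodule.exists_le_ker_of_lt_top W hlt
  have hker : Module.finrank K (LinearMap.ker φ) = 3 := by
    have h1 := LinearMap.finrank_range_add_finrank_ker φ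
    rw [LinearMap.range_eq_top.2 (LinearMap.surjective hφ), finrank_top, Module.finrank_self,
      Module.finrank_fin_fun] at h1
    omega
  have heq : W = LinearMap.ker φ := Submodule.eq_of_le_of_finrank_eq hle (by rw [hW, hker])
  have happ : ∀ z, φ z = ∑ i, φ (Pi.single i 1) * z i := by
    intro z
    rw [LinearMap.pi_apply_eq_sum_univ φ z]
    refine Finset.sum_congr rfl fun i _ => ?_
    rw [smul_eq_mul, mul_comm]
    congr 2
    ext j
    simp [Pi.single_apply, eq_comm]
  refine ⟨fun i => φ (Pi.single i 1), fun h0 => hφ ?_, fun z hz => ?_⟩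
  · ext i
    simpa using congrFun h0 i
  · rw [heq, LinearMap.mem_ker, happ, Fin.sum_univ_four]
    exact hz

/-- If some member of the pencil of quadrics through the curve contains a plane, then the curve is
reducible. -/
lemma CurveModel.isReducible_of_plane [IsAlgClosed K] [CharZero K] {Z : Set (P5 K)}
    {M : (Fin 4 → K) →ₗ[K] (Fin 6 → K)} {f g : Fin 3 → K} (h : CurveModel Z M f g)
    (hZ : IsZariskiClosed Z) (hf : bqPoly f ≠ 0) (hg : bqPoly g ≠ 0)
    {W : Submodule K (Fin 4 → K)} (hW : Module.finrank K W = 3) {α β : K}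
    (hαβ : ¬ (α = 0 ∧ β = 0)) (hvan : ∀ z ∈ W, α * (z 2 ^ 2 - bq f (z 0) (z 1)) +
      β * (z 3 ^ 2 - bq g (z 0) (z 1)) = 0) : IsReducible Z := by
  obtain ⟨p, hp, hpW⟩ := exists_functional_of_finrank_eq_three hW
  have van : ∀ x y z w, p 0 * x + p 1 * y + p 2 * z + p 3 * w = 0 →
      α * (z ^ 2 - bq f x y) + β * (w ^ 2 - bq g x y) = 0 :=
    fun x y z w e => hvan ![x, y, z, w] (hpW _ e)
  by_cases hα : α = 0
  · have hβ : β ≠ 0 := fun hβ => hαβ ⟨hα, hβ⟩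
    have hp3 : p 3 ≠ 0 := by
      intro h3
      have := van 0 0 0 1 (by simp [h3])
      simp [hα, bq, hβ] at this
    refine h.swap.isReducible_of_sq hZ hg (a := -p 0 / p 3) (b := -p 1 / p 3) (c := 0)
      fun u v w _ => ?_
    have := van u v 0 (-p 0 / p 3 * u + -p 1 / p 3 * v) (by field_simp; ring)
    rw [hα, zero_mul, zero_add] at this
    have := (mul_eq_zero.1 this).resolve_left hβ
    linear_combination this
  · by_cases hβ : β = 0
    · have hp2 : p 2 ≠ 0 := by
        intro h2
        have := van 0 0 1 0 (by simp [h2])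
        simp [hβ, bq, hα] at this
      refine h.isReducible_of_sq hZ hf (a := -p 0 / p 2) (b := -p 1 / p 2) (c := 0)
        fun u v w _ => ?_
      have := van u v (-p 0 / p 2 * u + -p 1 / p 2 * v) 0 (by field_simp; ring)
      rw [hβ, zero_mul, add_zero] at this
      have := (mul_eq_zero.1 this).resolve_left hα
      linear_combination this
    -- This point of the plane gives `α p₃² + β p₂² = 0`. Together with the plane's points having
    -- `z₃ = 0` or `z₂ = 0`, it forces `α f + β g = 0`, so on the curve `f` is the square of a
    -- multiple of `z₃`.
    · have h1 := van 0 0 (p 3) (-p 2) (by ring)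
      simp only [bq] at h1
      have hp2 : p 2 ≠ 0 := by
        intro h2
        have := van 0 0 1 0 (by simp [h2])
        simp [bq, hα] at this
      have key : ∀ u v, α * bq f u v + β * bq g u v = 0 := by
        intro u v
        have h2 := van (p 2 * u) (p 2 * v) (-(p 0 * u + p 1 * v)) 0 (by ring)
        have h3 := van (p 3 * u) (p 3 * v) 0 (-(p 0 * u + p 1 * v)) (by ring)
        simp only [bq] at h2 h3 ⊢
        have h4 : β * (p 2 ^ 2 * 2) * (α * (f 0 * u ^ 2 + f 1 * u * v + f 2 * v ^ 2) +
            β * (g 0 * u ^ 2 + g 1 * u * v + g 2 * v ^ 2)) = 0 := by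
          linear_combination -β * h2 + α * h3 +
            (α * (f 0 * u ^ 2 + f 1 * u * v + f 2 * v ^ 2) +
              β * (g 0 * u ^ 2 + g 1 * u * v + g 2 * v ^ 2)) * h1
        simpa [hβ, hp2] using h4
      obtain ⟨c, hc⟩ := exists_sq_eq (-β / α)
      refine h.isReducible_of_sq hZ hf (a := 0) (b := 0) (c := c) fun u v w hw => ?_
      have := key u v
      have e : (0 * u + 0 * v + c * w) ^ 2 = c ^ 2 * w ^ 2 := by ring
      rw [e, hc, hw]
      field_simp
      linear_combination -this

/-! ### The standard rulings of a quadric of rank four -/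

/-- The linear forms `r₀ x₀ + r₁ x₁`, `r₂ x₂ + r₃ x₃`, `r₂ x₂ - r₃ x₃`, `r₀ x₀ - r₁ x₁`, where the
coordinates are numbered by `σ`. -/
def standardCoeffs (σ : Fin 4 → Fin 6) (r : Fin 4 → K) : Fin 4 → Fin 6 → K :=
  ![Pi.single (σ 0) (r 0) + Pi.single (σ 1) (r 1), Pi.single (σ 2) (r 2) + Pi.single (σ 3) (r 3),
    Pi.single (σ 2) (r 2) - Pi.single (σ 3) (r 3), Pi.single (σ 0) (r 0) - Pi.single (σ 1) (r 1)]

lemma standardCoeffs_dotProduct (σ : Fin 4 → Fin 6) (r : Fin 4 → K) (x : Fin 6 → K) :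
    standardCoeffs σ r 0 ⬝ᵥ x = r 0 * x (σ 0) + r 1 * x (σ 1) ∧
    standardCoeffs σ r 1 ⬝ᵥ x = r 2 * x (σ 2) + r 3 * x (σ 3) ∧
    standardCoeffs σ r 2 ⬝ᵥ x = r 2 * x (σ 2) - r 3 * x (σ 3) ∧
    standardCoeffs σ r 3 ⬝ᵥ x = r 0 * x (σ 0) - r 1 * x (σ 1) := by
  simp [standardCoeffs, add_dotProduct, sub_dotProduct]

lemma exists_equiv_of_ne {a b : Fin 6} (hab : a ≠ b) :
    ∃ σ : Equiv.Perm (Fin 6), σ 4 = a ∧ σ 5 = b := by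
  refine ⟨Equiv.swap 4 a * Equiv.swap 5 (Equiv.swap 4 a b), ?_, ?_⟩
  · have h : Equiv.swap 4 a b ≠ 4 := by
      intro h
      rw [Equiv.swap_apply_eq_iff, Equiv.swap_apply_left] at h
      exact hab h.symm
    rw [Equiv.Perm.mul_apply, Equiv.swap_apply_of_ne_of_ne (by decide) h.symm,
      Equiv.swap_apply_left]
  · rw [Equiv.Perm.mul_apply, Equiv.swap_apply_left, Equiv.swap_apply_self]

lemma sum_eq_of_perm (σ : Equiv.Perm (Fin 6)) (F : Fin 6 → K) (h4 : F (σ 4) = 0)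
    (h5 : F (σ 5) = 0) : ∑ i, F i = F (σ 0) + F (σ 1) + F (σ 2) + F (σ 3) := by
  rw [← Equiv.sum_comp σ, Fin.sum_univ_six, h4, h5]
  ring

/-- The ruling given by the standard linear forms. -/
def standardRuling [CharZero K] {c : Fin 6 → K} (σ : Equiv.Perm (Fin 6)) {r : Fin 4 → K}
    (hr : ∀ i, r i ≠ 0) (h0 : r 0 ^ 2 = c (σ 0)) (h1 : r 1 ^ 2 = -c (σ 1))
    (h2 : r 2 ^ 2 = -c (σ 2)) (h3 : r 3 ^ 2 = c (σ 3)) (h4 : c (σ 4) = 0) (h5 : c (σ 5) = 0) :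
    Ruling (diagQuad c) where
  coeffs := standardCoeffs (fun i => σ (i.castLE (by norm_num))) r
  linearIndependent := by
    rw [Fintype.linearIndependent_iff]
    intro m hm
    have e := fun i => congrFun hm (σ i)
    simp only [Fin.sum_univ_four, standardCoeffs] at e
    have e0 := e 0
    have e1 := e 1
    have e2 := e 2
    have e3 := e 3
    simp at e0 e1 e2 e3
    have key : ∀ {x y p q : K}, p ≠ 0 → q ≠ 0 → x * p + y * p = 0 → x * q + -(y * q) = 0 →
        x = 0 ∧ y = 0 := by
      intro x y p q hp hq hxp hxq
      have h6 : x + y = 0 := mul_right_cancel₀ hp (by linear_combination hxp)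
      have h7 : x - y = 0 := mul_right_cancel₀ hq (by linear_combination hxq)
      exact ⟨by linear_combination (h6 + h7) / 2, by linear_combination (h6 - h7) / 2⟩
    obtain ⟨m0, m3⟩ := key (hr 0) (hr 1) e0 e1
    obtain ⟨m1, m2⟩ := key (hr 2) (hr 3) e2 e3
    intro i
    fin_cases i <;> assumption
  eq_form x := by
    obtain ⟨d0, d1, d2, d3⟩ := standardCoeffs_dotProduct
      (fun i : Fin 4 => σ (i.castLE (by norm_num))) r x
    rw [d0, d1, d2, d3, diagQuad_apply, diagForm, sum_eq_of_perm σ _ (by simp [h4]) (by simp [h5])]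
    change c (σ 0) * x (σ 0) ^ 2 + c (σ 1) * x (σ 1) ^ 2 + c (σ 2) * x (σ 2) ^ 2 +
      c (σ 3) * x (σ 3) ^ 2 = (r 0 * x (σ 0) + r 1 * x (σ 1)) * (r 0 * x (σ 0) - r 1 * x (σ 1)) -
      (r 2 * x (σ 2) + r 3 * x (σ 3)) * (r 2 * x (σ 2) - r 3 * x (σ 3))
    linear_combination -x (σ 0) ^ 2 * h0 + x (σ 1) ^ 2 * h1 + x (σ 2) ^ 2 * h2 - x (σ 3) ^ 2 * h3

section

/-! ### The standard pencils are elliptic -/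

lemma eq_of_cross_eq {t t' : P1 K} {x y : K} (hxy : ¬ (x = 0 ∧ y = 0))
    (h : t.rep 1 * x = t.rep 0 * y) (h' : t'.rep 1 * x = t'.rep 0 * y) : t = t' := by
  obtain ⟨u, hu, hu'⟩ := exists_of_cross_eq (rep_ne_zero_pair t) h
  obtain ⟨v, hv, hv'⟩ := exists_of_cross_eq (rep_ne_zero_pair t') h'
  have hu0 : u ≠ 0 := by rintro rfl; exact hxy ⟨by simp [hu], by simp [hu']⟩
  rw [← t.mk_rep, ← t'.mk_rep, Projectivization.mk_eq_mk_iff']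
  refine ⟨v / u, ?_⟩
  ext i
  fin_cases i
  · simp only [Pi.smul_apply, smul_eq_mul, Fin.zero_eta]
    field_simp
    linear_combination hu - hv
  · simp only [Pi.smul_apply, smul_eq_mul, Fin.mk_one]
    field_simp
    linear_combination hu' - hv'

namespace Ruling

/-- The pencil has no base points on the Büchi surface. -/
lemma existsUnique_mem_fiber [CharZero K] {s : Fin 3 → K} {a b : Fin 6}
    (R : Ruling (diagQuad (net s))) (h : IsRankFourMember s a b) {p : P5 K}
    (hp : p ∈ buchiK3 K) : ∃! t, p ∈ R.fiber t := by
  have hQ : (R.coeffs 0 ⬝ᵥ p.rep) * (R.coeffs 3 ⬝ᵥ p.rep) =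
      (R.coeffs 1 ⬝ᵥ p.rep) * (R.coeffs 2 ⬝ᵥ p.rep) := by
    rw [← sub_eq_zero, ← R.eq_diagForm]
    exact mem_buchiK3_iff.1 hp s
  have hrep : ∀ x y : K, ¬ (x = 0 ∧ y = 0) → ∃ t : P1 K, ∃ e : K, t.rep 0 = e * x ∧
      t.rep 1 = e * y := by
    intro x y hxy
    have hv : ![x, y] ≠ 0 := fun h0 => hxy ⟨congrFun h0 0, congrFun h0 1⟩
    obtain ⟨e, -, he⟩ := exists_rep_eq (K := K) hv
    exact ⟨_, e, congrFun he 0, congrFun he 1⟩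
  by_cases h01 : R.coeffs 0 ⬝ᵥ p.rep = 0 ∧ R.coeffs 1 ⬝ᵥ p.rep = 0
  · have h23 : ¬ (R.coeffs 2 ⬝ᵥ p.rep = 0 ∧ R.coeffs 3 ⬝ᵥ p.rep = 0) := by
      intro h23
      have hk : ∀ k, R.coeffs k ⬝ᵥ p.rep = 0 := by
        intro k; fin_cases k
        exacts [h01.1, h01.2, h23.1, h23.2]
      -- A base point would lie on the vertex of the cone, where only `x_a` and `x_b` survive; the
      -- two normalised equations then read `x_a² = 0` and `x_b² = 0`.
      obtain ⟨sa, sb, hc⟩ := h.exists_complement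
      have hx : ∀ i, i ≠ a → i ≠ b → p.rep i = 0 := fun i hia hib =>
        R.eq_zero_of_coeffs hk (h.net_ne_zero hia hib)
      have hX := mem_buchiK3_iff.1 hp
      have ea := hX sa
      have eb := hX sb
      rw [diagForm, Finset.sum_eq_single a] at ea
      · rw [diagForm, Finset.sum_eq_single b] at eb
        · rw [hc.left_left] at ea
          rw [hc.right_right] at eb
          apply p.rep_nonzero
          ext i
          by_cases hia : i = a
          · subst hia; simpa using ea
          · by_cases hib : i = b
            · subst hib; simpa using eb
            · exact hx i hia hib
        · intro i _ hib
          by_cases hia : i = a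
          · subst hia; simp [hc.right_left]
          · simp [hx i hia hib]
        · simp
      · intro i _ hia
        by_cases hib : i = b
        · subst hib; simp [hc.left_right]
        · simp [hx i hia hib]
      · simp
    obtain ⟨t, e, h0, h1⟩ := hrep _ _ h23
    refine ⟨t, R.mem_fiber_iff.2 ⟨hp, ?_, ?_⟩, fun t' ht' => ?_⟩
    · rw [h01.1, h01.2]; ring
    · rw [h0, h1]; ring
    · exact eq_of_cross_eq h23 (R.mem_fiber_iff.1 ht').2.2 (by rw [h0, h1]; ring)
  · obtain ⟨t, e, h0, h1⟩ := hrep _ _ h01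
    refine ⟨t, R.mem_fiber_iff.2 ⟨hp, ?_, ?_⟩, fun t' ht' => ?_⟩
    · rw [h0, h1]; ring
    · rw [h0, h1]; linear_combination -e * hQ
    · exact eq_of_cross_eq h01 (R.mem_fiber_iff.1 ht').2.1 (by rw [h0, h1]; ring)

end Ruling

/-- At `t₁ = 0` the value is `-pq t₀⁴ ≠ 0`, so all zeros lie in the affine chart, where they are
roots of a polynomial with constant term `-pq`. -/
lemma finite_zeros_on_P1 {p q m : K} (hp : p ≠ 0) (hq : q ≠ 0) :
    {t : P1 K | t.rep 0 ^ 2 * t.rep 1 ^ 2 * m ^ 2 -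
      (p * t.rep 0 ^ 2 + q * t.rep 1 ^ 2) * (p * t.rep 1 ^ 2 + q * t.rep 0 ^ 2) = 0}.Finite := by
  let F : Polynomial K := Polynomial.C (m ^ 2) * Polynomial.X ^ 2 -
    (Polynomial.C p * Polynomial.X ^ 2 + Polynomial.C q) *
      (Polynomial.C p + Polynomial.C q * Polynomial.X ^ 2)
  have hF : F ≠ 0 := by
    intro h0
    have := congrArg (Polynomial.eval 0) h0
    simp [F, hp, hq] at this
  have hne : ∀ t : P1 K, t.rep 0 ^ 2 * t.rep 1 ^ 2 * m ^ 2 -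
      (p * t.rep 0 ^ 2 + q * t.rep 1 ^ 2) * (p * t.rep 1 ^ 2 + q * t.rep 0 ^ 2) = 0 →
      t.rep 1 ≠ 0 := by
    intro t ht h1
    have h0 : t.rep 0 ≠ 0 := fun h0 => rep_ne_zero_pair t ⟨h0, h1⟩
    simp [h1, hp, hq, h0] at ht
  have hfin : {x : K | F.IsRoot x}.Finite := Polynomial.finite_setOfPred_isRoot hF
  refine Set.Finite.of_injOn (f := fun t : P1 K => t.rep 0 / t.rep 1) (fun t ht => ?_)
    (fun t ht t' ht' htt => ?_) hfin
  · have h1 := hne t ht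
    simp only [Set.mem_ofPred_eq, Polynomial.IsRoot.def, F, Polynomial.eval_sub,
      Polynomial.eval_mul, Polynomial.eval_add, Polynomial.eval_pow, Polynomial.eval_C,
      Polynomial.eval_X] at ht ⊢
    field_simp
    linear_combination ht
  · have h1 := hne t ht
    have h1' := hne t' ht'
    have e : t.rep 0 / t.rep 1 = t'.rep 0 / t'.rep 1 := htt
    rw [div_eq_div_iff h1 h1'] at e
    exact eq_of_cross_eq (x := t.rep 0) (y := t.rep 1) (rep_ne_zero_pair t) (mul_comm _ _)
      (by linear_combination e)

/-- The data defining the standard ruling of a member of rank four. -/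
structure IsStandard (s : Fin 3 → K) (a b : Fin 6) (σ : Equiv.Perm (Fin 6)) (r : Fin 4 → K) :
    Prop where
  rank : IsRankFourMember s a b
  four : σ 4 = a
  five : σ 5 = b
  zero : r 0 ^ 2 = net s (σ 0)
  one : r 1 ^ 2 = -net s (σ 1)
  two : r 2 ^ 2 = -net s (σ 2)
  three : r 3 ^ 2 = net s (σ 3)

namespace IsStandard

variable {s : Fin 3 → K} {a b : Fin 6} {σ : Equiv.Perm (Fin 6)} {r : Fin 4 → K}

/-- Changing the sign of `r₃` exchanges `ℓ₁` and `ℓ₂`, so it produces the other ruling. -/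
lemma flip (h : IsStandard s a b σ r) : IsStandard s a b σ ![r 0, r 1, r 2, -r 3] :=
  ⟨h.rank, h.four, h.five, h.zero, h.one, h.two, by simpa using h.three⟩

variable [CharZero K]

lemma net_ne_zero (h : IsStandard s a b σ r) {i : Fin 6} (h4 : i ≠ 4) (h5 : i ≠ 5) :
    net s (σ i) ≠ 0 :=
  h.rank.net_ne_zero (fun e => h4 (σ.injective (e.trans h.four.symm)))
    fun e => h5 (σ.injective (e.trans h.five.symm))

lemma root_ne_zero (h : IsStandard s a b σ r) (i : Fin 4) : r i ≠ 0 := by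
  have key : ∀ {x y : K}, x ^ 2 = y → y ≠ 0 → x ≠ 0 := by
    rintro x y e hy rfl; exact hy (by rw [← e]; ring)
  fin_cases i
  · exact key h.zero (h.net_ne_zero (by decide) (by decide))
  · exact key h.one (neg_ne_zero.2 (h.net_ne_zero (by decide) (by decide)))
  · exact key h.two (neg_ne_zero.2 (h.net_ne_zero (by decide) (by decide)))
  · exact key h.three (h.net_ne_zero (by decide) (by decide))

/-- The standard ruling. -/
def ruling (h : IsStandard s a b σ r) : Ruling (diagQuad (net s)) :=
  standardRuling σ h.root_ne_zero h.zero h.one h.two h.three (by rw [h.four, h.rank.left])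
    (by rw [h.five, h.rank.right])

lemma coeffs_dotProduct (h : IsStandard s a b σ r) (x : Fin 6 → K) :
    h.ruling.coeffs 0 ⬝ᵥ x = r 0 * x (σ 0) + r 1 * x (σ 1) ∧
    h.ruling.coeffs 1 ⬝ᵥ x = r 2 * x (σ 2) + r 3 * x (σ 3) ∧
    h.ruling.coeffs 2 ⬝ᵥ x = r 2 * x (σ 2) - r 3 * x (σ 3) ∧
    h.ruling.coeffs 3 ⬝ᵥ x = r 0 * x (σ 0) - r 1 * x (σ 1) :=
  standardCoeffs_dotProduct (fun i : Fin 4 => σ (i.castLE (by norm_num))) r x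

lemma bdisc_restrictForm (h : IsStandard s a b σ r) {t₀ t₁ : K}
    {M : (Fin 4 → K) →ₗ[K] (Fin 6 → K)} (hM : h.ruling.IsFiberParam t₀ t₁ a b M)
    (c : Fin 6 → K) : bdisc (restrictForm M c) / 4 =
      t₀ ^ 2 * t₁ ^ 2 * (c (σ 0) / (4 * r 0 ^ 2) - c (σ 1) / (4 * r 1 ^ 2) +
        (c (σ 2) / (4 * r 2 ^ 2) - c (σ 3) / (4 * r 3 ^ 2))) ^ 2 -
      ((c (σ 0) / (4 * r 0 ^ 2) + c (σ 1) / (4 * r 1 ^ 2)) * t₀ ^ 2 +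
        (c (σ 2) / (4 * r 2 ^ 2) + c (σ 3) / (4 * r 3 ^ 2)) * t₁ ^ 2) *
      ((c (σ 0) / (4 * r 0 ^ 2) + c (σ 1) / (4 * r 1 ^ 2)) * t₁ ^ 2 +
        (c (σ 2) / (4 * r 2 ^ 2) + c (σ 3) / (4 * r 3 ^ 2)) * t₀ ^ 2) := by
  have n0 := h.root_ne_zero 0
  have n1 := h.root_ne_zero 1
  have n2 := h.root_ne_zero 2
  have n3 := h.root_ne_zero 3
  have key : ∀ z : Fin 4 → K, M z (σ 0) = (t₀ * z 0 + t₁ * z 1) / (2 * r 0) ∧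
      M z (σ 1) = (t₀ * z 0 - t₁ * z 1) / (2 * r 1) ∧
      M z (σ 2) = (t₁ * z 0 + t₀ * z 1) / (2 * r 2) ∧
      M z (σ 3) = (t₁ * z 0 - t₀ * z 1) / (2 * r 3) := by
    intro z
    obtain ⟨d0, d1, d2, d3⟩ := h.coeffs_dotProduct (M z)
    rw [hM.form_zero] at d0
    rw [hM.form_one] at d1
    rw [hM.form_two] at d2
    rw [hM.form_three] at d3
    refine ⟨?_, ?_, ?_, ?_⟩
    · field_simp; linear_combination -d0 - d3
    · field_simp; linear_combination -d0 + d3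
    · field_simp; linear_combination -d1 - d2
    · field_simp; linear_combination -d1 + d2
  obtain ⟨a0, a1, a2, a3⟩ := key (Pi.single 0 1)
  obtain ⟨b0, b1, b2, b3⟩ := key (Pi.single 1 1)
  simp at a0 a1 a2 a3 b0 b1 b2 b3
  have a4 : M (Pi.single 0 1) (σ 4) = 0 := by rw [h.four, hM.coord_a]; simp
  have a5 : M (Pi.single 0 1) (σ 5) = 0 := by rw [h.five, hM.coord_b]; simp
  have b4 : M (Pi.single 1 1) (σ 4) = 0 := by rw [h.four, hM.coord_a]; simp
  have b5 : M (Pi.single 1 1) (σ 5) = 0 := by rw [h.five, hM.coord_b]; simp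
  have f0 : restrictForm M c 0 = -((c (σ 0) / (4 * r 0 ^ 2) + c (σ 1) / (4 * r 1 ^ 2)) * t₀ ^ 2 +
      (c (σ 2) / (4 * r 2 ^ 2) + c (σ 3) / (4 * r 3 ^ 2)) * t₁ ^ 2) := by
    change -∑ i, c i * M (Pi.single 0 1) i ^ 2 = _
    rw [sum_eq_of_perm σ _ (by simp [a4]) (by simp [a5]), a0, a1, a2, a3]
    field_simp
    ring
  have f2 : restrictForm M c 2 = -((c (σ 0) / (4 * r 0 ^ 2) + c (σ 1) / (4 * r 1 ^ 2)) * t₁ ^ 2 +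
      (c (σ 2) / (4 * r 2 ^ 2) + c (σ 3) / (4 * r 3 ^ 2)) * t₀ ^ 2) := by
    change -∑ i, c i * M (Pi.single 1 1) i ^ 2 = _
    rw [sum_eq_of_perm σ _ (by simp [b4]) (by simp [b5]), b0, b1, b2, b3]
    field_simp
    ring
  have f1 : restrictForm M c 1 = -2 * (t₀ * t₁ * (c (σ 0) / (4 * r 0 ^ 2) -
      c (σ 1) / (4 * r 1 ^ 2) + (c (σ 2) / (4 * r 2 ^ 2) - c (σ 3) / (4 * r 3 ^ 2)))) := by
    change -2 * ∑ i, c i * M (Pi.single 0 1) i * M (Pi.single 1 1) i = _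
    rw [sum_eq_of_perm σ _ (by simp [a4]) (by simp [a5]), a0, a1, a2, a3, b0, b1, b2, b3]
    field_simp
    ring
  rw [bdisc, f0, f1, f2]
  ring

/-- The discriminant is a quartic form in `t` whose extreme coefficients are multiples of `pq`.
Since the `r_i²` are the coefficients of `s` up to sign, `p` and `q` are differences of coefficient
ratios up to nonzero factors, hence nonzero. -/
lemma finite_bdisc_eq_zero (h : IsStandard s a b σ r) {c : Fin 6 → K}
    (hc : ∀ i j, i ≠ j → i ≠ a → i ≠ b → j ≠ a → j ≠ b → net s i * c j ≠ net s j * c i) :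
    {t : P1 K | ∃ M, h.ruling.IsFiberParam (t.rep 0) (t.rep 1) a b M ∧
      bdisc (restrictForm M c) = 0}.Finite := by
  have ha : ∀ i, i ≠ 4 → σ i ≠ a := fun i hi e => hi (σ.injective (e.trans h.four.symm))
  have hb : ∀ i, i ≠ 5 → σ i ≠ b := fun i hi e => hi (σ.injective (e.trans h.five.symm))
  have h01 := hc (σ 0) (σ 1) (σ.injective.ne (by decide)) (ha _ (by decide)) (hb _ (by decide))
    (ha _ (by decide)) (hb _ (by decide))
  have h23 := hc (σ 2) (σ 3) (σ.injective.ne (by decide)) (ha _ (by decide)) (hb _ (by decide))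
    (ha _ (by decide)) (hb _ (by decide))
  have n0 := h.root_ne_zero 0
  have n1 := h.root_ne_zero 1
  have n2 := h.root_ne_zero 2
  have n3 := h.root_ne_zero 3
  refine (finite_zeros_on_P1 (p := c (σ 0) / (4 * r 0 ^ 2) + c (σ 1) / (4 * r 1 ^ 2))
    (q := c (σ 2) / (4 * r 2 ^ 2) + c (σ 3) / (4 * r 3 ^ 2))
    (m := c (σ 0) / (4 * r 0 ^ 2) - c (σ 1) / (4 * r 1 ^ 2) +
        (c (σ 2) / (4 * r 2 ^ 2) - c (σ 3) / (4 * r 3 ^ 2))) ?_ ?_).subset ?_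
  · intro e
    field_simp at e
    apply h01
    linear_combination -c (σ 1) * h.zero - c (σ 0) * h.one + e
  · intro e
    field_simp at e
    apply h23
    linear_combination c (σ 3) * h.two + c (σ 2) * h.three - e
  · rintro t ⟨M, hM, hd⟩
    rw [Set.mem_ofPred_eq, ← h.bdisc_restrictForm hM c, hd, zero_div]

lemma isElliptic [IsAlgClosed K] (h : IsStandard s a b σ r) : h.ruling.IsElliptic := by
  obtain ⟨sa, sb, hc⟩ := h.rank.exists_complement
  refine ⟨fun p hp => h.ruling.existsUnique_mem_fiber h.rank hp, ?_⟩
  have fin1 := h.finite_bdisc_eq_zero (c := net sa) fun _ _ hij _ hib hja hjb =>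
    h.rank.ratio_ne hc.left_left hc.left_right hij hib hja hjb
  have fin2 := h.finite_bdisc_eq_zero (c := net sb) fun _ _ hij hia _ hja hjb =>
    h.rank.swap.ratio_ne hc.right_right hc.right_left hij hia hjb hja
  -- Common zeros of `f` and `g` on a fiber are points with `z₂ = z₃ = 0`, that is `x_a = x_b = 0`;
  -- each of these finitely many points lies on a single fiber.
  have fin3 : (⋃ p ∈ {p : P5 K | p ∈ buchiK3 K ∧ p.rep a = 0 ∧ p.rep b = 0},
      {t | p ∈ h.ruling.fiber t}).Finite := by
    refine h.rank.finite_points.biUnion fun p hp => Set.Subsingleton.finite fun t ht t' ht' => ?_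
    exact (h.ruling.existsUnique_mem_fiber h.rank hp.1).unique ht ht'
  refine ((fin1.union fin2).union fin3).subset fun t ht => ?_
  by_contra hn
  apply ht
  simp only [Set.mem_union, not_or] at hn
  obtain ⟨⟨h1, h2⟩, h3⟩ := hn
  obtain ⟨M, hM⟩ := h.ruling.exists_fiberParam h.rank (rep_ne_zero_pair t)
  have hmodel := hM.curveModel h.rank hc
  refine hmodel.smooth_genus_one (fiberEquations_isHomogeneous _ t)
    (fun p z _ hz => hM.coneTangent_le h.rank hc p z hz) (fun e => h1 ⟨M, hM, e⟩)
    (fun e => h2 ⟨M, hM, e⟩) fun z hz hz2 hz3 => ?_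
  by_contra hz0
  have hmem := hmodel.mk_mem hz hz0
  obtain ⟨e, -, he⟩ := exists_rep_eq (K := K) (hmodel.map_ne_zero hz0)
  refine h3 (Set.mem_biUnion ⟨(h.ruling.mem_fiber_iff.1 hmem).1, ?_, ?_⟩ hmem)
  · rw [he, Pi.smul_apply, hM.coord_a, hz2, smul_zero]
  · rw [he, Pi.smul_apply, hM.coord_b, hz3, smul_zero]

end IsStandard

/-! ### From a plane conic to a reducible fiber of an elliptic pencil -/

lemma IsRankFourMember.exists_isStandard [IsAlgClosed K] {s : Fin 3 → K} {a b : Fin 6}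
    (h : IsRankFourMember s a b) : ∃ σ r, IsStandard s a b σ r := by
  obtain ⟨σ, h4, h5⟩ := exists_equiv_of_ne h.ne
  obtain ⟨r0, h0⟩ := exists_sq_eq (net s (σ 0))
  obtain ⟨r1, h1⟩ := exists_sq_eq (-net s (σ 1))
  obtain ⟨r2, h2⟩ := exists_sq_eq (-net s (σ 2))
  obtain ⟨r3, h3⟩ := exists_sq_eq (net s (σ 3))
  exact ⟨σ, ![r0, r1, r2, r3], h, h4, h5, h0, h1, h2, h3⟩

/-- A subspace contained in a quadric of rank four lies in a member of a standard ruling. -/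
lemma exists_isStandard_of_isotropic [IsAlgClosed K] [CharZero K] {s : Fin 3 → K} {a b : Fin 6}
    (h : IsRankFourMember s a b) {W : Submodule K (Fin 6 → K)}
    (hW : ∀ x ∈ W, diagForm (net s) x = 0) : ∃ σ r, ∃ h : IsStandard s a b σ r, ∃ t : P1 K,
      ∀ x ∈ W, t.rep 1 * (h.ruling.coeffs 0 ⬝ᵥ x) = t.rep 0 * (h.ruling.coeffs 1 ⬝ᵥ x) ∧
        t.rep 1 * (h.ruling.coeffs 2 ⬝ᵥ x) = t.rep 0 * (h.ruling.coeffs 3 ⬝ᵥ x) := by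
  obtain ⟨σ, r, hst⟩ := h.exists_isStandard
  let ℓ : Fin 4 → W →ₗ[K] K := fun k => dotProductBilin K K (hst.ruling.coeffs k) ∘ₗ W.subtype
  have hℓ : ∀ k (x : W), ℓ k x = hst.ruling.coeffs k ⬝ᵥ x.1 := fun k x => rfl
  obtain ⟨t₀, t₁, ht, hcases⟩ := exists_ruling_member (l₀ := ℓ 0) (l₁ := ℓ 1) (l₂ := ℓ 2)
    (l₃ := ℓ 3) fun x => by
      have := hW x.1 x.2
      rw [hst.ruling.eq_diagForm, sub_eq_zero] at this
      simpa only [hℓ] using this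
  have hv : ![t₀, t₁] ≠ 0 := fun h0 => ht ⟨congrFun h0 0, congrFun h0 1⟩
  obtain ⟨e, -, he⟩ := exists_rep_eq (K := K) hv
  have e0 : (Projectivization.mk K ![t₀, t₁] hv).rep 0 = e * t₀ := congrFun he 0
  have e1 : (Projectivization.mk K ![t₀, t₁] hv).rep 1 = e * t₁ := congrFun he 1
  rcases hcases with hc | hc
  · refine ⟨σ, r, hst, Projectivization.mk K ![t₀, t₁] hv, fun x hx => ?_⟩
    obtain ⟨h1, h2⟩ := hc ⟨x, hx⟩
    simp only [hℓ] at h1 h2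
    rw [e0, e1]
    exact ⟨by linear_combination e * h1, by linear_combination e * h2⟩
  · refine ⟨σ, _, hst.flip, Projectivization.mk K ![t₀, t₁] hv, fun x hx => ?_⟩
    obtain ⟨h1, h2⟩ := hc ⟨x, hx⟩
    simp only [hℓ] at h1 h2
    obtain ⟨d0, d1, d2, d3⟩ := hst.coeffs_dotProduct x
    obtain ⟨d0', d1', d2', d3'⟩ := hst.flip.coeffs_dotProduct x
    simp only [Matrix.cons_val] at d0' d1' d2' d3'
    rw [e0, e1, d0', d1', d2', d3']
    rw [d0, d2] at h1
    rw [d1, d3] at h2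
    exact ⟨by linear_combination e * h1, by linear_combination e * h2⟩

/-- Every conic on the Büchi surface is contained in a reducible fiber of an elliptic pencil. -/
lemma exists_elliptic_of_conic [IsAlgClosed K] [CharZero K] {C : Set (P5 K)} (hC : IsConic C)
    (hX : C ⊆ buchiK3 K) : ∃ Q : QuadraticForm K (Fin 6 → K), IsRankFourQuadricThroughX Q ∧
      ∃ R : Ruling Q, R.IsElliptic ∧ ∃ t : P1 K, IsReducible (R.fiber t) ∧ C ⊆ R.fiber t := by
  obtain ⟨W, q, hW, hq, rfl⟩ := hC
  obtain ⟨w, hw⟩ := exists_point_of_conic hq hX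
  obtain ⟨s, a, b, hab, hs, ha, hb, hiso⟩ := exists_rank_four_of_plane hW hw
  have h : IsRankFourMember s a b := ⟨hab, hs, ha, hb⟩
  obtain ⟨sa, sb, hc⟩ := h.exists_complement
  obtain ⟨σ, r, hst, t, ht⟩ := exists_isStandard_of_isotropic h hiso
  refine ⟨diagQuad (net s), isRankFourQuadricThroughX_diagQuad hs hab ha hb, hst.ruling,
    hst.isElliptic, t, ?_, fun p hp => ?_⟩
  · obtain ⟨M, hM⟩ := hst.ruling.exists_fiberParam h (rep_ne_zero_pair t)
    have hrange : W ≤ LinearMap.range M := fun x hx => hM.surj x (ht x hx).1 (ht x hx).2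
    have hW' : Module.finrank K (W.comap M) = 3 := by
      rw [(Submodule.equivMapOfInjective M hM.inj _).finrank_eq,
        Submodule.map_comap_eq_of_le hrange, hW]
    -- A nontrivial combination of the two complementary quadrics vanishing at `w`, hence on the
    -- whole plane; on the three-space of the fiber it becomes a member of the pencil generated by
    -- `z₂² - f` and `z₃² - g`.
    obtain ⟨α, β, hαβ, h0⟩ : ∃ α β : K, ¬ (α = 0 ∧ β = 0) ∧
        α * diagForm (net sa) w + β * diagForm (net sb) w = 0 := by
      by_cases h0 : diagForm (net sa) w = 0
      · exact ⟨1, 0, by simp, by simp [h0]⟩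
      · exact ⟨diagForm (net sb) w, -diagForm (net sa) w, fun h => h0 (by simpa using h.2), by ring⟩
    have hcl : IsZariskiClosed (hst.ruling.fiber t) :=
      ⟨_, fiberEquations_isHomogeneous hst.ruling t, rfl⟩
    refine (hM.curveModel h hc).isReducible_of_plane hcl (hM.bqPoly_left_ne_zero h hc)
      (hM.bqPoly_right_ne_zero h hc) hW' hαβ fun z hz => ?_
    have h1 := hw (α • sa + β • sb) (by simpa [diagForm_add, diagForm_smul] using h0) (M z) hz
    rw [map_add, map_smul, map_smul, diagForm_add, diagForm_smul, diagForm_smul,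
      hM.diagForm_apply h, hM.diagForm_apply h, hc.left_left, hc.left_right, hc.right_left,
      hc.right_right] at h1
    linear_combination h1
  · obtain ⟨hpW, -⟩ := id hp
    exact hst.ruling.mem_fiber_iff.2 ⟨hX hp, ht _ hpW⟩

end

end Buchi

end

theorem mainTheorem12 (K : Type*) [Field K] [IsAlgClosed K] [CharZero K] :
    (∀ C : Set (Buchi.P5 K), Buchi.IsConic C → C ⊆ Buchi.buchiK3 K →
      ∃ Q : QuadraticForm K (Fin 6 → K), Buchi.IsRankFourQuadricThroughX Q ∧
        ∃ R : Buchi.Ruling Q, R.IsElliptic ∧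
          ∃ t : Buchi.P1 K, Buchi.IsReducible (R.fiber t) ∧ C ⊆ R.fiber t) ∧
    (∀ Q : QuadraticForm K (Fin 6 → K), Buchi.IsRankFourQuadricThroughX Q →
      ∀ (R : Buchi.Ruling Q) (t : Buchi.P1 K), R.IsFiberOfTypeI2 t →
        ∃ C₁ C₂ : Set (Buchi.P5 K), Buchi.IsSmoothConic C₁ ∧ Buchi.IsSmoothConic C₂ ∧
          C₁ ≠ C₂ ∧ R.fiber t = C₁ ∪ C₂) :=
  ⟨fun _ hC hX => Buchi.exists_elliptic_of_conic hC hX,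
    fun _ hQ R t hI => R.exists_smooth_conics_of_I2 hQ t hI⟩
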